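/- **Conventions.** A *groupoid* means an étale groupoid $G$ (range and source maps $r,s\colon G\rightrightarrows G^0$ are local homeomorphisms, multiplication and inversion are continuous) whose object space $G^0$ is Hausdorff and locally compact; $G$ itself need not be Hausdorff. A *groupoid correspondence* $X\colon H\leftarrow G$ is a space $X$ with commuting continuous actions of $H$ on the left (anchor map $r\colon X\to H^0$) and $G$ on the right (anchor map $s\colon X\to G^0$) such that $s$ is a local homeomorphism and the right action is free and proper, that is, $(x,g)\mapsto(xg,x)$ is injective and proper. *The bicategory $\mathfrak{Gr}$.* Objects are groupoids, arrows $G\to H$ are groupoid correspondences $H\leftarrow G$, and 2-arrows are injective, $H,G$-equivariant, continuous maps. The composite of $X\colon H\leftarrow G$ and $Y\colon G\leftarrow K$ is the orbit space $X\circ_G Y$ of $X\times_{s,G^0,r}Y$ under $g\cdot(x,y)=(xg^{-1},gy)$, with $h[x,y]k=[hx,yk]$; horizontal composition of 2-arrows is $[x,y]\mapsto[\alpha(x),\beta(y)]$; the unit arrow on $G$ is $G$ with left and right multiplication; the associators are $[x_1,[x_2,x_3]]\mapsto[[x_1,x_2],x_3]$ and the unitors are $[h,x]\mapsto hx$ and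 $[x,g]\mapsto xg$. *The bicategory $\mathfrak{Corr}$.* Objects are $\mathrm C^*$-algebras, arrows $B\to A$ are $\mathrm C^*$-correspondences $A\leftarrow B$ (right Hilbert $B$-modules with a nondegenerate $^*$-representation of $A$ by adjointable operators), and 2-arrows are $A,B$-bimodule maps $\alpha$ with $\langle\alpha(x),\alpha(y)\rangle=\langle x,y\rangle$. Composition is the completed tensor product $\otimes_B$, the unit arrow on $A$ is $A$ with $\langle x,y\rangle=x^*y$, and the associators and unitors are the canonical ones. *The $\mathrm C^*$-constructions.* For a space $X$, let $\mathfrak S(X)$ be the linear span of the functions $X\to\mathbb C$ that are extensions by zero of functions in $\mathrm C_c(V)$ for open Hausdorff subsets $V\subseteq X$. For a groupoid $G$, $\mathfrak S(G)$ is a $^*$-algebra with $$(\xi*\eta)(g)=\sum_{r(h)=r(g)}\xi(h)\eta(h^{-1}g),\qquad \xi^*(g)=\overline{\xi(g^{-1})},$$ and $\mathrm C^*(G)$ is its completion in the largest $\mathrm C^*$-seminorm. For $X\colon H\leftarrow G$, the $\mathrm C^*$-correspondence $\mathrm C^*(X)\colon \mathrm C^*(H)\leftarrow\mathrm C^*(G)$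 is the completion of $\mathfrak S(X)$ for the inner product and actions $$\langle\xi,\eta\rangle(g)=\sum_{s(x)=r(g)}\overline{\xi(x)}\,\eta(xg),\quad (\xi*\gamma)(x)=\sum_{r(g)=s(x)}\xi(xg)\gamma(g^{-1}),\quad (\zeta*\xi)(x)=\sum_{r(h)=r(x)}\zeta(h)\xi(h^{-1}x)$$ for $\xi,\eta\in\mathfrak S(X)$, $\gamma\in\mathfrak S(G)$, $\zeta\in\mathfrak S(H)$. For a 2-arrow $\alpha\colon X\Rightarrow Y$, $\mathrm C^*(\alpha)\colon \mathrm C^*(X)\to \mathrm C^*(Y)$ is the isometric bimodule map that extends a function in $\mathfrak S(X)$ by zero along the injection $\alpha$. For $X\colon H\leftarrow G$ and $Y\colon G\leftarrow K$, let $\mu_{X,Y}\colon \mathrm C^*(X)\otimes_{\mathrm C^*(G)}\mathrm C^*(Y)\to \mathrm C^*(X\circ_G Y)$ be the map given on $f_1\in\mathfrak S(X)$, $f_2\in\mathfrak S(Y)$ by $$\mu_{X,Y}(f_1\otimes f_2)([x,y])=\sum_{g\in G,\ r(g)=s(x)} f_1(xg)\,f_2(g^{-1}y).$$ **Theorem.**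 $\mathfrak{Gr}$ and $\mathfrak{Corr}$ are bicategories, all the constructions above are well defined, and each $\mu_{X,Y}$ is a unitary isomorphism of $\mathrm C^*$-correspondences. The maps $G\mapsto\mathrm C^*(G)$ on objects, $X\mapsto\mathrm C^*(X)$ on arrows and $\alpha\mapsto\mathrm C^*(\alpha)$ on 2-arrows, together with the identity maps $\mathrm C^*(1_G)=1_{\mathrm C^*(G)}$ (induced by the identity of $\mathfrak S(G)$) and the unitaries $\mu_{X,Y}$, form a strictly unital homomorphism of bicategories $\mathfrak{Gr}\to\mathfrak{Corr}$. -/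

import Mathlib

open CategoryTheory Topology

universe w v u

/-! ### Étale groupoids -/

/-- An étale, locally compact groupoid: arrow space `Arr`, object space `Obj`, range `r`,
source `s`.  The product `mul g h` is defined when `s g = r h`.  The arrow space need not be
Hausdorff. -/
structure EtaleGroupoid : Type (u + 1) where
  Obj : Type u
  Arr : Type u
  [topObj : TopologicalSpace Obj]
  [topArr : TopologicalSpace Arr]
  [t2Obj : T2Space Obj]
  [locallyCompactObj : LocallyCompactSpace Obj]
  r : Arr → Obj
  s : Arr → Obj
  unit : Obj → Arr
  inv : Arr → Arr
  mul : (g h : Arr) → s g = r h → Arr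
  r_unit : ∀ x, r (unit x) = x
  s_unit : ∀ x, s (unit x) = x
  r_inv : ∀ g, r (inv g) = s g
  s_inv : ∀ g, s (inv g) = r g
  r_mul : ∀ g h e, r (mul g h e) = r g
  s_mul : ∀ g h e, s (mul g h e) = s h
  mul_assoc : ∀ g h k (e : s g = r h) (e' : s h = r k),
    mul (mul g h e) k ((s_mul g h e).trans e') = mul g (mul h k e') (e.trans (r_mul h k e').symm)
  unit_mul : ∀ g, mul (unit (r g)) g (s_unit (r g)) = g
  mul_unit : ∀ g, mul g (unit (s g)) (r_unit (s g)).symm = g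
  mul_inv : ∀ g, mul g (inv g) (r_inv g).symm = unit (r g)
  inv_mul : ∀ g, mul (inv g) g (s_inv g) = unit (s g)
  isLocalHomeomorph_r : IsLocalHomeomorph r
  isLocalHomeomorph_s : IsLocalHomeomorph s
  continuous_mul :
    Continuous fun p : {p : Arr × Arr // s p.1 = r p.2} => mul p.1.1 p.1.2 p.2
  continuous_inv : Continuous inv

attribute [instance] EtaleGroupoid.topObj EtaleGroupoid.topArr EtaleGroupoid.t2Obj
  EtaleGroupoid.locallyCompactObj

namespace EtaleGroupoid

variable (G : EtaleGroupoid.{u})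

theorem inv_mul_cancel_left (x g : G.Arr) (e : G.s x = G.r g) :
    G.mul (G.inv x) (G.mul x g e) ((G.s_inv x).trans (G.r_mul x g e).symm) = g := by
  have h := G.mul_assoc (G.inv x) x g (G.s_inv x) e
  rw [← h]
  have key : ∀ y (hy : y = G.unit (G.r g)) (ey : G.s y = G.r g), G.mul y g ey = g := by
    rintro y rfl ey
    exact G.unit_mul g
  exact key _ ((G.inv_mul x).trans (by rw [e])) _

theorem mul_inv_cancel_left (x y : G.Arr) (e : G.r x = G.r y) :
    G.mul x (G.mul (G.inv x) y ((G.s_inv x).trans e))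
      ((G.r_inv x).symm.trans (G.r_mul _ _ _).symm) = y := by
  have h := G.mul_assoc x (G.inv x) y (G.r_inv x).symm ((G.s_inv x).trans e)
  rw [← h]
  have key : ∀ z (hz : z = G.unit (G.r y)) (ez : G.s z = G.r y), G.mul z y ez = y := by
    rintro z rfl ez
    exact G.unit_mul y
  exact key _ ((G.mul_inv x).trans (by rw [e])) _

/-- The action map of right multiplication is a closed embedding: its image is the closed set
of pairs with equal range, and the inverse is `(y, x) ↦ (x, x⁻¹ y)`. -/
theorem isClosedEmbedding_mul :
    IsClosedEmbedding fun p : {p : G.Arr × G.Arr // G.s p.1 = G.r p.2} =>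
      (G.mul p.1.1 p.1.2 p.2, p.1.1) := by
  have hC : IsClosed {q : G.Arr × G.Arr | G.r q.1 = G.r q.2} :=
    isClosed_eq (G.isLocalHomeomorph_r.continuous.comp continuous_fst)
      (G.isLocalHomeomorph_r.continuous.comp continuous_snd)
  let e : {p : G.Arr × G.Arr // G.s p.1 = G.r p.2} ≃ₜ
      {q : G.Arr × G.Arr | G.r q.1 = G.r q.2} :=
    { toFun := fun p => ⟨(G.mul p.1.1 p.1.2 p.2, p.1.1), G.r_mul _ _ _⟩
      invFun := fun q => ⟨(q.1.2, G.mul (G.inv q.1.2) q.1.1 ((G.s_inv _).trans q.2.symm)),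
        (G.r_inv _).symm.trans (G.r_mul _ _ _).symm⟩
      left_inv := fun p => Subtype.ext (Prod.ext rfl (G.inv_mul_cancel_left _ _ p.2))
      right_inv := fun q => Subtype.ext (Prod.ext (G.mul_inv_cancel_left _ _ q.2.symm) rfl)
      continuous_toFun := by
        refine Continuous.subtype_mk (Continuous.prodMk G.continuous_mul ?_) _
        exact continuous_fst.comp continuous_subtype_val
      continuous_invFun := by
        refine Continuous.subtype_mk (Continuous.prodMk ?_ ?_) _
        · exact continuous_snd.comp continuous_subtype_val
        · have hc : Continuous fun q : {q : G.Arr × G.Arr | G.r q.1 = G.r q.2} =>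
              (⟨(G.inv q.1.2, q.1.1), (G.s_inv _).trans q.2.symm⟩ :
                {p : G.Arr × G.Arr // G.s p.1 = G.r p.2}) :=
            Continuous.subtype_mk (Continuous.prodMk
              (G.continuous_inv.comp (continuous_snd.comp continuous_subtype_val))
              (continuous_fst.comp continuous_subtype_val)) _
          exact G.continuous_mul.comp hc }
  exact hC.isClosedEmbedding_subtypeVal.comp e.isClosedEmbedding

end EtaleGroupoid

/-! ### Groupoid actions -/

/-- A right `G`-space structure on `X` with anchor map `s`. -/
structure RightAction (G : EtaleGroupoid.{u}) (X : Type u) [TopologicalSpace X] where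
  s : X → G.Obj
  act : (x : X) → (g : G.Arr) → s x = G.r g → X
  continuous_s : Continuous s
  continuous_act :
    Continuous fun p : {p : X × G.Arr // s p.1 = G.r p.2} => act p.1.1 p.1.2 p.2
  s_act : ∀ x g e, s (act x g e) = G.s g
  act_act : ∀ x g₁ g₂ (e₁ : s x = G.r g₁) (e₂ : G.s g₁ = G.r g₂),
    act (act x g₁ e₁) g₂ ((s_act x g₁ e₁).trans e₂) =
      act x (G.mul g₁ g₂ e₂) (e₁.trans (G.r_mul g₁ g₂ e₂).symm)
  act_unit : ∀ x, act x (G.unit (s x)) (G.r_unit (s x)).symm = x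

/-- A left `H`-space structure on `X` with anchor map `r`. -/
structure LeftAction (H : EtaleGroupoid.{u}) (X : Type u) [TopologicalSpace X] where
  r : X → H.Obj
  act : (h : H.Arr) → (x : X) → H.s h = r x → X
  continuous_r : Continuous r
  continuous_act :
    Continuous fun p : {p : H.Arr × X // H.s p.1 = r p.2} => act p.1.1 p.1.2 p.2
  r_act : ∀ h x e, r (act h x e) = H.r h
  act_act : ∀ h₁ h₂ x (e₁ : H.s h₁ = H.r h₂) (e₂ : H.s h₂ = r x),
    act h₁ (act h₂ x e₂) (e₁.trans (r_act h₂ x e₂).symm) =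
      act (H.mul h₁ h₂ e₁) x ((H.s_mul h₁ h₂ e₁).trans e₂)
  unit_act : ∀ x, act (H.unit (r x)) x (H.s_unit (r x)) = x

/-- The map `(x, g) ↦ (x · g, x)` from `X ×_{s,r} G` to `X × X`. -/
def RightAction.actionMap {G : EtaleGroupoid.{u}} {X : Type u} [TopologicalSpace X]
    (a : RightAction G X) (p : {p : X × G.Arr // a.s p.1 = G.r p.2}) : X × X :=
  (a.act p.1.1 p.1.2 p.2, p.1.1)

/-- A right action is free if its action map is injective. -/
def RightAction.IsFree {G : EtaleGroupoid.{u}} {X : Type u} [TopologicalSpace X]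
    (a : RightAction G X) : Prop :=
  Function.Injective a.actionMap

/-- A right action is proper if its action map is proper (universally closed). -/
def RightAction.IsProper {G : EtaleGroupoid.{u}} {X : Type u} [TopologicalSpace X]
    (a : RightAction G X) : Prop :=
  IsProperMap a.actionMap

/-! ### Groupoid correspondences and their 2-arrows -/

/-- A groupoid correspondence `H ← G`: a space with commuting actions of `H` on the left and
of `G` on the right, such that the right anchor map is a local homeomorphism and the right
action is free and proper. -/
structure GroupoidCorr (H G : EtaleGroupoid.{u}) : Type (u + 1) where
  carrier : Type u
  [top : TopologicalSpace carrier]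
  left : LeftAction H carrier
  right : RightAction G carrier
  s_left_act : ∀ h x e, right.s (left.act h x e) = right.s x
  r_right_act : ∀ x g e, left.r (right.act x g e) = left.r x
  act_comm : ∀ h x g (e : H.s h = left.r x) (e' : right.s x = G.r g),
    right.act (left.act h x e) g ((s_left_act h x e).trans e') =
      left.act h (right.act x g e') (e.trans (r_right_act x g e').symm)
  isLocalHomeomorph_s : IsLocalHomeomorph right.s
  isFree : right.IsFree
  isProper : right.IsProper

namespace GroupoidCorr

attribute [instance] GroupoidCorr.top

instance {H G : EtaleGroupoid.{u}} : CoeSort (GroupoidCorr H G) (Type u) := ⟨carrier⟩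

variable {H G : EtaleGroupoid.{u}} (X Y Z : GroupoidCorr H G)

/-- The left anchor map. -/
abbrev r (x : X) : H.Obj := X.left.r x

/-- The right anchor map. -/
abbrev s (x : X) : G.Obj := X.right.s x

/-- The left action `h · x`. -/
abbrev lact (h : H.Arr) (x : X) (e : H.s h = X.r x) : X := X.left.act h x e

/-- The right action `x · g`. -/
abbrev ract (x : X) (g : G.Arr) (e : X.s x = G.r g) : X := X.right.act x g e

/-- A 2-arrow: an injective, biequivariant, continuous map. -/
@[ext]
structure Hom where
  toFun : X → Y
  continuous_toFun : Continuous toFun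
  injective : Function.Injective toFun
  r_map : ∀ x, Y.r (toFun x) = X.r x
  s_map : ∀ x, Y.s (toFun x) = X.s x
  map_lact : ∀ h x (e : H.s h = X.r x),
    toFun (X.lact h x e) = Y.lact h (toFun x) (e.trans (r_map x).symm)
  map_ract : ∀ x g (e : X.s x = G.r g),
    toFun (X.ract x g e) = Y.ract (toFun x) g ((s_map x).trans e)

/-- Groupoid correspondences `H ← G` with injective biequivariant continuous maps, composed as
maps. -/
instance category : Category.{u} (GroupoidCorr H G) where
  Hom := Hom
  id X :=
    { toFun := fun x => x
      continuous_toFun := continuous_id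
      injective := fun _ _ h => h
      r_map := fun _ => rfl
      s_map := fun _ => rfl
      map_lact := fun _ _ _ => rfl
      map_ract := fun _ _ _ => rfl }
  comp {X Y Z} α β :=
    { toFun := fun x => β.toFun (α.toFun x)
      continuous_toFun := β.continuous_toFun.comp α.continuous_toFun
      injective := β.injective.comp α.injective
      r_map := fun x => (β.r_map _).trans (α.r_map x)
      s_map := fun x => (β.s_map _).trans (α.s_map x)
      map_lact := fun h x e => by
        simp only [α.map_lact h x e, β.map_lact]
      map_ract := fun x g e => by
        simp only [α.map_ract x g e, β.map_ract] }

/-- The identity correspondence: `G` acting on its arrow space by left and right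
multiplication. -/
def one (G : EtaleGroupoid.{u}) : GroupoidCorr G G where
  carrier := G.Arr
  left :=
    { r := G.r
      act := G.mul
      continuous_r := G.isLocalHomeomorph_r.continuous
      continuous_act := G.continuous_mul
      r_act := G.r_mul
      act_act := fun h₁ h₂ x e₁ e₂ => (G.mul_assoc h₁ h₂ x e₁ e₂).symm
      unit_act := G.unit_mul }
  right :=
    { s := G.s
      act := G.mul
      continuous_s := G.isLocalHomeomorph_s.continuous
      continuous_act := G.continuous_mul
      s_act := G.s_mul
      act_act := fun x g₁ g₂ e₁ e₂ => G.mul_assoc x g₁ g₂ e₁ e₂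
      act_unit := G.mul_unit }
  s_left_act := G.s_mul
  r_right_act := G.r_mul
  act_comm := fun h x g e e' => G.mul_assoc h x g e e'
  isLocalHomeomorph_s := G.isLocalHomeomorph_s
  isFree := G.isClosedEmbedding_mul.injective
  isProper := G.isClosedEmbedding_mul.isProperMap

end GroupoidCorr

/-! ### Bicategory structures on prescribed objects, arrows, 2-arrows and unit arrows -/

/-- The remaining data of a bicategory (composition of arrows, whiskering, associators, unitors,
with the usual axioms) when the objects `B`, the categories `Hom a b` of arrows and 2-arrows and
the unit arrows `one a` are given.  The fields are those of Mathlib's `Bicategory`. -/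
structure BicategoryOn (B : Type u) (Hom : B → B → Type v) [∀ a b, Category.{w} (Hom a b)]
    (one : ∀ a, Hom a a) where
  comp : ∀ {a b c : B}, Hom a b → Hom b c → Hom a c
  whiskerLeft : ∀ {a b c : B} (f : Hom a b) {g h : Hom b c} (_ : g ⟶ h), comp f g ⟶ comp f h
  whiskerRight : ∀ {a b c : B} {f g : Hom a b} (_ : f ⟶ g) (h : Hom b c), comp f h ⟶ comp g h
  associator : ∀ {a b c d : B} (f : Hom a b) (g : Hom b c) (h : Hom c d),
    comp (comp f g) h ≅ comp f (comp g h)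
  leftUnitor : ∀ {a b : B} (f : Hom a b), comp (one a) f ≅ f
  rightUnitor : ∀ {a b : B} (f : Hom a b), comp f (one b) ≅ f
  whiskerLeft_id : ∀ {a b c} (f : Hom a b) (g : Hom b c), whiskerLeft f (𝟙 g) = 𝟙 (comp f g)
  whiskerLeft_comp : ∀ {a b c} (f : Hom a b) {g h i : Hom b c} (η : g ⟶ h) (θ : h ⟶ i),
    whiskerLeft f (η ≫ θ) = whiskerLeft f η ≫ whiskerLeft f θ
  id_whiskerLeft : ∀ {a b} {f g : Hom a b} (η : f ⟶ g),
    whiskerLeft (one a) η = (leftUnitor f).hom ≫ η ≫ (leftUnitor g).inv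
  comp_whiskerLeft : ∀ {a b c d} (f : Hom a b) (g : Hom b c) {h h' : Hom c d} (η : h ⟶ h'),
    whiskerLeft (comp f g) η =
      (associator f g h).hom ≫ whiskerLeft f (whiskerLeft g η) ≫ (associator f g h').inv
  id_whiskerRight : ∀ {a b c} (f : Hom a b) (g : Hom b c), whiskerRight (𝟙 f) g = 𝟙 (comp f g)
  comp_whiskerRight : ∀ {a b c} {f g h : Hom a b} (η : f ⟶ g) (θ : g ⟶ h) (i : Hom b c),
    whiskerRight (η ≫ θ) i = whiskerRight η i ≫ whiskerRight θ i
  whiskerRight_id : ∀ {a b} {f g : Hom a b} (η : f ⟶ g),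
    whiskerRight η (one b) = (rightUnitor f).hom ≫ η ≫ (rightUnitor g).inv
  whiskerRight_comp : ∀ {a b c d} {f f' : Hom a b} (η : f ⟶ f') (g : Hom b c) (h : Hom c d),
    whiskerRight η (comp g h) =
      (associator f g h).inv ≫ whiskerRight (whiskerRight η g) h ≫ (associator f' g h).hom
  whisker_assoc : ∀ {a b c d} (f : Hom a b) {g g' : Hom b c} (η : g ⟶ g') (h : Hom c d),
    whiskerRight (whiskerLeft f η) h =
      (associator f g h).hom ≫ whiskerLeft f (whiskerRight η h) ≫ (associator f g' h).inv
  whisker_exchange : ∀ {a b c} {f g : Hom a b} {h i : Hom b c} (η : f ⟶ g) (θ : h ⟶ i),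
    whiskerLeft f θ ≫ whiskerRight η i = whiskerRight η h ≫ whiskerLeft g θ
  pentagon : ∀ {a b c d e} (f : Hom a b) (g : Hom b c) (h : Hom c d) (i : Hom d e),
    whiskerRight (associator f g h).hom i ≫
        (associator f (comp g h) i).hom ≫ whiskerLeft f (associator g h i).hom =
      (associator (comp f g) h i).hom ≫ (associator f g (comp h i)).hom
  triangle : ∀ {a b c} (f : Hom a b) (g : Hom b c),
    (associator f (one b) g).hom ≫ whiskerLeft f (leftUnitor g).hom =
      whiskerRight (rightUnitor f).hom g

/-- The resulting Mathlib bicategory. -/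
@[reducible]
def BicategoryOn.toBicategory {B : Type u} {Hom : B → B → Type v}
    [inst : ∀ a b, Category.{w} (Hom a b)] {one : ∀ a, Hom a a} (S : BicategoryOn B Hom one) :
    Bicategory.{w, v} B where
  Hom := Hom
  id := one
  comp := S.comp
  homCategory := inst
  whiskerLeft := S.whiskerLeft
  whiskerRight := S.whiskerRight
  associator := S.associator
  leftUnitor := S.leftUnitor
  rightUnitor := S.rightUnitor
  whiskerLeft_id := S.whiskerLeft_id
  whiskerLeft_comp := S.whiskerLeft_comp
  id_whiskerLeft := S.id_whiskerLeft
  comp_whiskerLeft := S.comp_whiskerLeft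
  id_whiskerRight := S.id_whiskerRight
  comp_whiskerRight := S.comp_whiskerRight
  whiskerRight_id := S.whiskerRight_id
  whiskerRight_comp := S.whiskerRight_comp
  whisker_assoc := S.whisker_assoc
  whisker_exchange := S.whisker_exchange
  pentagon := S.pentagon
  triangle := S.triangle

/-! ### The bicategory of groupoid correspondences -/

/-- `Z : H ← K` is the composite `X ∘_G Y` of `X : H ← G` and `Y : G ← K`: it comes with the map
`(x, y) ↦ [x, y]` from `X ×_{s,r} Y`, which is the quotient map by the orbits of the diagonal
action `g · (x, y) = (x · g⁻¹, g · y)`, and its anchor maps and actions are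
`r [x, y] = r x`, `s [x, y] = s y`, `h · [x, y] = [h · x, y]`, `[x, y] · k = [x, y · k]`. -/
structure GroupoidCorr.Composite {H G K : EtaleGroupoid.{u}} (X : GroupoidCorr H G)
    (Y : GroupoidCorr G K) (Z : GroupoidCorr H K) where
  cls : (x : X) → (y : Y) → X.s x = Y.r y → Z
  isQuotientMap_cls :
    IsQuotientMap fun p : {p : X × Y // X.s p.1 = Y.r p.2} => cls p.1.1 p.1.2 p.2
  cls_eq_cls_iff : ∀ x y (e : X.s x = Y.r y) x' y' (e' : X.s x' = Y.r y'),
    cls x y e = cls x' y' e' ↔ ∃ (g : G.Arr) (eg : G.s g = Y.r y),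
      X.ract x (G.inv g) (e.trans (eg.symm.trans (G.r_inv g).symm)) = x' ∧ Y.lact g y eg = y'
  r_cls : ∀ x y e, Z.r (cls x y e) = X.r x
  s_cls : ∀ x y e, Z.s (cls x y e) = Y.s y
  lact_cls : ∀ h x y (e : X.s x = Y.r y) (eh : H.s h = X.r x),
    Z.lact h (cls x y e) (eh.trans (r_cls x y e).symm) =
      cls (X.lact h x eh) y ((X.s_left_act h x eh).trans e)
  ract_cls : ∀ x y k (e : X.s x = Y.r y) (ek : Y.s y = K.r k),
    Z.ract (cls x y e) k ((s_cls x y e).trans ek) =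
      cls x (Y.ract y k ek) (e.trans (Y.r_right_act y k ek).symm)

/-- The bicategory of groupoid correspondences.  Objects are étale groupoids, the arrows `G ⟶ H`
are the correspondences `H ← G`, 2-arrows are injective biequivariant continuous maps, the unit
arrow is `G` itself and `Y ≫ X` is the composite `X ∘_G Y`.  All of this is explicit; the fields
only fix which copy of the orbit space `X ∘_G Y` is used, and they determine the horizontal
composition of 2-arrows (`[x, y] ↦ [α x, β y]`), the associators
(`[x₁, [x₂, x₃]] ↦ [[x₁, x₂], x₃]`) and the unitors (`[x, g] ↦ x · g`, `[h, x] ↦ h · x`). -/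
structure GrBicategory extends
    BicategoryOn EtaleGroupoid.{u} (fun G H => GroupoidCorr H G) GroupoidCorr.one where
  composite : ∀ {H G K : EtaleGroupoid.{u}} (X : GroupoidCorr H G) (Y : GroupoidCorr G K),
    X.Composite Y (comp Y X)
  whiskerLeft_cls : ∀ {H G K : EtaleGroupoid.{u}} (Y : GroupoidCorr G K) {X₁ X₂ : GroupoidCorr H G}
    (α : X₁ ⟶ X₂) x y (e : X₁.s x = Y.r y),
    (whiskerLeft Y α).toFun ((composite X₁ Y).cls x y e) =
      (composite X₂ Y).cls (α.toFun x) y ((α.s_map x).trans e)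
  whiskerRight_cls : ∀ {H G K : EtaleGroupoid.{u}} {Y₁ Y₂ : GroupoidCorr G K} (β : Y₁ ⟶ Y₂)
    (X : GroupoidCorr H G) x y (e : X.s x = Y₁.r y),
    (whiskerRight β X).toFun ((composite X Y₁).cls x y e) =
      (composite X Y₂).cls x (β.toFun y) (e.trans (β.r_map y).symm)
  associator_cls : ∀ {G₁ G₂ G₃ G₄ : EtaleGroupoid.{u}} (X₁ : GroupoidCorr G₁ G₂)
    (X₂ : GroupoidCorr G₂ G₃) (X₃ : GroupoidCorr G₃ G₄) x₁ x₂ x₃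
    (e : X₁.s x₁ = X₂.r x₂) (e' : X₂.s x₂ = X₃.r x₃),
    (associator X₃ X₂ X₁).hom.toFun
        ((composite X₁ (comp X₃ X₂)).cls x₁ ((composite X₂ X₃).cls x₂ x₃ e')
          (e.trans ((composite X₂ X₃).r_cls x₂ x₃ e').symm)) =
      (composite (comp X₂ X₁) X₃).cls ((composite X₁ X₂).cls x₁ x₂ e) x₃
        (((composite X₁ X₂).s_cls x₁ x₂ e).trans e')
  leftUnitor_cls : ∀ {H G : EtaleGroupoid.{u}} (X : GroupoidCorr H G) (x : X) (g : G.Arr)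
    (e : X.s x = G.r g),
    (leftUnitor X).hom.toFun ((composite X (GroupoidCorr.one G)).cls x g e) = X.ract x g e
  rightUnitor_cls : ∀ {H G : EtaleGroupoid.{u}} (X : GroupoidCorr H G) (h : H.Arr) (x : X)
    (e : H.s h = X.r x),
    (rightUnitor X).hom.toFun ((composite (GroupoidCorr.one H) X).cls h x e) = X.lact h x e

/-- Étale groupoids as the objects of the bicategory `𝔊`. -/
def GrBicategory.Ob (_ : GrBicategory.{u}) : Type (u + 1) := EtaleGroupoid.{u}

instance (𝔊 : GrBicategory.{u}) : Bicategory.{u, u + 1} 𝔊.Ob :=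
  𝔊.toBicategoryOn.toBicategory

/-! ### The bicategory of C*-correspondences -/

/-- A (not necessarily unital) C*-algebra. -/
structure CStarAlg : Type (u + 1) where
  carrier : Type u
  [str : NonUnitalCStarAlgebra carrier]

attribute [instance] CStarAlg.str

instance : CoeSort CStarAlg.{u} (Type u) := ⟨CStarAlg.carrier⟩

/-- A C*-correspondence `A ← B`: a (right) Hilbert `B`-module with a nondegenerate left action
of `A` by adjointable operators.  The inner product is linear in the second variable. -/
structure CStarCorr (A B : CStarAlg.{u}) : Type (u + 1) where
  carrier : Type u
  [normedAddCommGroup : NormedAddCommGroup carrier]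
  [normedSpace : NormedSpace ℂ carrier]
  [completeSpace : CompleteSpace carrier]
  inner : carrier →ₗ⋆[ℂ] carrier →ₗ[ℂ] B
  lact : A →ₗ[ℂ] carrier →ₗ[ℂ] carrier
  ract : carrier →ₗ[ℂ] B →ₗ[ℂ] carrier
  ract_mul : ∀ x b c, ract x (b * c) = ract (ract x b) c
  inner_ract : ∀ x y b, inner x (ract y b) = inner x y * b
  star_inner : ∀ x y, star (inner x y) = inner y x
  inner_self_nonneg : ∀ x, ∃ b : B, inner x x = star b * b
  norm_sq_eq : ∀ x, ‖x‖ ^ 2 = ‖inner x x‖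
  lact_mul : ∀ a a' x, lact (a * a') x = lact a (lact a' x)
  lact_ract : ∀ a x b, lact a (ract x b) = ract (lact a x) b
  inner_lact : ∀ a x y, inner (lact a x) y = inner x (lact (star a) y)
  nondegenerate : Dense (Submodule.span ℂ {z | ∃ a x, lact a x = z} : Set carrier)

namespace CStarCorr

attribute [instance] CStarCorr.normedAddCommGroup CStarCorr.normedSpace CStarCorr.completeSpace

instance {A B : CStarAlg.{u}} : CoeSort (CStarCorr A B) (Type u) := ⟨carrier⟩

variable {A B : CStarAlg.{u}} (E F : CStarCorr A B)

/-- A 2-arrow: an isometric bimodule map. -/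
@[ext]
structure Hom where
  toFun : E →ₗ[ℂ] F
  map_lact : ∀ a x, toFun (E.lact a x) = F.lact a (toFun x)
  map_ract : ∀ x b, toFun (E.ract x b) = F.ract (toFun x) b
  inner_map : ∀ x y, F.inner (toFun x) (toFun y) = E.inner x y

/-- C*-correspondences `A ← B` with isometric bimodule maps, composed as maps. -/
instance category : Category.{u} (CStarCorr A B) where
  Hom := Hom
  id E :=
    { toFun := LinearMap.id
      map_lact := fun _ _ => rfl
      map_ract := fun _ _ => rfl
      inner_map := fun _ _ => rfl }
  comp α β :=
    { toFun := β.toFun ∘ₗ α.toFun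
      map_lact := fun a x => by simp [α.map_lact, β.map_lact]
      map_ract := fun x b => by simp [α.map_ract, β.map_ract]
      inner_map := fun x y => by simp [α.inner_map, β.inner_map] }

/-- The unit correspondence: `A` as a bimodule over itself with `⟨x, y⟩ = x* y`. -/
noncomputable def one (A : CStarAlg.{u}) : CStarCorr A A where
  carrier := A
  inner := LinearMap.mk₂'ₛₗ (starRingEnd ℂ) (RingHom.id ℂ) (fun x y : A => star x * y)
    (fun x y z => by simp [add_mul]) (fun c x y => by simp [smul_mul_assoc])
    (fun x y z => by simp [mul_add]) (fun c x y => by simp [mul_smul_comm])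
  lact := LinearMap.mul ℂ A
  ract := LinearMap.mul ℂ A
  ract_mul x b c := by simp [mul_assoc]
  inner_ract x y b := by simp [mul_assoc]
  star_inner x y := by simp
  inner_self_nonneg x := ⟨x, rfl⟩
  norm_sq_eq x := by simp [CStarRing.norm_star_mul_self, sq]
  lact_mul a b x := by simp [mul_assoc]
  lact_ract a x b := by simp [mul_assoc]
  inner_lact a x y := by simp [mul_assoc]
  nondegenerate := by
    let := CStarAlgebra.spectralOrder A
    have := CStarAlgebra.spectralOrderedRing A
    have hu := CStarAlgebra.increasingApproximateUnit A
    intro x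
    have := hu.neBot
    refine mem_closure_of_tendsto (hu.tendsto_mul_right x) (Filter.Eventually.of_forall fun a => ?_)
    exact Submodule.subset_span ⟨a, x, rfl⟩

/-- `T : A ← C` is the completed tensor product `E ⊗_B F` of `E : A ← B` and `F : B ← C`: the
elementary tensors span a dense subspace, `⟨x ⊗ y, x' ⊗ y'⟩ = ⟨y, ⟨x, x'⟩ · y'⟩`, and the
actions are `a · (x ⊗ y) = (a · x) ⊗ y`, `(x ⊗ y) · c = x ⊗ (y · c)`. -/
structure TensorProduct {A B C : CStarAlg.{u}} (E : CStarCorr A B) (F : CStarCorr B C)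
    (T : CStarCorr A C) where
  tmul : E →ₗ[ℂ] F →ₗ[ℂ] T
  inner_tmul : ∀ x y x' y',
    T.inner (tmul x y) (tmul x' y') = F.inner y (F.lact (E.inner x x') y')
  lact_tmul : ∀ a x y, T.lact a (tmul x y) = tmul (E.lact a x) y
  ract_tmul : ∀ x y c, T.ract (tmul x y) c = tmul x (F.ract y c)
  dense_tmul : Dense (Submodule.span ℂ {z | ∃ x y, tmul x y = z} : Set T)

end CStarCorr

/-- The bicategory of C*-correspondences.  Objects are C*-algebras, the arrows `B ⟶ A` are the
correspondences `A ← B`, 2-arrows are isometric bimodule maps, the unit arrow is `A` itself and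
`F ≫ E` is the completed tensor product `E ⊗_B F`.  All of this is explicit; the fields only fix
which copy of the completion `E ⊗_B F` is used, and they determine the horizontal composition of
2-arrows, the associators and the unitors. -/
structure CorrBicategory extends
    BicategoryOn CStarAlg.{u} (fun B A => CStarCorr A B) CStarCorr.one where
  tensor : ∀ {A B C : CStarAlg.{u}} (E : CStarCorr A B) (F : CStarCorr B C),
    E.TensorProduct F (comp F E)
  whiskerLeft_tmul : ∀ {A B C : CStarAlg.{u}} (F : CStarCorr B C) {E₁ E₂ : CStarCorr A B}
    (α : E₁ ⟶ E₂) x y,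
    (whiskerLeft F α).toFun ((tensor E₁ F).tmul x y) = (tensor E₂ F).tmul (α.toFun x) y
  whiskerRight_tmul : ∀ {A B C : CStarAlg.{u}} {F₁ F₂ : CStarCorr B C} (β : F₁ ⟶ F₂)
    (E : CStarCorr A B) x y,
    (whiskerRight β E).toFun ((tensor E F₁).tmul x y) = (tensor E F₂).tmul x (β.toFun y)
  associator_tmul : ∀ {A₁ A₂ A₃ A₄ : CStarAlg.{u}} (E₁ : CStarCorr A₁ A₂)
    (E₂ : CStarCorr A₂ A₃) (E₃ : CStarCorr A₃ A₄) x₁ x₂ x₃,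
    (associator E₃ E₂ E₁).hom.toFun
        ((tensor E₁ (comp E₃ E₂)).tmul x₁ ((tensor E₂ E₃).tmul x₂ x₃)) =
      (tensor (comp E₂ E₁) E₃).tmul ((tensor E₁ E₂).tmul x₁ x₂) x₃
  leftUnitor_tmul : ∀ {A B : CStarAlg.{u}} (E : CStarCorr A B) (x : E) (b : B),
    (leftUnitor E).hom.toFun ((tensor E (CStarCorr.one B)).tmul x b) = E.ract x b
  rightUnitor_tmul : ∀ {A B : CStarAlg.{u}} (E : CStarCorr A B) (a : A) (x : E),
    (rightUnitor E).hom.toFun ((tensor (CStarCorr.one A) E).tmul a x) = E.lact a x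

/-- C*-algebras as the objects of the bicategory `ℭ`. -/
noncomputable def CorrBicategory.Ob (_ : CorrBicategory.{u}) : Type (u + 1) := CStarAlg.{u}

noncomputable instance (ℭ : CorrBicategory.{u}) : Bicategory.{u, u + 1} ℭ.Ob :=
  ℭ.toBicategoryOn.toBicategory

/-! ### The function spaces and their algebraic structure -/

/-- The space `𝔖(X)`: the linear span of the functions that are continuous with compact support
on some open Hausdorff subset `V`, extended by zero outside `V`. -/
def SFun (X : Type u) [TopologicalSpace X] : Submodule ℂ (X → ℂ) :=
  Submodule.span ℂ {f | ∃ V K : Set X, IsOpen V ∧ T2Space V ∧ IsCompact K ∧ K ⊆ V ∧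
    ContinuousOn f V ∧ ∀ x ∉ K, f x = 0}

/-- The convolution `(ξ * η)(g) = ∑_{r h = r g} ξ(h) η(h⁻¹ g)`. -/
noncomputable def EtaleGroupoid.conv (G : EtaleGroupoid.{u}) (ξ η : G.Arr → ℂ) : G.Arr → ℂ :=
  fun g => ∑ᶠ h : {h : G.Arr // G.r h = G.r g},
    ξ h.1 * η (G.mul (G.inv h.1) g ((G.s_inv h.1).trans h.2))

/-- The involution `ξ*(g) = conj ξ(g⁻¹)`. -/
noncomputable def EtaleGroupoid.involution (G : EtaleGroupoid.{u}) (ξ : G.Arr → ℂ) : G.Arr → ℂ :=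
  fun g => star (ξ (G.inv g))

namespace GroupoidCorr

variable {H G : EtaleGroupoid.{u}} (X : GroupoidCorr H G)

/-- `(ξ * γ)(x) = ∑_{r g = s x} ξ(x g) γ(g⁻¹)`. -/
noncomputable def rconv (ξ : X → ℂ) (γ : G.Arr → ℂ) : X → ℂ :=
  fun x => ∑ᶠ g : {g : G.Arr // X.s x = G.r g}, ξ (X.ract x g.1 g.2) * γ (G.inv g.1)

/-- `⟨ξ, η⟩(g) = ∑_{s x = r g} conj ξ(x) η(x g)`. -/
noncomputable def braket (ξ η : X → ℂ) : G.Arr → ℂ :=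
  fun g => ∑ᶠ x : {x : X // X.s x = G.r g}, star (ξ x.1) * η (X.ract x.1 g x.2)

/-- `(ζ * ξ)(x) = ∑_{r h = r x} ζ(h) ξ(h⁻¹ x)`. -/
noncomputable def lconv (ζ : H.Arr → ℂ) (ξ : X → ℂ) : X → ℂ :=
  fun x => ∑ᶠ h : {h : H.Arr // H.r h = X.r x},
    ζ h.1 * ξ (X.lact (H.inv h.1) x ((H.s_inv h.1).trans h.2))

/-- The value `∑_{r g = s x} f₁(x g) f₂(g⁻¹ y)` at `[x, y]` of the product of `f₁` and `f₂`. -/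
noncomputable def pairing {K : EtaleGroupoid.{u}} (Y : GroupoidCorr G K) (f₁ : X → ℂ)
    (f₂ : Y → ℂ) (x : X) (y : Y) (e : X.s x = Y.r y) : ℂ :=
  ∑ᶠ g : {g : G.Arr // X.s x = G.r g},
    f₁ (X.ract x g.1 g.2) *
      f₂ (Y.lact (G.inv g.1) y ((G.s_inv g.1).trans (g.2.symm.trans e)))

end GroupoidCorr

/-! ### The completions `C*(G)` and `C*(X)` -/

/-- A C*-seminorm on the *-algebra `𝔖(G)`. -/
structure IsCStarSeminorm (G : EtaleGroupoid.{u}) (p : Seminorm ℂ (SFun G.Arr)) : Prop where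
  mul_le : ∀ ξ η ζ : SFun G.Arr, (ζ : G.Arr → ℂ) = G.conv ξ η → p ζ ≤ p ξ * p η
  cstar : ∀ ξ ζ : SFun G.Arr, (ζ : G.Arr → ℂ) = G.conv (G.involution ξ) ξ → p ζ = p ξ ^ 2

/-- `A` is the groupoid C*-algebra `C*(G)`, that is, the completion of the *-algebra `𝔖(G)` in
its largest C*-seminorm: `ι` is a *-homomorphism from `𝔖(G)` with dense range, and `‖ι ξ‖`
dominates every C*-seminorm. -/
structure GroupoidCStarAlgebra (G : EtaleGroupoid.{u}) (A : CStarAlg.{u}) where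
  ι : SFun G.Arr →ₗ[ℂ] A
  map_conv : ∀ ξ η : SFun G.Arr, ∃ ζ : SFun G.Arr,
    (ζ : G.Arr → ℂ) = G.conv ξ η ∧ ι ζ = ι ξ * ι η
  map_star : ∀ ξ : SFun G.Arr, ∃ ζ : SFun G.Arr,
    (ζ : G.Arr → ℂ) = G.involution ξ ∧ ι ζ = star (ι ξ)
  denseRange : DenseRange ι
  le_norm : ∀ p, IsCStarSeminorm G p → ∀ ξ, p ξ ≤ ‖ι ξ‖

/-- `E` is the C*-correspondence `C*(X) : C*(H) ← C*(G)` of the groupoid correspondence `X`: the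
completion of `𝔖(X)` for the `C*(G)`-valued inner product, with actions extending the
convolutions. -/
structure GroupoidCStarCorr {H G : EtaleGroupoid.{u}} (X : GroupoidCorr H G)
    {A B : CStarAlg.{u}} (cH : GroupoidCStarAlgebra H A) (cG : GroupoidCStarAlgebra G B)
    (E : CStarCorr A B) where
  ι : SFun X →ₗ[ℂ] E
  inner_ι : ∀ ξ η : SFun X, ∃ γ : SFun G.Arr,
    (γ : G.Arr → ℂ) = X.braket ξ η ∧ E.inner (ι ξ) (ι η) = cG.ι γ
  ract_ι : ∀ (ξ : SFun X) (γ : SFun G.Arr), ∃ φ : SFun X,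
    (φ : X → ℂ) = X.rconv ξ γ ∧ E.ract (ι ξ) (cG.ι γ) = ι φ
  lact_ι : ∀ (ζ : SFun H.Arr) (ξ : SFun X), ∃ φ : SFun X,
    (φ : X → ℂ) = X.lconv ζ ξ ∧ E.lact (cH.ι ζ) (ι ξ) = ι φ
  denseRange : DenseRange ι

/-! ### Reading the cells of the two bicategories -/

section

variable {𝔊 : GrBicategory.{u}} {ℭ : CorrBicategory.{u}}

/-- An object of `𝔊` as a groupoid. -/
abbrev GrBicategory.gpd (G : 𝔊.Ob) : EtaleGroupoid.{u} := G

/-- An arrow `G ⟶ H` of `𝔊` as a groupoid correspondence `H ← G`. -/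
abbrev GrBicategory.corr {G H : 𝔊.Ob} (X : G ⟶ H) :
    GroupoidCorr (GrBicategory.gpd H) (GrBicategory.gpd G) := X

/-- The map underlying a 2-arrow of `𝔊`. -/
abbrev GrBicategory.fn {G H : 𝔊.Ob} {X Y : G ⟶ H} (α : X ⟶ Y) :
    GrBicategory.corr X → GrBicategory.corr Y := GroupoidCorr.Hom.toFun α

/-- An object of `ℭ` as a C*-algebra. -/
abbrev CorrBicategory.alg (A : ℭ.Ob) : CStarAlg.{u} := A

/-- An arrow `B ⟶ A` of `ℭ` as a C*-correspondence `A ← B`. -/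
abbrev CorrBicategory.corr {B A : ℭ.Ob} (E : B ⟶ A) :
    CStarCorr (CorrBicategory.alg A) (CorrBicategory.alg B) := E

/-- The map underlying a 2-arrow of `ℭ`. -/
abbrev CorrBicategory.fn {B A : ℭ.Ob} {E F : B ⟶ A} (α : E ⟶ F) :
    CorrBicategory.corr E →ₗ[ℂ] CorrBicategory.corr F := CStarCorr.Hom.toFun α

end

/-! The algebra is controlled by one construction. For a relation `R x y z`, `relProd R f g` sums `f
x * g y` over all pairs with product `z`. Convolution on `𝔖(G)`, both actions on `𝔖(X)`, the inner
product (with the first argument conjugated) and the product `𝔖(X) × 𝔖(Y) → 𝔖(X ∘ Y)` are all of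
this form. Their relations are étale (`IsEtaleRel`): the graph is a space `P` properly embedded in
`X × Y`, and the product map out of `P` is a local homeomorphism. Pulling `f ⊗ g` back to `P` and
summing along fibres stays inside `𝔖`. A product of three functions is a finite sum over triples, so
`relProd_assoc` reduces each algebraic identity to an equivalence between composed relations, that
is, to the axioms for free commuting actions. In this way `Composite.sInner_prod`, which says that
`μ` is isometric, follows from `Composite.rel_rel_iff`.

Two analytic facts make the completions exist. First, a compactly supported `ξ` is reproduced by a
finite frame, `ξ = ∑ wᵢ ⟨wᵢ, ξ⟩` (`exists_frame`); hence `⟨ξ, ξ⟩ = ∑ ⟨wᵢ, ξ⟩* ⟨wᵢ, ξ⟩` is positive.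
The frame is built from slices of the free proper action. Second, if `ζ` lives on a bisection, then
`ζ* ζ` acts as multiplication by a bounded continuous function `F ≤ C` on objects, so `C ⟨ξ, ξ⟩ - ⟨ζ
ξ, ζ ξ⟩ = ⟨η, η⟩` with `η = √(C - F) ξ` (`IsBisection.exists_sInner_sub`). For the unit arrow this
bounds all C*-seminorms at once, so a largest one exists. For general `X` it bounds the left action;
the operator seminorm of that action is then a C*-seminorm, lies below the norm of `C*(H)`, and the
action extends to `C*(H)`.

The map `μ` is onto because functions on `X ∘ Y` are spanned by products (`mem_span_prod`): over a
slice the orbit map has continuous local sections. The remaining coherence laws are equalities of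
continuous maps, and are checked on the images of functions in `𝔖`, where they are again identities
for `relProd`. Strict unitality is arranged by choosing `C*(1_G)` to be `C*(G)` itself.

For `ℭ`, tensor products are completions of algebraic ones, with positivity supplied by a
factorization of Gram matrices, and every cell is determined on elementary tensors. For `𝔊`,
composites are orbit spaces, whose right action is shown to be proper by following ultrafilters, and
every cell is determined on classes `[x, y]`. -/

/-! ### Extension of densely defined maps -/

section Extension

variable {S T E F M : Type*} [AddCommGroup S] [Module ℂ S] [AddCommGroup T] [Module ℂ T]
  [NormedAddCommGroup E] [NormedSpace ℂ E] [NormedAddCommGroup F] [NormedSpace ℂ F]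
  [NormedAddCommGroup M] [NormedSpace ℂ M] [CompleteSpace M]
  {σ : ℂ →+* ℂ}

theorem exists_extension {i : S →ₗ[ℂ] E} (hi : DenseRange i) (f : S →ₛₗ[σ] M) {C : ℝ}
    (h : ∀ x, ‖f x‖ ≤ C * ‖i x‖) :
    ∃ f' : E →SL[σ] M, (∀ x, f' (i x) = f x) ∧ ∀ x, ‖f' x‖ ≤ C * ‖x‖ :=
  ⟨f.extendOfNorm i, LinearMap.extendOfNorm_eq hi ⟨C, h⟩,
    LinearMap.norm_extendOfNorm_apply_le hi C h⟩

/-- One variable is extended at a time: each `f x` becomes an operator on `F`, and the resulting map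
into the Banach space `F →L[ℂ] M` is extended in turn. Semilinearity in the first variable
accommodates inner products. -/
theorem exists_extension_bilin [RingHomIsometric σ] {i : S →ₗ[ℂ] E} {j : T →ₗ[ℂ] F} (hi : DenseRange i)
    (hj : DenseRange j) (f : S →ₛₗ[σ] T →ₗ[ℂ] M) {C : ℝ} (hC : 0 ≤ C)
    (h : ∀ x y, ‖f x y‖ ≤ C * ‖i x‖ * ‖j y‖) :
    ∃ f' : E →SL[σ] F →L[ℂ] M, (∀ x y, f' (i x) (j y) = f x y) ∧
      ∀ x y, ‖f' x y‖ ≤ C * ‖x‖ * ‖y‖ := by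
  choose g hg hgn using fun x => exists_extension hj (f x) (h x)
  have ext : ∀ a b : F →L[ℂ] M, (∀ y, a (j y) = b (j y)) → a = b := fun a b hab =>
    ContinuousLinearMap.coeFn_injective (hj.equalizer a.continuous b.continuous (funext hab))
  let G : S →ₛₗ[σ] (F →L[ℂ] M) :=
    { toFun := g
      map_add' := fun x y => ext _ _ fun z => by simp [hg]
      map_smul' := fun c x => ext _ _ fun z => by simp [hg] }
  obtain ⟨f', hf', hn⟩ := exists_extension (C := C) hi G fun x =>
    (g x).opNorm_le_bound (by positivity) (hgn x)
  refine ⟨f', fun x y => ?_, fun x y => ?_⟩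
  · rw [hf']
    exact hg x y
  · refine ((f' x).le_opNorm y).trans ?_
    gcongr
    exact hn x

end Extension

/-- The completion of a vector space with respect to a seminorm. -/
theorem Seminorm.exists_completion {S : Type u} [AddCommGroup S] [Module ℂ S]
    (p : Seminorm ℂ S) :
    ∃ (E : Type u) (_ : NormedAddCommGroup E) (_ : NormedSpace ℂ E) (_ : CompleteSpace E)
      (i : S →ₗ[ℂ] E), DenseRange i ∧ ∀ x, ‖i x‖ = p x := by
  let : SeminormedAddCommGroup S := p.toSeminormedAddCommGroup
  let : NormedSpace ℂ S := { norm_smul_le := fun a b => (map_smul_eq_mul p a b).le }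
  exact ⟨UniformSpace.Completion S, inferInstance, inferInstance, inferInstance,
    (UniformSpace.Completion.toComplₗᵢ (𝕜 := ℂ) (E := S)).toLinearMap,
    UniformSpace.Completion.denseRange_coe, fun x => UniformSpace.Completion.norm_coe x⟩

/-! ### Positive elements -/

/-- Elements of the form `c* c`, that is, positive elements of a C*-algebra. -/
def IsStarSquare {B : Type*} [NonUnitalCStarAlgebra B] (b : B) : Prop := ∃ c, b = star c * c

namespace IsStarSquare

attribute [local instance] CStarAlgebra.spectralOrder CStarAlgebra.spectralOrderedRing

variable {B : Type*} [NonUnitalCStarAlgebra B] {a b : B}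

theorem iff_nonneg : IsStarSquare b ↔ 0 ≤ b :=
  CStarAlgebra.nonneg_iff_eq_star_mul_self.symm

theorem star_mul (c : B) : IsStarSquare (star c * c) := ⟨c, rfl⟩

theorem sum {ι : Type*} (s : Finset ι) {f : ι → B} (h : ∀ i ∈ s, IsStarSquare (f i)) :
    IsStarSquare (∑ i ∈ s, f i) := by
  simp only [iff_nonneg] at *
  exact Finset.sum_nonneg h

theorem smul {t : ℝ} (ht : 0 ≤ t) (ha : IsStarSquare a) : IsStarSquare ((t : ℂ) • a) := by
  obtain ⟨c, rfl⟩ := ha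
  refine ⟨((√t : ℝ) : ℂ) • c, ?_⟩
  rw [star_smul, smul_mul_smul_comm]
  congr 1
  simp [← Complex.ofReal_mul, Real.mul_self_sqrt ht]

theorem norm_le (ha : IsStarSquare a) (hab : IsStarSquare (b - a)) : ‖a‖ ≤ ‖b‖ := by
  rw [iff_nonneg] at *
  exact CStarAlgebra.norm_le_norm_of_nonneg_of_le ha (sub_nonneg.1 hab)

theorem isClosed : IsClosed {b : B | IsStarSquare b} := by
  simp only [iff_nonneg]
  exact CStarAlgebra.isClosed_nonneg

theorem eq_zero_of_neg (ha : IsStarSquare a) (hb : IsStarSquare (-a)) : a = 0 := by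
  rw [iff_nonneg] at *
  exact le_antisymm (neg_nonneg.1 hb) ha

theorem eq_zero_of_sum_eq_zero {ι : Type*} [Fintype ι] {f : ι → B} (h : ∀ i, IsStarSquare (f i))
    (h0 : ∑ i, f i = 0) (i : ι) : f i = 0 := by
  simp only [iff_nonneg] at *
  exact (Finset.sum_eq_zero_iff_of_nonneg fun i _ => h i).1 h0 i (Finset.mem_univ i)

end IsStarSquare

/-! ### Completions of *-algebras -/

/-- The completion of a *-algebra with respect to a C*-seminorm. -/
theorem exists_cstarAlg_completion {S : Type u} [AddCommGroup S] [Module ℂ S]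
    (mul : S →ₗ[ℂ] S →ₗ[ℂ] S) (st : S →ₗ⋆[ℂ] S)
    (mul_assoc' : ∀ x y z, mul (mul x y) z = mul x (mul y z))
    (st_mul : ∀ x y, st (mul x y) = mul (st y) (st x)) (st_st : ∀ x, st (st x) = x)
    (p : Seminorm ℂ S) (p_mul : ∀ x y, p (mul x y) ≤ p x * p y)
    (p_st : ∀ x, p (mul (st x) x) = p x ^ 2) :
    ∃ (A : CStarAlg.{u}) (ι : S →ₗ[ℂ] A), DenseRange ι ∧ (∀ x, ‖ι x‖ = p x) ∧
      (∀ x y, ι (mul x y) = ι x * ι y) ∧ ∀ x, ι (st x) = star (ι x) := by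
  obtain ⟨E, _, _, _, i, hi, hn⟩ := p.exists_completion
  obtain ⟨m, hm, hmn⟩ := exists_extension_bilin hi hi (mul.compr₂ i) zero_le_one
    (fun x y => by simpa [hn] using p_mul x y)
  -- The C*-identity at `st x` reads `p (st x) ^ 2 = p (x * st x) ≤ p x * p (st x)`; cancel `p (st
  -- x)`.
  have p_st_le : ∀ x, p (st x) ≤ p x := fun x => by
    have h := p_mul (st (st x)) (st x)
    rw [p_st, st_st, sq] at h
    by_contra! hlt
    exact absurd (le_of_mul_le_mul_right h ((apply_nonneg p x).trans_lt hlt)) (not_le.2 hlt)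
  obtain ⟨σ, hσ, -⟩ := exists_extension (C := 1) hi (i.comp st)
    (fun x => by simpa [hn] using p_st_le x)
  simp only [LinearMap.compr₂_apply, LinearMap.coe_comp, Function.comp_apply, one_mul]
    at hm hmn hσ
  -- Continuity of both operations makes each algebra axiom a closed condition, to be checked on the
  -- dense image of `S`.
  have mc : Continuous fun q : E × E => m q.1 q.2 := m.continuous₂
  have σc : Continuous σ := σ.continuous
  let ring : NonUnitalNormedRing E :=
    { (inferInstance : NormedAddCommGroup E) with
      mul := fun x y => m x y
      left_distrib := fun x y z => map_add (m x) y z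
      right_distrib := fun x y z => by simp [HMul.hMul]
      zero_mul := fun x => by simp [HMul.hMul]
      mul_zero := fun x => map_zero (m x)
      mul_assoc := fun x y z => by
        refine hi.induction_on₃ (p := fun x y z => m (m x y) z = m x (m y z)) ?_ ?_ x y z
        · exact isClosed_eq (by fun_prop) (by fun_prop)
        · intro x y z
          simp only [hm, mul_assoc']
      norm_mul_le := fun x y => hmn x y }
  have mul_def : ∀ x y : E, x * y = m x y := fun _ _ => rfl
  let star : StarRing E :=
    { star := σ
      star_involutive := fun x => by
        refine hi.induction_on (p := fun x => σ (σ x) = x) x ?_ fun x => ?_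
        · exact isClosed_eq (by fun_prop) (by fun_prop)
        · simp only [hσ, st_st]
      star_mul := fun x y => by
        refine hi.induction_on₂ (p := fun x y => σ (m x y) = m (σ y) (σ x)) ?_ ?_ x y
        · exact isClosed_eq (by fun_prop) (by fun_prop)
        · intro x y
          simp only [hm, hσ, st_mul]
      star_add := map_add σ }
  let alg : NonUnitalCStarAlgebra E :=
    { ring, star, (inferInstance : NormedSpace ℂ E) with
      norm_mul_self_le := fun x => by
        refine hi.induction_on (p := fun x => ‖x‖ * ‖x‖ ≤ ‖m (σ x) x‖) x ?_ fun x => ?_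
        · exact isClosed_le (by fun_prop) (by fun_prop)
        · simp only [hσ, hm, hn, p_st, sq, le_refl]
      complete := CompleteSpace.complete
      smul_assoc := fun c x y => by simp [mul_def]
      smul_comm := fun c x y => by simp [mul_def]
      star_smul := fun c x => map_smulₛₗ σ c x }
  exact ⟨⟨E⟩, i, hi, hn, fun x y => (hm x y).symm, fun x => (hσ x).symm⟩

/-! ### Positive semidefinite inner products with values in a C*-algebra -/

section PreInner

variable {B : Type*} [NonUnitalCStarAlgebra B] {S : Type*} [AddCommGroup S] [Module ℂ S]
  {ip : S →ₗ⋆[ℂ] S →ₗ[ℂ] B}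

/-- Positivity of the inner square of `√t x - y/√t` bounds the cross terms by `t⟨x, x⟩ + t⁻¹⟨y, y⟩`.
The free weight `t` is optimized for the triangle inequality; `t = 1` suffices for crude bounds. -/
theorem norm_inner_add_le_weighted (pos : ∀ x, IsStarSquare (ip x x)) (x y : S) {t : ℝ}
    (ht : 0 < t) :
    ‖ip (x + y) (x + y)‖ ≤ (1 + t) * ‖ip x x‖ + (1 + t⁻¹) * ‖ip y y‖ := by
  have key : IsStarSquare ((((1 + t : ℝ) : ℂ) • ip x x + ((1 + t⁻¹ : ℝ) : ℂ) • ip y y)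
      - ip (x + y) (x + y)) := by
    convert pos (((√t : ℝ) : ℂ) • x - ((√t : ℝ) : ℂ)⁻¹ • y) using 1
    have h0 : ((√t : ℝ) : ℂ) ≠ 0 := by
      simpa using (Real.sqrt_pos.2 ht).ne'
    have h1 : (t : ℂ) = ((√t : ℝ) : ℂ) * ((√t : ℝ) : ℂ) := by
      rw [← Complex.ofReal_mul, Real.mul_self_sqrt ht.le]
    simp only [map_add, map_sub, LinearMap.add_apply, LinearMap.sub_apply, map_smulₛₗ,
      LinearMap.smul_apply, RingHom.id_apply, Complex.conj_ofReal, map_inv₀,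
      Complex.ofReal_add, Complex.ofReal_one, Complex.ofReal_inv]
    rw [h1]
    match_scalars <;> field_simp <;> ring
  refine ((pos _).norm_le key).trans ((norm_add_le _ _).trans ?_)
  rw [norm_smul, norm_smul, Complex.norm_real, Complex.norm_real, Real.norm_of_nonneg (by positivity),
    Real.norm_of_nonneg (by positivity)]

/-- Optimal weights are quotients of two seminorm values; adding `ε` to both keeps them defined and
positive when a value vanishes. -/
theorem le_of_forall_pos_le_add_add {a x y : ℝ} {d : ℝ → ℝ → ℝ}
    (hd : Continuous fun ε : ℝ => d (x + ε) (y + ε)) (h : ∀ ε, 0 < ε → a ≤ d (x + ε) (y + ε)) :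
    a ≤ d x y := by
  have h1 : Filter.Tendsto (fun ε : ℝ => d (x + ε) (y + ε)) (𝓝[>] 0) (𝓝 (d x y)) := by
    have := (hd.tendsto 0).mono_left (nhdsWithin_le_nhds (s := Set.Ioi 0))
    simpa using this
  exact ge_of_tendsto h1 (Filter.eventually_of_mem self_mem_nhdsWithin h)

theorem sqrt_norm_inner_add_le (pos : ∀ x, IsStarSquare (ip x x)) (x y : S) :
    √‖ip (x + y) (x + y)‖ ≤ √‖ip x x‖ + √‖ip y y‖ := by
  refine Real.sqrt_le_iff.2 ⟨by positivity, ?_⟩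
  refine le_of_forall_pos_le_add_add (d := fun a b => (a + b) ^ 2) (by fun_prop) fun ε hε => ?_
  have hx := Real.sq_sqrt (norm_nonneg (ip x x))
  have hy := Real.sq_sqrt (norm_nonneg (ip y y))
  have hx0 := Real.sqrt_nonneg ‖ip x x‖
  have hy0 := Real.sqrt_nonneg ‖ip y y‖
  generalize √‖ip x x‖ = a at *
  generalize √‖ip y y‖ = b at *
  have ha : 0 < a + ε := by linarith
  have hb : 0 < b + ε := by linarith
  -- The weight `b / a` turns `(1 + t) a² + (1 + t⁻¹) b²` into `(a + b)²`.
  have h := norm_inner_add_le_weighted pos x y (div_pos hb ha)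
  rw [← hx, ← hy] at h
  calc _ ≤ _ := h
    _ ≤ (1 + (b + ε) / (a + ε)) * (a + ε) ^ 2 + (1 + ((b + ε) / (a + ε))⁻¹) * (b + ε) ^ 2 := by
        gcongr <;> linarith
    _ = _ := by
        field_simp
        ring

/-- The seminorm `√‖⟨x, x⟩‖`. -/
noncomputable def innerSeminorm (pos : ∀ x, IsStarSquare (ip x x)) : Seminorm ℂ S :=
  Seminorm.of (fun x => √‖ip x x‖) (sqrt_norm_inner_add_le pos) fun c x => by
    simp only [map_smulₛₗ, LinearMap.smul_apply, RingHom.id_apply]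
    rw [smul_smul, norm_smul]
    simp [Real.sqrt_mul_self]

theorem innerSeminorm_sq (pos : ∀ x, IsStarSquare (ip x x)) (x : S) :
    innerSeminorm pos x ^ 2 = ‖ip x x‖ :=
  Real.sq_sqrt (norm_nonneg _)

/-- Polarization writes `⟨x, y⟩` as a quarter of a combination of four inner squares with
coefficients of modulus one, and each of the four vectors has seminorm at most the sum of those of
`x` and `y`. -/
theorem norm_inner_le_add_sq (pos : ∀ x, IsStarSquare (ip x x)) (x y : S) :
    ‖ip x y‖ ≤ (innerSeminorm pos x + innerSeminorm pos y) ^ 2 := by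
  have hpol : ip x y = (4⁻¹ : ℂ) • (ip (x + y) (x + y) - ip (x - y) (x - y)
      + Complex.I • ip (x - Complex.I • y) (x - Complex.I • y)
      - Complex.I • ip (x + Complex.I • y) (x + Complex.I • y)) := by
    simp only [map_add, map_sub, LinearMap.add_apply, LinearMap.sub_apply, map_smulₛₗ,
      LinearMap.smul_apply, RingHom.id_apply, Complex.conj_I]
    match_scalars <;> ring_nf <;> simp <;> norm_num
  have hb : ∀ z, innerSeminorm pos z ≤ innerSeminorm pos x + innerSeminorm pos y →
      ‖ip z z‖ ≤ (innerSeminorm pos x + innerSeminorm pos y) ^ 2 := fun z hz => by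
    rw [← innerSeminorm_sq pos]
    gcongr
  have h1 := hb _ (map_add_le_add (innerSeminorm pos) x y)
  have h2 := hb _ (map_sub_le_add (innerSeminorm pos) x y)
  have h3 := hb (x - Complex.I • y)
    ((map_sub_le_add (innerSeminorm pos) _ _).trans (by simp [map_smul_eq_mul]))
  have h4 := hb (x + Complex.I • y)
    ((map_add_le_add (innerSeminorm pos) _ _).trans (by simp [map_smul_eq_mul]))
  rw [hpol, norm_smul]
  have h5 := norm_sub_le (ip (x + y) (x + y) - ip (x - y) (x - y)
      + Complex.I • ip (x - Complex.I • y) (x - Complex.I • y))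
      (Complex.I • ip (x + Complex.I • y) (x + Complex.I • y))
  have h6 := norm_add_le (ip (x + y) (x + y) - ip (x - y) (x - y))
      (Complex.I • ip (x - Complex.I • y) (x - Complex.I • y))
  have h7 := norm_sub_le (ip (x + y) (x + y)) (ip (x - y) (x - y))
  rw [norm_smul, Complex.norm_I, one_mul] at h5 h6
  rw [show ‖(4⁻¹ : ℂ)‖ = 4⁻¹ by norm_num]
  linarith

/-- Replacing `x, y` by `t x, t⁻¹ y` does not change `⟨x, y⟩`, and `t² = b / a` balances the two
seminorms in the polarization bound. The constant 4 is not sharp, but only joint continuity is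
needed. -/
theorem norm_inner_le (pos : ∀ x, IsStarSquare (ip x x)) (x y : S) :
    ‖ip x y‖ ≤ 4 * innerSeminorm pos x * innerSeminorm pos y := by
  refine le_of_forall_pos_le_add_add (d := fun a b => 4 * a * b) (by fun_prop) fun ε hε => ?_
  have hx0 : 0 ≤ innerSeminorm pos x := apply_nonneg _ _
  have hy0 : 0 ≤ innerSeminorm pos y := apply_nonneg _ _
  have ha : 0 < innerSeminorm pos x + ε := by linarith
  have hb : 0 < innerSeminorm pos y + ε := by linarith
  set a := innerSeminorm pos x + ε
  set b := innerSeminorm pos y + ε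
  have ht : 0 < √(b / a) := Real.sqrt_pos.2 (div_pos hb ha)
  set t := √(b / a)
  have ht2 : t ^ 2 = b / a := Real.sq_sqrt (div_pos hb ha).le
  have h := norm_inner_le_add_sq pos ((t : ℂ) • x) ((t : ℂ)⁻¹ • y)
  have h1 : ip ((t : ℂ) • x) ((t : ℂ)⁻¹ • y) = ip x y := by
    simp only [map_smulₛₗ, LinearMap.smul_apply, RingHom.id_apply, Complex.conj_ofReal]
    rw [smul_smul, inv_mul_cancel₀ (by exact_mod_cast ht.ne'), one_smul]
  rw [h1, map_smul_eq_mul, map_smul_eq_mul, norm_inv, Complex.norm_real,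
    Real.norm_of_nonneg ht.le] at h
  calc ‖ip x y‖ ≤ _ := h
    _ ≤ (t * a + t⁻¹ * b) ^ 2 := by
        gcongr <;> linarith
    _ = t ^ 2 * a ^ 2 + 2 * a * b + b ^ 2 / t ^ 2 := by
        field_simp
        ring
    _ = 4 * a * b := by
        rw [ht2]
        field_simp
        ring

end PreInner

/-- The completion of a pre-correspondence: a space with a positive semidefinite `B`-valued inner
product and actions of dense subspaces of `A` and `B`. -/
theorem exists_cstarCorr_completion {A B : CStarAlg.{u}} {S : Type u} [AddCommGroup S]
    [Module ℂ S] {SA SB : Type*} [AddCommGroup SA] [Module ℂ SA] [AddCommGroup SB] [Module ℂ SB]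
    {jA : SA →ₗ[ℂ] A} {jB : SB →ₗ[ℂ] B} (hA : DenseRange jA) (hB : DenseRange jB)
    (ip : S →ₗ⋆[ℂ] S →ₗ[ℂ] B) (star_ip : ∀ x y, star (ip x y) = ip y x)
    (pos : ∀ x, IsStarSquare (ip x x))
    (ra : S →ₗ[ℂ] SB →ₗ[ℂ] S) (ip_ra : ∀ x y b, ip x (ra y b) = ip x y * jB b)
    (la : SA →ₗ[ℂ] S →ₗ[ℂ] S)
    (ip_la : ∀ a, ∃ a', jA a' = star (jA a) ∧ ∀ x y, ip (la a x) y = ip x (la a' y))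
    (la_mul : ∀ a b, ∃ c, jA c = jA a * jA b ∧ ∀ x, la c x = la a (la b x))
    (la_le : ∀ a x, ‖ip (la a x) (la a x)‖ ≤ ‖jA a‖ ^ 2 * ‖ip x x‖)
    (D : Set S) (hD : Submodule.span ℂ D = ⊤)
    (nondeg : ∀ x ∈ D, ∀ ε > 0, ∃ z ∈ Submodule.span ℂ {z | ∃ a x, la a x = z},
      ‖ip (x - z) (x - z)‖ < ε) :
    ∃ (E : CStarCorr A B) (ι : S →ₗ[ℂ] E), DenseRange ι ∧
      (∀ x y, E.inner (ι x) (ι y) = ip x y) ∧ (∀ x b, E.ract (ι x) (jB b) = ι (ra x b)) ∧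
      ∀ a x, E.lact (jA a) (ι x) = ι (la a x) := by
  obtain ⟨E, _, _, _, i, hi, hn⟩ := (innerSeminorm pos).exists_completion
  have hsq : ∀ x, ‖i x‖ ^ 2 = ‖ip x x‖ := fun x => by rw [hn, innerSeminorm_sq]
  obtain ⟨I, hI, -⟩ := exists_extension_bilin hi hi ip (C := 4) (by norm_num)
    (fun x y => by simpa only [hn] using norm_inner_le pos x y)
  have ra_ip : ∀ x y b, ip (ra x b) y = star (jB b) * ip x y := fun x y b => by
    rw [← star_ip, ip_ra, star_mul, star_ip]
  obtain ⟨R, hR, -⟩ := exists_extension_bilin hi hB (ra.compr₂ i) zero_le_one (fun x b => by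
    rw [LinearMap.compr₂_apply, one_mul]
    refine le_of_sq_le_sq ?_ (by positivity)
    rw [hsq, ip_ra, ra_ip, mul_pow, hsq]
    refine (norm_mul_le _ _).trans ?_
    have := norm_mul_le (star (jB b)) (ip x x)
    rw [norm_star] at this
    nlinarith [norm_nonneg (jB b)])
  obtain ⟨L, hL, -⟩ := exists_extension_bilin hA hi (la.compr₂ i) zero_le_one (fun a x => by
    rw [LinearMap.compr₂_apply, one_mul]
    refine le_of_sq_le_sq ?_ (by positivity)
    rw [hsq, mul_pow, hsq]
    exact la_le a x)
  simp only [LinearMap.compr₂_apply] at hR hL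
  have Ic : Continuous fun q : E × E => I q.1 q.2 :=
    (I.continuous.comp continuous_fst).clm_apply continuous_snd
  have Rc : Continuous fun q : E × B => R q.1 q.2 := R.continuous₂
  have Lc : Continuous fun q : A × E => L q.1 q.2 := L.continuous₂
  have Isq : ∀ x, ‖x‖ ^ 2 = ‖I x x‖ := fun x => by
    refine hi.induction_on (p := fun x => ‖x‖ ^ 2 = ‖I x x‖) x ?_ fun x => ?_
    · exact isClosed_eq (by fun_prop) (by fun_prop)
    · rw [hI, hsq]
  have Istar : ∀ x y, star (I x y) = I y x := fun x y => by
    refine hi.induction_on₂ (p := fun x y => star (I x y) = I y x) ?_ ?_ x y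
    · exact isClosed_eq (by fun_prop) (by fun_prop)
    · intro x y
      rw [hI, hI, star_ip]
  have IR : ∀ x y b, I x (R y b) = I x y * b := fun x y b => by
    refine DenseRange.induction_on (e := fun q : S × S × SB => (i q.1, i q.2.1, jB q.2.2))
      (hi.prodMap (hi.prodMap hB)) (p := fun q => I q.1 (R q.2.1 q.2.2) = I q.1 q.2.1 * q.2.2)
      (x, y, b) ?_ ?_
    · exact isClosed_eq (by fun_prop) (by fun_prop)
    · intro q
      simp only [hR, hI, ip_ra]
  have IL : ∀ a x y, I (L a x) y = I x (L (star a) y) := fun a x y => by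
    refine DenseRange.induction_on (e := fun q : SA × S × S => (jA q.1, i q.2.1, i q.2.2))
      (hA.prodMap (hi.prodMap hi)) (p := fun q => I (L q.1 q.2.1) q.2.2 = I q.2.1 (L (star q.1) q.2.2))
      (a, x, y) ?_ ?_
    · exact isClosed_eq (by fun_prop) (by fun_prop)
    · rintro ⟨a, x, y⟩
      obtain ⟨a', h1, h2⟩ := ip_la a
      simp only [hL, hI, ← h1, h2]
  -- Inner products separate vectors, so identities involving the right action can be verified after
  -- pairing with an arbitrary `w`.
  have ext : ∀ z z', (∀ w, I w z = I w z') → z = z' := fun z z' h => by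
    have h1 := Isq (z - z')
    rw [map_sub (I (z - z')), h, sub_self, norm_zero] at h1
    exact sub_eq_zero.1 (norm_eq_zero.1 (pow_eq_zero_iff two_ne_zero |>.1 h1))
  let EE : CStarCorr A B :=
    { carrier := E
      inner := ContinuousLinearMap.coeLMₛₗ (RingHom.id ℂ) ∘ₛₗ (I : E →ₗ⋆[ℂ] E →L[ℂ] B)
      lact := ContinuousLinearMap.coeLM ℂ ∘ₗ (L : A →ₗ[ℂ] E →L[ℂ] E)
      ract := ContinuousLinearMap.coeLM ℂ ∘ₗ (R : E →ₗ[ℂ] B →L[ℂ] E)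
      ract_mul := fun x b c => ext _ _ fun w => by
        change I w (R x (b * c)) = I w (R (R x b) c)
        simp only [IR, mul_assoc]
      inner_ract := IR
      star_inner := Istar
      inner_self_nonneg := fun x => by
        refine hi.induction_on (p := fun x => IsStarSquare (I x x)) x ?_ fun x => ?_
        · exact IsStarSquare.isClosed.preimage (f := fun x => I x x) (by fun_prop)
        · rw [hI]
          exact pos x
      norm_sq_eq := Isq
      lact_mul := fun a b x => by
        refine DenseRange.induction_on (e := fun q : SA × SA × S => (jA q.1, jA q.2.1, i q.2.2))
          (hA.prodMap (hA.prodMap hi))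
          (p := fun q => L (q.1 * q.2.1) q.2.2 = L q.1 (L q.2.1 q.2.2)) (a, b, x) ?_ ?_
        · exact isClosed_eq (by fun_prop) (by fun_prop)
        · rintro ⟨a, b, x⟩
          obtain ⟨c, h1, h2⟩ := la_mul a b
          simp only [hL, ← h1, h2]
      lact_ract := fun a x b => ext _ _ fun w => by
        change I w (L a (R x b)) = I w (R (L a x) b)
        rw [IR, ← star_star a, ← IL, ← IL, IR]
      inner_lact := IL
      nondegenerate := by
        let T : Submodule ℂ E := (Submodule.span ℂ {z | ∃ a x, L a x = z}).topologicalClosure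
        have hle : ∀ x, i x ∈ T := by
          -- The vectors with image in `T` form a subspace, so approximating the generators in `D`
          -- is enough.
          suffices h : Submodule.span ℂ D ≤ T.comap i from fun x => h (hD ▸ Submodule.mem_top)
          refine Submodule.span_le.2 fun x hx => Metric.mem_closure_iff.2 fun ε hε => ?_
          obtain ⟨z, hz, hlt⟩ := nondeg x hx (ε ^ 2) (by positivity)
          refine ⟨i z, ?_, ?_⟩
          · refine (Submodule.span_le (p := (Submodule.span ℂ {z | ∃ a x, L a x = z}).comap i)).2 ?_ hz
            rintro _ ⟨a, x, rfl⟩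
            exact Submodule.subset_span ⟨jA a, i x, hL a x⟩
          · rw [dist_eq_norm, ← map_sub]
            rw [← hsq] at hlt
            exact lt_of_pow_lt_pow_left₀ 2 hε.le hlt
        intro x
        have : x ∈ closure (Set.range i) := hi x
        exact closure_minimal (Set.range_subset_iff.2 hle)
          (Submodule.isClosed_topologicalClosure _) this }
  exact ⟨EE, i, hi, hI, hR, hL⟩

/-! ### Boundedness of actions of C*-algebras -/

/-- For `‖a‖ ≤ 1`, the element `c = 1 - √(1 - a* a)`. -/
theorem exists_two_smul_sub_sq {A : Type*} [NonUnitalCStarAlgebra A] (a : A) (ha : ‖a‖ ≤ 1) :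
    ∃ c : A, star c = c ∧ c + c - c * c = star a * a := by
  let b := star a * a
  have hb : IsSelfAdjoint b := IsSelfAdjoint.star_mul_self a
  have hbn : ‖b‖ ≤ 1 := by
    rw [CStarRing.norm_star_mul_self]
    nlinarith [norm_nonneg a]
  -- This solves `2 f - f² = t` for `t ≤ 1` and vanishes at 0, as the non-unital functional calculus
  -- requires.
  let f : ℝ → ℝ := fun t => 1 - √(1 - t)
  have hf : Continuous f := by fun_prop
  have hf0 : f 0 = 0 := by simp [f]
  refine ⟨cfcₙ f b, IsSelfAdjoint.cfcₙ.star_eq, ?_⟩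
  have h1 : cfcₙ (fun t : ℝ => f t + f t - f t * f t) b = cfcₙ (fun t : ℝ => t) b := by
    refine cfcₙ_congr fun t ht => ?_
    have ht1 : t ≤ 1 := (le_abs_self t).trans
      ((NonUnitalIsometricContinuousFunctionalCalculus.norm_quasispectrum_le b ht hb : ‖t‖ ≤ ‖b‖).trans hbn)
    have := Real.mul_self_sqrt (sub_nonneg.2 ht1)
    simp only [f]
    nlinarith
  rw [cfcₙ_id' ℝ b] at h1
  rw [← cfcₙ_mul f f b, ← cfcₙ_add f f b, ← cfcₙ_sub _ _ b]
  exact h1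

/-- An adjointable action of a complete C*-algebra is automatically contractive: for `‖a‖ ≤ 1` and
`c = 1 - √(1 - a* a)`, one has `⟨x, x⟩ - ⟨a x, a x⟩ = ⟨x - c x, x - c x⟩`. The general case follows
by rescaling `a`. -/
theorem norm_inner_lact_le {A B : Type*} [NonUnitalCStarAlgebra A] [NonUnitalCStarAlgebra B]
    {S : Type*} [AddCommGroup S] [Module ℂ S] (ip : S →ₗ⋆[ℂ] S →ₗ[ℂ] B)
    (pos : ∀ x, IsStarSquare (ip x x)) (la : A →ₗ[ℂ] S →ₗ[ℂ] S)
    (ip_la : ∀ a x y, ip (la a x) y = ip x (la (star a) y))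
    (la_mul : ∀ a b x, la (a * b) x = la a (la b x)) (a : A) (x : S) :
    ‖ip (la a x) (la a x)‖ ≤ ‖a‖ ^ 2 * ‖ip x x‖ := by
  have key : ∀ a : A, ‖a‖ ≤ 1 → ‖ip (la a x) (la a x)‖ ≤ ‖ip x x‖ := fun a ha => by
    obtain ⟨c, hc, h⟩ := exists_two_smul_sub_sq a ha
    refine (pos _).norm_le ?_
    convert pos (x - la c x) using 1
    have e1 : ip (la a x) (la a x) = ip x (la (c + c - c * c) x) := by
      rw [ip_la, ← la_mul, h]
    have e2 : ip (la c x) x = ip x (la c x) := by rw [ip_la, hc]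
    have e3 : ip (la c x) (la c x) = ip x (la (c * c) x) := by rw [ip_la, hc, la_mul]
    rw [e1]
    simp only [map_sub, map_add, LinearMap.sub_apply, LinearMap.add_apply, e2, e3]
    abel
  rcases eq_or_ne a 0 with rfl | ha
  · simp
  have ha' : 0 < ‖a‖ := norm_pos_iff.2 ha
  have h := key (((‖a‖ : ℝ) : ℂ)⁻¹ • a) (by
    rw [norm_smul, norm_inv, Complex.norm_real, norm_norm, inv_mul_cancel₀ ha'.ne'])
  simp only [map_smulₛₗ, LinearMap.smul_apply, RingHom.id_apply, map_inv₀, Complex.conj_ofReal,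
    norm_smul, norm_inv, Complex.norm_real, norm_norm] at h
  calc ‖ip (la a x) (la a x)‖
      = ‖a‖ ^ 2 * (‖a‖⁻¹ * (‖a‖⁻¹ * ‖ip (la a x) (la a x)‖)) := by field_simp
    _ ≤ _ := by gcongr

/-! ### Hilbert modules: continuity, Gram matrices, and criteria for 2-arrows. -/

namespace CStarCorr

variable {A B C : CStarAlg.{u}} (E F : CStarCorr A B)

theorem pos (x : E) : IsStarSquare (E.inner x x) := E.inner_self_nonneg x

theorem innerSeminorm_eq (x : E) : innerSeminorm E.pos x = ‖x‖ := by
  refine (pow_left_inj₀ (apply_nonneg _ _) (norm_nonneg _) two_ne_zero).1 ?_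
  rw [innerSeminorm_sq, E.norm_sq_eq]

theorem norm_inner_le (x y : E) : ‖E.inner x y‖ ≤ 4 * ‖x‖ * ‖y‖ := by
  simpa only [innerSeminorm_eq] using _root_.norm_inner_le E.pos x y

theorem norm_lact_le (a : A) (x : E) : ‖E.lact a x‖ ≤ 1 * ‖a‖ * ‖x‖ := by
  rw [one_mul]
  refine le_of_sq_le_sq ?_ (by positivity)
  rw [mul_pow, E.norm_sq_eq, E.norm_sq_eq]
  exact norm_inner_lact_le E.inner E.pos E.lact E.inner_lact E.lact_mul a x

theorem inner_ract_left (x y : E) (b : B) : E.inner (E.ract x b) y = star b * E.inner x y := by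
  rw [← E.star_inner, E.inner_ract, star_mul, E.star_inner]

theorem continuous_inner : Continuous fun q : E × E => E.inner q.1 q.2 :=
  ((E.inner.mkContinuous₂ 4 E.norm_inner_le).continuous.comp continuous_fst).clm_apply
    continuous_snd

theorem continuous_lact : Continuous fun q : A × E => E.lact q.1 q.2 :=
  ((E.lact.mkContinuous₂ 1 E.norm_lact_le).continuous.comp continuous_fst).clm_apply
    continuous_snd

variable {E F}

theorem eq_of_inner_sub {x y : E} (h : E.inner (x - y) (x - y) = 0) : x = y := by
  have h1 := E.norm_sq_eq (x - y)
  rw [h, norm_zero] at h1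
  exact sub_eq_zero.1 (norm_eq_zero.1 (pow_eq_zero_iff two_ne_zero |>.1 h1))

namespace Hom

theorem norm_map (α : Hom E F) (x : E) : ‖α.toFun x‖ = ‖x‖ := by
  refine (pow_left_inj₀ (norm_nonneg _) (norm_nonneg _) two_ne_zero).1 ?_
  rw [F.norm_sq_eq, E.norm_sq_eq, α.inner_map]

theorem continuous (α : Hom E F) : Continuous α.toFun :=
  (AddMonoidHomClass.isometry_of_norm α.toFun α.norm_map).continuous

theorem ext_dense {S : Type*} {i : S → E} (hi : DenseRange i) {α β : E ⟶ F}
    (h : ∀ x, Hom.toFun α (i x) = Hom.toFun β (i x)) : α = β :=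
  Hom.ext (LinearMap.ext fun x => congrFun
    (hi.equalizer (Hom.continuous α) (Hom.continuous β) (funext h)) x)

end Hom

section Gram

attribute [local instance] CStarAlgebra.spectralOrder CStarAlgebra.spectralOrderedRing

/-- With `N` the negative part of `T`, a witness for the failure of positivity of `T`. -/
theorem _root_.exists_conj_eq_neg_star_mul {M : Type*} [NonUnitalCStarAlgebra M] {T : M}
    (hT : star T = T) :
    ∃ N D : M, star N * T * N = -(star D * D) ∧ (D = 0 → IsStarSquare T) := by
  have hsa : star T⁻ = T⁻ := (CFC.negPart_nonneg T).isSelfAdjoint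
  obtain ⟨D, hD⟩ := IsStarSquare.iff_nonneg.2 (CFC.negPart_nonneg T)
  -- Since the positive part annihilates `T⁻`, conjugating `T` by `T⁻` gives minus its cube, and `T⁻
  -- = D* D` makes this cube `(D T⁻)* (D T⁻)`. If `D T⁻ = 0`, then `T⁻` squares to zero and hence
  -- vanishes.
  refine ⟨T⁻, D * T⁻, ?_, fun h => ?_⟩
  · rw [hsa]
    conv_lhs => enter [1, 2]; rw [← CFC.posPart_sub_negPart T hT]
    rw [mul_sub, sub_mul, mul_assoc, CFC.posPart_mul_negPart, mul_zero, zero_sub, star_mul, hsa]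
    congr 1
    simp only [mul_assoc]
    rw [← mul_assoc (star D), ← hD]
  · have h1 : T⁻ * T⁻ = 0 := by
      nth_rw 1 [hD]
      rw [mul_assoc, h, mul_zero]
    have h2 : T⁻ = 0 := by
      rw [← CStarRing.star_mul_self_eq_zero_iff, hsa, h1]
    rw [IsStarSquare.iff_nonneg, ← CFC.negPart_eq_zero_iff T hT]
    exact h2

/-- The Gram matrix of finitely many vectors is positive. -/
theorem exists_gram_eq (E : CStarCorr A B) {n : ℕ} (x : Fin n → E) :
    ∃ N : Fin n → Fin n → B, ∀ i j, E.inner (x i) (x j) = ∑ k, star (N k i) * N k j := by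
  let T : CStarMatrix (Fin n) (Fin n) B := CStarMatrix.ofMatrix fun i j => E.inner (x i) (x j)
  have hTa : ∀ i j, T i j = E.inner (x i) (x j) := fun _ _ => rfl
  have hT : star T = T := by
    ext i j
    rw [CStarMatrix.star_apply, hTa, hTa, E.star_inner]
  obtain ⟨N, D, h1, h2⟩ := exists_conj_eq_neg_star_mul hT
  have hD : D = 0 := by
    ext k j
    -- The `j`-th diagonal entry of `N* T N` is the inner square of `∑ l, x l · N l j`, hence
    -- positive; it is also minus a sum of squares. So every `D k j` vanishes.
    have h3 : IsStarSquare (-∑ k, star (D k j) * D k j) := by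
      convert E.pos (∑ l, E.ract (x l) (N l j)) using 1
      have h4 := congrFun (congrFun h1 j) j
      rw [CStarMatrix.neg_apply] at h4
      simp only [CStarMatrix.mul_apply, CStarMatrix.star_apply, hTa] at h4
      rw [← h4, map_sum, Finset.sum_congr rfl fun l _ => ?_]
      rw [LinearMap.map_sum₂, Finset.sum_mul]
      exact Finset.sum_congr rfl fun m _ => by rw [E.inner_ract, E.inner_ract_left]
    have h4 : IsStarSquare (∑ k, star (D k j) * D k j) :=
      IsStarSquare.sum _ fun k _ => IsStarSquare.star_mul _
    have h5 : star (D k j) * D k j = 0 :=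
      IsStarSquare.eq_zero_of_sum_eq_zero (fun k => IsStarSquare.star_mul (D k j))
        (h4.eq_zero_of_neg h3) k
    exact CStarRing.star_mul_self_eq_zero_iff _ |>.1 h5
  obtain ⟨M, hM⟩ := h2 hD
  refine ⟨M, fun i j => ?_⟩
  rw [← hTa, hM, CStarMatrix.mul_apply]
  simp only [CStarMatrix.star_apply]

end Gram

/-- An isometry defined on a dense subspace that intertwines a dense part of the left action
extends to a 2-arrow. -/
theorem exists_hom {S : Type*} [AddCommGroup S] [Module ℂ S] {i : S →ₗ[ℂ] E} (hi : DenseRange i)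
    (j : S →ₗ[ℂ] F) (hij : ∀ x y, F.inner (j x) (j y) = E.inner (i x) (i y))
    {T : Type*} {k : T → A} (hk : DenseRange k)
    (hl : ∀ a x, ∃ y, E.lact (k a) (i x) = i y ∧ F.lact (k a) (j x) = j y) :
    ∃ α : E ⟶ F, ∀ x, Hom.toFun α (i x) = j x := by
  have hn : ∀ x, ‖j x‖ = ‖i x‖ := fun x => by
    refine (pow_left_inj₀ (norm_nonneg _) (norm_nonneg _) two_ne_zero).1 ?_
    rw [F.norm_sq_eq, E.norm_sq_eq, hij]
  obtain ⟨f, hf, -⟩ := exists_extension (C := 1) hi j (fun x => by rw [hn, one_mul])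
  have fc : Continuous f := f.continuous
  have hin : ∀ x y, F.inner (f x) (f y) = E.inner x y := fun x y => by
    refine hi.induction_on₂ (p := fun x y => F.inner (f x) (f y) = E.inner x y) ?_ ?_ x y
    · refine isClosed_eq (F.continuous_inner.comp (by fun_prop : Continuous fun q : E × E =>
        (f q.1, f q.2))) E.continuous_inner
    · intro x y
      rw [hf, hf, hij]
  refine ⟨(⟨f, fun a x => ?_, fun x b => ?_, hin⟩ : Hom E F), hf⟩
  · refine DenseRange.induction_on (e := Prod.map k i) (hk.prodMap hi)
      (p := fun q => f (E.lact q.1 q.2) = F.lact q.1 (f q.2)) (a, x) ?_ ?_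
    · exact isClosed_eq (fc.comp E.continuous_lact) (F.continuous_lact.comp (by fun_prop :
        Continuous fun q : A × E => (q.1, f q.2)))
    · rintro ⟨a, x⟩
      obtain ⟨y, h1, h2⟩ := hl a x
      simp only [Prod.map_apply]
      rw [h1, hf, hf, h2]
  -- Right linearity is automatic for a map preserving inner products: the inner square of `f (x b)
  -- - f x b` expands to zero.
  · refine eq_of_inner_sub ?_
    change F.inner (f (E.ract x b) - F.ract (f x) b) (f (E.ract x b) - F.ract (f x) b) = 0
    simp only [map_sub, LinearMap.sub_apply, inner_ract_left, F.inner_ract, hin, E.inner_ract,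
      mul_assoc, sub_self]

/-- A 2-arrow with dense range is invertible. -/
theorem exists_iso_of_dense (α : E ⟶ F) (hα : DenseRange (Hom.toFun α)) :
    ∃ e : E ≅ F, e.hom = α := by
  have hiso : Isometry (Hom.toFun α) := AddMonoidHomClass.isometry_of_norm _ (Hom.norm_map α)
  have hsurj : Function.Surjective (Hom.toFun α) := by
    rw [← Set.range_eq_univ, ← hiso.isClosedEmbedding.isClosed_range.closure_eq]
    exact hα.closure_range
  let e := LinearEquiv.ofBijective (Hom.toFun α) ⟨hiso.injective, hsurj⟩
  have he : ∀ x, e x = Hom.toFun α x := fun _ => rfl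
  have hea : ∀ y, Hom.toFun α (e.symm y) = y := fun y => e.apply_symm_apply y
  let β : Hom F E :=
    { toFun := e.symm
      map_lact := fun a x => e.injective (by
        change Hom.toFun α (e.symm _) = Hom.toFun α (E.lact a (e.symm x))
        rw [hea, Hom.map_lact, hea])
      map_ract := fun x b => e.injective (by
        change Hom.toFun α (e.symm _) = Hom.toFun α (E.ract (e.symm x) b)
        rw [hea, Hom.map_ract, hea])
      inner_map := fun x y => by
        change E.inner (e.symm x) (e.symm y) = _
        rw [← Hom.inner_map α, hea, hea] }
  exact ⟨⟨α, β, Hom.ext (LinearMap.ext fun x => e.symm_apply_apply x),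
    Hom.ext (LinearMap.ext fun x => e.apply_symm_apply x)⟩, rfl⟩

end CStarCorr

/-! ### The interior tensor product as a completion of the algebraic one. -/

section AlgebraicTensor

open scoped TensorProduct

variable {A B C : CStarAlg.{u}}

/-- The inner product on the algebraic tensor product. -/
noncomputable def CStarCorr.tensorInner (E : CStarCorr A B) (F : CStarCorr B C) :
    (E ⊗[ℂ] F) →ₗ⋆[ℂ] (E ⊗[ℂ] F) →ₗ[ℂ] C :=
  _root_.TensorProduct.lift (LinearMap.mk₂'ₛₗ (starRingEnd ℂ) (starRingEnd ℂ)
    (fun x y => _root_.TensorProduct.lift ((F.lact.compr₂ (F.inner y)) ∘ₗ E.inner x))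
    (fun x x' y => _root_.TensorProduct.ext' fun _ _ => by simp)
    (fun c x y => _root_.TensorProduct.ext' fun _ _ => by simp)
    (fun x y y' => _root_.TensorProduct.ext' fun _ _ => by simp)
    (fun c x y => _root_.TensorProduct.ext' fun _ _ => by simp))

theorem CStarCorr.tensorInner_tmul (E : CStarCorr A B) (F : CStarCorr B C) (x x' : E) (y y' : F) :
    tensorInner E F (x ⊗ₜ y) (x' ⊗ₜ y') = F.inner y (F.lact (E.inner x x') y') := rfl

/-- Factor the Gram matrix of the `x i` as `N* N`; the inner square of `∑ x i ⊗ y i` becomes `∑ₖ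
⟨vₖ, vₖ⟩` with `vₖ = ∑ᵢ N k i · y i`. -/
theorem CStarCorr.tensorInner_self (E : CStarCorr A B) (F : CStarCorr B C) (s : E ⊗[ℂ] F) :
    IsStarSquare (tensorInner E F s s) := by
  obtain ⟨n, x, y, rfl⟩ : ∃ (n : ℕ) (x : Fin n → E) (y : Fin n → F), s = ∑ i, x i ⊗ₜ y i := by
    obtain ⟨n, x, y, h⟩ := _root_.TensorProduct.exists_sum_tmul_eq s
    exact ⟨n, x, y, h⟩
  obtain ⟨N, hN⟩ := exists_gram_eq E x
  have h : tensorInner E F (∑ i, x i ⊗ₜ y i) (∑ i, x i ⊗ₜ y i) =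
      ∑ k, F.inner (∑ i, F.lact (N k i) (y i)) (∑ i, F.lact (N k i) (y i)) := by
    simp only [map_sum, LinearMap.sum_apply, tensorInner_tmul, hN, F.lact_mul, F.inner_lact]
    conv_rhs => rw [Finset.sum_comm]
    refine Finset.sum_congr rfl fun j _ => ?_
    rw [Finset.sum_comm]
  rw [h]
  exact IsStarSquare.sum _ fun k _ => F.pos _

/-- The tensor product over `ℂ` is completed without dividing by the balancing relations, since the
inner product already annihilates them (see `tmul_ract`). Nondegeneracy is inherited from `E` by
approximating the first factor. -/
theorem CStarCorr.exists_tensorProduct (E : CStarCorr A B) (F : CStarCorr B C) :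
    ∃ T : CStarCorr A C, Nonempty (E.TensorProduct F T) := by
  have hsp : Submodule.span ℂ {t : E ⊗[ℂ] F | ∃ x y, x ⊗ₜ y = t} = ⊤ :=
    _root_.TensorProduct.span_tmul_eq_top ℂ E F
  let la : A →ₗ[ℂ] (E ⊗[ℂ] F) →ₗ[ℂ] (E ⊗[ℂ] F) :=
    LinearMap.mk₂ ℂ (fun a s => LinearMap.rTensor F (E.lact a) s)
      (fun a b s => by simp [LinearMap.rTensor_add]) (fun c a s => by simp [LinearMap.rTensor_smul])
      (fun a s t => by simp) (fun c a s => by simp)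
  let ra : (E ⊗[ℂ] F) →ₗ[ℂ] C →ₗ[ℂ] (E ⊗[ℂ] F) :=
    LinearMap.mk₂ ℂ (fun s c => LinearMap.lTensor E (F.ract.flip c) s)
      (fun s t c => by simp) (fun z s c => by simp)
      (fun s c d => by simp [LinearMap.lTensor_add]) (fun z s c => by simp [LinearMap.lTensor_smul])
  have la_tmul : ∀ a x y, la a (x ⊗ₜ y) = E.lact a x ⊗ₜ y := fun _ _ _ => rfl
  have ra_tmul : ∀ x y c, ra (x ⊗ₜ y) c = x ⊗ₜ F.ract y c := fun _ _ _ => rfl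
  have ind : ∀ {p : E ⊗[ℂ] F → Prop}, (∀ x y, p (x ⊗ₜ y)) → (∀ s t, p s → p t → p (s + t)) →
      ∀ s, p s := fun {p} h1 h2 s => by
    induction s with
    | zero => simpa using h1 0 0
    | tmul x y => exact h1 x y
    | add s t hs ht => exact h2 s t hs ht
  have ip_la : ∀ a s t, tensorInner E F (la a s) t = tensorInner E F s (la (star a) t) := by
    intro a s t
    refine ind (p := fun s => tensorInner E F (la a s) t = tensorInner E F s (la (star a) t))
      (fun x y => ?_) (fun s s' h h' => by simp only [map_add, LinearMap.add_apply, h, h']) s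
    refine ind (p := fun t => tensorInner E F (la a (x ⊗ₜ y)) t = tensorInner E F (x ⊗ₜ y)
      (la (star a) t)) (fun x' y' => ?_) (fun s s' h h' => by simp only [map_add, h, h']) t
    rw [la_tmul, la_tmul, tensorInner_tmul, tensorInner_tmul, E.inner_lact]
  have la_mul : ∀ a b s, la (a * b) s = la a (la b s) := fun a b s =>
    ind (p := fun s => la (a * b) s = la a (la b s))
      (fun x y => by simp only [la_tmul, E.lact_mul])
      (fun s s' h h' => by simp only [map_add, h, h']) s
  obtain ⟨T, ι, hι, h1, h2, h3⟩ := exists_cstarCorr_completion (A := A) (B := C)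
    (jA := LinearMap.id) (jB := LinearMap.id) Function.surjective_id.denseRange
    Function.surjective_id.denseRange (tensorInner E F)
    (fun s t => by
      refine ind (p := fun s => star (tensorInner E F s t) = tensorInner E F t s) (fun x y => ?_)
        (fun s s' h h' => by simp only [map_add, LinearMap.add_apply, star_add, h, h']) s
      refine ind (p := fun t => star (tensorInner E F (x ⊗ₜ y) t) = tensorInner E F t (x ⊗ₜ y))
        (fun x' y' => ?_)
        (fun s s' h h' => by simp only [map_add, LinearMap.add_apply, star_add, h, h']) t
      rw [tensorInner_tmul, tensorInner_tmul, F.star_inner, F.inner_lact, E.star_inner])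
    (tensorInner_self E F) ra
    (fun s t c => by
      refine ind (p := fun s => tensorInner E F s (ra t c) = tensorInner E F s t * c)
        (fun x y => ?_)
        (fun s s' h h' => by simp only [map_add, LinearMap.add_apply, h, h', add_mul]) s
      refine ind (p := fun t => tensorInner E F (x ⊗ₜ y) (ra t c) =
        tensorInner E F (x ⊗ₜ y) t * c) (fun x' y' => ?_)
        (fun s s' h h' => by simp only [map_add, LinearMap.add_apply, h, h', add_mul]) t
      rw [ra_tmul, tensorInner_tmul, tensorInner_tmul, F.lact_ract, F.inner_ract])
    la (fun a => ⟨star a, rfl, ip_la a⟩) (fun a b => ⟨a * b, rfl, la_mul a b⟩)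
    (norm_inner_lact_le (tensorInner E F) (tensorInner_self E F) la ip_la la_mul)
    {t | ∃ x y, x ⊗ₜ y = t} hsp (by
      rintro _ ⟨x, y, rfl⟩ ε hε
      have hc : Continuous fun z : E => tensorInner E F (x ⊗ₜ y - z ⊗ₜ y) (x ⊗ₜ y - z ⊗ₜ y) := by
        have : ∀ z : E, tensorInner E F (x ⊗ₜ y - z ⊗ₜ y) (x ⊗ₜ y - z ⊗ₜ y) =
            F.inner y (F.lact (E.inner (x - z) (x - z)) y) := fun z => by
          rw [← _root_.TensorProduct.sub_tmul, tensorInner_tmul]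
        simp only [this]
        have hs : Continuous fun z : E => x - z := by fun_prop
        exact F.continuous_inner.comp₂ continuous_const
          (F.continuous_lact.comp₂ (E.continuous_inner.comp₂ hs hs) continuous_const)
      have ho : IsOpen {z : E | ‖tensorInner E F (x ⊗ₜ y - z ⊗ₜ y) (x ⊗ₜ y - z ⊗ₜ y)‖ < ε} :=
        isOpen_lt hc.norm continuous_const
      obtain ⟨z, hz, hz'⟩ := E.nondegenerate.exists_mem_open ho ⟨x, by simpa using hε⟩
      refine ⟨z ⊗ₜ y, ?_, hz'⟩
      refine (Submodule.span_le (p := (Submodule.span ℂ {z | ∃ a x, la a x = z}).comap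
        ((_root_.TensorProduct.mk ℂ E F).flip y))).2 ?_ hz
      rintro _ ⟨a, x', rfl⟩
      exact Submodule.subset_span ⟨a, x' ⊗ₜ y, rfl⟩)
  refine ⟨T, ⟨⟨(_root_.TensorProduct.mk ℂ E F).compr₂ ι, fun x y x' y' => h1 _ _, fun a x y => h3 _ _,
    fun x y c => h2 _ _, ?_⟩⟩⟩
  have : (Submodule.span ℂ {z | ∃ x y, (_root_.TensorProduct.mk ℂ E F).compr₂ ι x y = z}) =
      LinearMap.range ι := by
    rw [← Submodule.map_top, ← hsp, Submodule.map_span]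
    congr 1
    ext z
    simp
  rw [this]
  exact hι

end AlgebraicTensor

/-! ### Completed tensor products -/

namespace CStarCorr

variable {A B C D : CStarAlg.{u}}

@[simp]
theorem comp_toFun {E F G : CStarCorr A B} (α : E ⟶ F) (β : F ⟶ G) (x : E) :
    Hom.toFun (α ≫ β) x = Hom.toFun β (Hom.toFun α x) := rfl

@[simp]
theorem id_toFun (E : CStarCorr A B) (x : E) : Hom.toFun (𝟙 E) x = x := rfl

theorem inv_hom_toFun {E F : CStarCorr A B} (e : E ≅ F) (x : E) :
    Hom.toFun e.inv (Hom.toFun e.hom x) = x := by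
  rw [← comp_toFun, e.hom_inv_id, id_toFun]

namespace TensorProduct

variable {E : CStarCorr A B} {F : CStarCorr B C} {T : CStarCorr A C} (t : E.TensorProduct F T)

theorem norm_tmul_le (x : E) (y : F) : ‖t.tmul x y‖ ≤ 2 * ‖x‖ * ‖y‖ := by
  refine le_of_sq_le_sq ?_ (by positivity)
  rw [T.norm_sq_eq, t.inner_tmul]
  have h1 := F.norm_inner_le y (F.lact (E.inner x x) y)
  have h2 := F.norm_lact_le (E.inner x x) y
  rw [← E.norm_sq_eq, one_mul] at h2
  calc _ ≤ _ := h1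
    _ ≤ 4 * ‖y‖ * (‖x‖ ^ 2 * ‖y‖) := by gcongr
    _ = _ := by ring

theorem continuous_tmul : Continuous fun q : E × F => t.tmul q.1 q.2 :=
  ((t.tmul.mkContinuous₂ 2 t.norm_tmul_le).continuous.comp continuous_fst).clm_apply
    continuous_snd

theorem continuous_tmul_left (y : F) : Continuous fun x => t.tmul x y :=
  t.continuous_tmul.comp₂ continuous_id continuous_const

theorem continuous_tmul_right (x : E) : Continuous (t.tmul x) :=
  t.continuous_tmul.comp₂ continuous_const continuous_id

/-- Balancing over `B` need not be part of the structure: the difference of the two sides has inner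
square zero. -/
theorem tmul_ract (x : E) (b : B) (y : F) : t.tmul (E.ract x b) y = t.tmul x (F.lact b y) := by
  refine eq_of_inner_sub ?_
  simp only [map_sub, LinearMap.sub_apply, t.inner_tmul, E.inner_ract, inner_ract_left, F.lact_mul,
    F.inner_lact]
  abel

theorem linearMap_ext {M : Type*} [AddCommGroup M] [Module ℂ M] [TopologicalSpace M] [T2Space M]
    {f g : T →ₗ[ℂ] M} (hf : Continuous f) (hg : Continuous g)
    (h : ∀ x y, f (t.tmul x y) = g (t.tmul x y)) : f = g := by
  have hd := t.dense_tmul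
  refine LinearMap.ext fun z => ?_
  refine isClosed_property (e := ((↑) : Submodule.span ℂ {z | ∃ x y, t.tmul x y = z} → T))
    (p := fun z => f z = g z) hd.denseRange_val (isClosed_eq hf hg) (fun z => ?_) z
  obtain ⟨z, hz⟩ := z
  refine (Submodule.span_le (p := LinearMap.eqLocus f g)).2 ?_ hz
  rintro _ ⟨x, y, rfl⟩
  exact h x y

theorem hom_ext {T' : CStarCorr A C} {α β : T ⟶ T'}
    (h : ∀ x y, Hom.toFun α (t.tmul x y) = Hom.toFun β (t.tmul x y)) : α = β :=
  Hom.ext (t.linearMap_ext (Hom.continuous α) (Hom.continuous β) h)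

theorem hom_ext_dense {T' : CStarCorr A C} {P Q : Type*} {i : P → E} {j : Q → F}
    (hi : DenseRange i) (hj : DenseRange j) {α β : T ⟶ T'}
    (h : ∀ p q, Hom.toFun α (t.tmul (i p) (j q)) = Hom.toFun β (t.tmul (i p) (j q))) : α = β := by
  refine t.hom_ext fun x y => ?_
  refine DenseRange.induction_on (hi.prodMap hj)
    (p := fun q => Hom.toFun α (t.tmul q.1 q.2) = Hom.toFun β (t.tmul q.1 q.2)) (x, y)
    (isClosed_eq ((Hom.continuous α).comp t.continuous_tmul)
      ((Hom.continuous β).comp t.continuous_tmul)) fun q => h q.1 q.2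

theorem mem_closure_of_tmul {S : Submodule ℂ T} (hS : IsClosed (S : Set T))
    (h : ∀ x y, t.tmul x y ∈ S) (z : T) : z ∈ S := by
  have hd : z ∈ closure (Submodule.span ℂ {z | ∃ x y, t.tmul x y = z} : Set T) := t.dense_tmul z
  refine closure_minimal ?_ hS hd
  refine Submodule.span_le.2 ?_
  rintro _ ⟨x, y, rfl⟩
  exact h x y

theorem mem_closure_of_tmul_dense {P Q : Type*} {i : P → E} {j : Q → F}
    (hi : DenseRange i) (hj : DenseRange j) {S : Submodule ℂ T} (hS : IsClosed (S : Set T))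
    (h : ∀ p q, t.tmul (i p) (j q) ∈ S) (z : T) : z ∈ S := by
  refine t.mem_closure_of_tmul hS (fun x y => ?_) z
  exact DenseRange.induction_on (hi.prodMap hj) (p := fun q => t.tmul q.1 q.2 ∈ S) (x, y)
    (hS.preimage t.continuous_tmul) fun q => h q.1 q.2

/-- Isometric bimodule maps out of a tensor product. -/
theorem exists_hom_of_bilin {T' : CStarCorr A C} (m : E →ₗ[ℂ] F →ₗ[ℂ] T')
    (hm : ∀ x y x' y', T'.inner (m x y) (m x' y') = F.inner y (F.lact (E.inner x x') y'))
    (hl : ∀ a x y, T'.lact a (m x y) = m (E.lact a x) y) :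
    ∃ α : T ⟶ T', ∀ x y, Hom.toFun α (t.tmul x y) = m x y := by
  have hi : DenseRange (_root_.TensorProduct.lift t.tmul) := by
    intro z
    refine t.mem_closure_of_tmul
      (S := (LinearMap.range (_root_.TensorProduct.lift t.tmul)).topologicalClosure)
      (Submodule.isClosed_topologicalClosure _) (fun x y => subset_closure ?_) z
    exact ⟨x ⊗ₜ[ℂ] y, rfl⟩
  obtain ⟨α, hα⟩ := exists_hom (F := T') hi (_root_.TensorProduct.lift m) (fun s s' => by
    induction s with
    | zero => simp
    | add s₁ s₂ h₁ h₂ => simp only [map_add, LinearMap.add_apply, h₁, h₂]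
    | tmul x y =>
      induction s' with
      | zero => simp
      | add s₁ s₂ h₁ h₂ => simp only [map_add, h₁, h₂]
      | tmul x' y' =>
        simp only [_root_.TensorProduct.lift.tmul]
        rw [hm, t.inner_tmul])
    (k := fun a : A => a) Function.surjective_id.denseRange (fun a s => by
      refine ⟨_root_.TensorProduct.map (E.lact a) LinearMap.id s, ?_⟩
      induction s with
      | zero => simp
      | add s₁ s₂ h₁ h₂ => simp only [map_add, h₁, h₂, and_self]
      | tmul x y =>
        simp only [_root_.TensorProduct.lift.tmul, _root_.TensorProduct.map_tmul,
          LinearMap.id_apply, hl, t.lact_tmul, and_self])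
  exact ⟨α, fun x y => hα (x ⊗ₜ[ℂ] y)⟩

/-- A bilinear map with dense span and the inner products of a tensor product identifies the
tensor product. -/
theorem exists_iso_of_bilin {T' : CStarCorr A C} (m : E →ₗ[ℂ] F →ₗ[ℂ] T')
    (hm : ∀ x y x' y', T'.inner (m x y) (m x' y') = F.inner y (F.lact (E.inner x x') y'))
    (hl : ∀ a x y, T'.lact a (m x y) = m (E.lact a x) y)
    (hd : ∀ S : Submodule ℂ T', IsClosed (S : Set T') → (∀ x y, m x y ∈ S) → S = ⊤) :
    ∃ e : T ≅ T', ∀ x y, Hom.toFun e.hom (t.tmul x y) = m x y := by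
  obtain ⟨α, hα⟩ := t.exists_hom_of_bilin m hm hl
  obtain ⟨e, rfl⟩ := exists_iso_of_dense α (by
    intro z
    have := hd (LinearMap.range (Hom.toFun α)).topologicalClosure
      (Submodule.isClosed_topologicalClosure _) fun x y => subset_closure ⟨t.tmul x y, hα x y⟩
    exact (this ▸ Submodule.mem_top : z ∈ (LinearMap.range (Hom.toFun α)).topologicalClosure))
  exact ⟨e, hα⟩

end TensorProduct

/-- Vectors of the form `x · b` are dense in a Hilbert module. -/
theorem mem_of_ract_mem (E : CStarCorr A B) {S : Submodule ℂ E} (hS : IsClosed (S : Set E))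
    (h : ∀ x b, E.ract x b ∈ S) : S = ⊤ := by
  refine eq_top_iff.2 fun x _ => ?_
  let := CStarAlgebra.spectralOrder B
  have := CStarAlgebra.spectralOrderedRing B
  have hu := CStarAlgebra.increasingApproximateUnit B
  have := hu.neBot
  obtain ⟨c, hc⟩ := E.inner_self_nonneg x
  -- With `⟨x, x⟩ = c* c`, the inner square of `x u - x` is `(c u - c)* (c u - c)`. An approximate
  -- unit of `B` therefore converges to the identity on `x`.
  have hnorm : ∀ u : B, ‖E.ract x u - x‖ = ‖c * u - c‖ := fun u => by
    refine (pow_left_inj₀ (norm_nonneg _) (norm_nonneg _) two_ne_zero).1 ?_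
    rw [E.norm_sq_eq, sq, ← CStarRing.norm_star_mul_self]
    congr 1
    simp only [map_sub, LinearMap.sub_apply, E.inner_ract, inner_ract_left, hc, star_sub, star_mul,
      mul_sub, sub_mul, mul_assoc]
  have ht : Filter.Tendsto (fun u : B => E.ract x u) (CStarAlgebra.approximateUnit B) (𝓝 x) := by
    rw [tendsto_iff_norm_sub_tendsto_zero]
    simp only [hnorm]
    exact tendsto_iff_norm_sub_tendsto_zero.1 (hu.tendsto_mul_left c)
  exact hS.mem_of_tendsto ht (Filter.Eventually.of_forall fun u => h x u)

theorem mem_of_lact_mem (E : CStarCorr A B) {S : Submodule ℂ E} (hS : IsClosed (S : Set E))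
    (h : ∀ a x, E.lact a x ∈ S) : S = ⊤ := by
  refine eq_top_iff.2 fun x _ => ?_
  refine closure_minimal ?_ hS (E.nondegenerate x)
  refine Submodule.span_le.2 ?_
  rintro _ ⟨a, x, rfl⟩
  exact h a x

open scoped _root_.TensorProduct in
-- Both iterated tensor products contain a dense image of the algebraic triple tensor product, with
-- the same inner product and the same left action, so they are identified by a unitary.
theorem exists_associator {E₁ : CStarCorr A B} {E₂ : CStarCorr B C} {E₃ : CStarCorr C D}
    {E₁₂ : CStarCorr A C} {E₂₃ : CStarCorr B D} {T T' : CStarCorr A D}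
    (t₁₂ : E₁.TensorProduct E₂ E₁₂) (t₂₃ : E₂.TensorProduct E₃ E₂₃)
    (t : E₁.TensorProduct E₂₃ T) (t' : E₁₂.TensorProduct E₃ T') :
    ∃ e : T ≅ T', ∀ x₁ x₂ x₃, Hom.toFun e.hom (t.tmul x₁ (t₂₃.tmul x₂ x₃)) =
      t'.tmul (t₁₂.tmul x₁ x₂) x₃ := by
  let i : (E₁ ⊗[ℂ] (E₂ ⊗[ℂ] E₃)) →ₗ[ℂ] T :=
    _root_.TensorProduct.lift (t.tmul.compl₂ (_root_.TensorProduct.lift t₂₃.tmul))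
  let j : (E₁ ⊗[ℂ] (E₂ ⊗[ℂ] E₃)) →ₗ[ℂ] T' :=
    (_root_.TensorProduct.lift (t'.tmul ∘ₗ (_root_.TensorProduct.lift t₁₂.tmul))) ∘ₗ
      (_root_.TensorProduct.assoc ℂ E₁ E₂ E₃).symm.toLinearMap
  have hi : ∀ x₁ x₂ x₃, i (x₁ ⊗ₜ (x₂ ⊗ₜ x₃)) = t.tmul x₁ (t₂₃.tmul x₂ x₃) := fun _ _ _ => rfl
  have hj : ∀ x₁ x₂ x₃, j (x₁ ⊗ₜ (x₂ ⊗ₜ x₃)) = t'.tmul (t₁₂.tmul x₁ x₂) x₃ := fun _ _ _ => rfl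
  have ind : ∀ {p : E₁ ⊗[ℂ] (E₂ ⊗[ℂ] E₃) → Prop}, (∀ x y z, p (x ⊗ₜ (y ⊗ₜ z))) →
      (∀ s t, p s → p t → p (s + t)) → ∀ s, p s := fun {p} h1 h2 s => by
    induction s with
    | zero => simpa using h1 0 0 0
    | add s t hs ht => exact h2 s t hs ht
    | tmul x s =>
      induction s with
      | zero => simpa using h1 0 0 0
      | add s t hs ht =>
        rw [_root_.TensorProduct.tmul_add]
        exact h2 _ _ hs ht
      | tmul y z => exact h1 x y z
  have di : DenseRange i := fun z => by
    have hcl := (LinearMap.range i).isClosed_topologicalClosure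
    refine t.mem_closure_of_tmul hcl (fun x₁ z => ?_) z
    refine t₂₃.mem_closure_of_tmul (S := (LinearMap.range i).topologicalClosure.comap (t.tmul x₁))
      (hcl.preimage (t.continuous_tmul_right x₁)) (fun x₂ x₃ => ?_) z
    exact subset_closure ⟨x₁ ⊗ₜ (x₂ ⊗ₜ x₃), rfl⟩
  have dj : DenseRange j := fun z => by
    have hcl := (LinearMap.range j).isClosed_topologicalClosure
    refine t'.mem_closure_of_tmul hcl (fun z x₃ => ?_) z
    refine t₁₂.mem_closure_of_tmul
      (S := (LinearMap.range j).topologicalClosure.comap (t'.tmul.flip x₃))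
      (hcl.preimage (t'.continuous_tmul_left x₃)) (fun x₁ x₂ => ?_) z
    exact subset_closure ⟨x₁ ⊗ₜ (x₂ ⊗ₜ x₃), rfl⟩
  obtain ⟨α, hα⟩ := exists_hom di j (fun s s' => by
      refine ind (p := fun s => T'.inner (j s) (j s') = T.inner (i s) (i s')) (fun x₁ x₂ x₃ => ?_)
        (fun s₁ s₂ h₁ h₂ => by simp only [map_add, LinearMap.add_apply, h₁, h₂]) s
      refine ind (p := fun s' => T'.inner (j _) (j s') = T.inner (i _) (i s'))
        (fun y₁ y₂ y₃ => ?_) (fun s₁ s₂ h₁ h₂ => by simp only [map_add, h₁, h₂]) s'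
      simp only [hi, hj, t.inner_tmul, t'.inner_tmul, t₁₂.inner_tmul, t₂₃.lact_tmul,
        t₂₃.inner_tmul])
    (k := fun a : A => a) Function.surjective_id.denseRange (fun a s => by
      refine ⟨_root_.TensorProduct.map (E₁.lact a) LinearMap.id s, ?_⟩
      refine ind (p := fun s => T.lact a (i s) = i (_root_.TensorProduct.map (E₁.lact a)
        LinearMap.id s) ∧ T'.lact a (j s) = j (_root_.TensorProduct.map (E₁.lact a)
        LinearMap.id s)) (fun x₁ x₂ x₃ => ?_)
        (fun s₁ s₂ h₁ h₂ => by simp only [map_add, h₁, h₂, and_self]) s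
      simp only [hi, hj, _root_.TensorProduct.map_tmul, LinearMap.id_apply, t.lact_tmul,
        t'.lact_tmul, t₁₂.lact_tmul, and_self])
  obtain ⟨e, rfl⟩ := exists_iso_of_dense α (dj.mono (by
    rintro _ ⟨s, rfl⟩
    exact ⟨i s, hα s⟩))
  exact ⟨e, fun x₁ x₂ x₃ => hα (x₁ ⊗ₜ (x₂ ⊗ₜ x₃))⟩

end CStarCorr

/-! ### The bicategory of C*-correspondences exists -/

/-- Cells are continuous and thus determined on elementary tensors, where each axiom becomes an
identity between explicit formulas. Only the `TensorProduct` structure of the chosen completions is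
used. -/
theorem nonempty_corrBicategory : Nonempty CorrBicategory.{u} := by
  choose T ht using @CStarCorr.exists_tensorProduct.{u}
  let t : ∀ {A B C : CStarAlg.{u}} (E : CStarCorr A B) (F : CStarCorr B C),
    E.TensorProduct F (T E F) := fun E F => (ht E F).some
  have wl : ∀ {A B C : CStarAlg.{u}} (F : CStarCorr B C) {E₁ E₂ : CStarCorr A B} (α : E₁ ⟶ E₂),
      ∃ β : T E₁ F ⟶ T E₂ F, ∀ x y, CStarCorr.Hom.toFun β ((t E₁ F).tmul x y) =
        (t E₂ F).tmul (CStarCorr.Hom.toFun α x) y := fun F E₁ E₂ α =>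
    (t E₁ F).exists_hom_of_bilin ((t E₂ F).tmul ∘ₗ CStarCorr.Hom.toFun α)
      (fun x y x' y' => by
        simp only [LinearMap.comp_apply, (t E₂ F).inner_tmul, CStarCorr.Hom.inner_map])
      (fun a x y => by
        simp only [LinearMap.comp_apply, (t E₂ F).lact_tmul, CStarCorr.Hom.map_lact])
  have wr : ∀ {A B C : CStarAlg.{u}} {F₁ F₂ : CStarCorr B C} (β : F₁ ⟶ F₂) (E : CStarCorr A B),
      ∃ γ : T E F₁ ⟶ T E F₂, ∀ x y, CStarCorr.Hom.toFun γ ((t E F₁).tmul x y) =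
        (t E F₂).tmul x (CStarCorr.Hom.toFun β y) := fun {_ _ _ F₁ F₂} β E =>
    (t E F₁).exists_hom_of_bilin ((t E F₂).tmul.compl₂ (CStarCorr.Hom.toFun β))
      (fun x y x' y' => by
        simp only [LinearMap.compl₂_apply, (t E F₂).inner_tmul, ← CStarCorr.Hom.map_lact,
          CStarCorr.Hom.inner_map])
      (fun a x y => by simp only [LinearMap.compl₂_apply, (t E F₂).lact_tmul])
  have lu : ∀ {A B : CStarAlg.{u}} (E : CStarCorr A B), ∃ e : T E (CStarCorr.one B) ≅ E,
      ∀ x b, CStarCorr.Hom.toFun e.hom ((t E (CStarCorr.one B)).tmul x b) = E.ract x b :=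
    fun {A B} E => (t E (CStarCorr.one B)).exists_iso_of_bilin E.ract
      (fun x b x' b' => by
        have h : ∀ b b' : B, E.inner (E.ract x b) (E.ract x' b') = star b * (E.inner x x' * b') :=
          fun b b' => by rw [E.inner_ract, E.inner_ract_left, mul_assoc]
        exact h b b')
      (fun a x b => E.lact_ract a x b) (fun S hS h => E.mem_of_ract_mem hS h)
  have ru : ∀ {A B : CStarAlg.{u}} (E : CStarCorr A B), ∃ e : T (CStarCorr.one A) E ≅ E,
      ∀ a x, CStarCorr.Hom.toFun e.hom ((t (CStarCorr.one A) E).tmul a x) = E.lact a x :=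
    fun {A B} E => (t (CStarCorr.one A) E).exists_iso_of_bilin E.lact
      (fun a x a' x' => by
        exact (E.inner_lact _ _ _).trans (congrArg _ (E.lact_mul _ _ _).symm))
      (fun a b x => (E.lact_mul a b x).symm) (fun S hS h => E.mem_of_lact_mem hS h)
  choose W hW using @wl
  choose V hV using @wr
  choose L hL using @lu
  choose R hR using @ru
  choose P hP using fun {A B C D : CStarAlg.{u}} (E₁ : CStarCorr A B) (E₂ : CStarCorr B C)
    (E₃ : CStarCorr C D) => CStarCorr.exists_associator (t E₁ E₂) (t E₂ E₃) (t E₁ (T E₂ E₃))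
      (t (T E₁ E₂) E₃)
  have ext₃ : ∀ {A B C D : CStarAlg.{u}} {E₁ : CStarCorr A B} {E₂ : CStarCorr B C}
      {E₃ : CStarCorr C D} {M : CStarCorr A D} {α β : T E₁ (T E₂ E₃) ⟶ M},
      (∀ x₁ x₂ x₃, CStarCorr.Hom.toFun α ((t E₁ (T E₂ E₃)).tmul x₁ ((t E₂ E₃).tmul x₂ x₃)) =
        CStarCorr.Hom.toFun β ((t E₁ (T E₂ E₃)).tmul x₁ ((t E₂ E₃).tmul x₂ x₃))) → α = β := by
    intro A B C D E₁ E₂ E₃ M α β h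
    refine (t _ _).hom_ext fun x₁ z => ?_
    exact LinearMap.congr_fun ((t E₂ E₃).linearMap_ext
      (f := CStarCorr.Hom.toFun α ∘ₗ (t E₁ (T E₂ E₃)).tmul x₁)
      (g := CStarCorr.Hom.toFun β ∘ₗ (t E₁ (T E₂ E₃)).tmul x₁)
      ((CStarCorr.Hom.continuous α).comp ((t _ _).continuous_tmul_right _))
      ((CStarCorr.Hom.continuous β).comp ((t _ _).continuous_tmul_right _)) (h x₁)) z
  refine ⟨{ comp := fun F E => T E F
            whiskerLeft := fun F _ _ α => W F α
            whiskerRight := fun β E => V β E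
            associator := fun E₃ E₂ E₁ => P E₁ E₂ E₃
            leftUnitor := fun E => L E
            rightUnitor := fun E => R E
            whiskerLeft_id := ?_
            whiskerLeft_comp := ?_
            id_whiskerLeft := ?_
            comp_whiskerLeft := ?_
            id_whiskerRight := ?_
            comp_whiskerRight := ?_
            whiskerRight_id := ?_
            whiskerRight_comp := ?_
            whisker_assoc := ?_
            whisker_exchange := ?_
            pentagon := ?_
            triangle := ?_
            tensor := fun E F => t E F
            whiskerLeft_tmul := fun F _ _ α => hW F α
            whiskerRight_tmul := fun β E => hV β E
            associator_tmul := fun E₁ E₂ E₃ => hP E₁ E₂ E₃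
            leftUnitor_tmul := fun E => hL E
            rightUnitor_tmul := fun E => hR E }⟩
  · intro A B C f g
    exact (t _ _).hom_ext fun x y => by simp [hW]
  · intro A B C f g h i η θ
    exact (t _ _).hom_ext fun x y => by simp [hW]
  · intro A B f g η
    -- Inverse unitors and associators have no direct formula on elementary tensors, so they are
    -- moved to the other side first, here and below. What remains here is right linearity of `η`.
    rw [← Category.assoc, Iso.eq_comp_inv]
    exact (t _ _).hom_ext fun x y => by
      simp only [CStarCorr.comp_toFun, hW, hL]
      exact (CStarCorr.Hom.map_ract _ _ _).symm
  · intro A B C D f g h h' η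
    rw [← Category.assoc, Iso.eq_comp_inv]
    exact ext₃ fun x y z => by simp [hW, hP]
  · intro A B C f g
    exact (t _ _).hom_ext fun x y => by simp [hV]
  · intro A B C f g h η θ i
    exact (t _ _).hom_ext fun x y => by simp [hV]
  · intro A B f g η
    rw [← Category.assoc, Iso.eq_comp_inv]
    exact (t _ _).hom_ext fun x y => by
      simp only [CStarCorr.comp_toFun, hV, hR]
      exact (CStarCorr.Hom.map_lact _ _ _).symm
  · intro A B C D f f' η g h
    rw [Iso.eq_inv_comp]
    exact ext₃ fun x y z => by simp [hV, hP]
  · intro A B C D f g g' η h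
    rw [← Category.assoc, Iso.eq_comp_inv]
    exact ext₃ fun x y z => by simp [hV, hW, hP]
  · intro A B C f g h i η θ
    exact (t _ _).hom_ext fun x y => by simp [hV, hW]
  · intro A B C D E f g h i
    -- The third factor `z` lies in a completed tensor product itself, so one more density argument
    -- reduces it to `x₃ ⊗ x₄`.
    refine ext₃ fun x₁ x₂ z => ?_
    set α := V (P h g f).hom i ≫ (P i (T h g) f).hom ≫ W f (P i h g).hom
    set β := (P i h (T g f)).hom ≫ (P (T i h) g f).hom
    refine LinearMap.congr_fun ((t g f).linearMap_ext
      (f := CStarCorr.Hom.toFun α ∘ₗ (t i (T h (T g f))).tmul x₁ ∘ₗ (t h (T g f)).tmul x₂)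
      (g := CStarCorr.Hom.toFun β ∘ₗ (t i (T h (T g f))).tmul x₁ ∘ₗ (t h (T g f)).tmul x₂)
      ((CStarCorr.Hom.continuous α).comp (((t _ _).continuous_tmul_right _).comp
        ((t _ _).continuous_tmul_right _)))
      ((CStarCorr.Hom.continuous β).comp (((t _ _).continuous_tmul_right _).comp
        ((t _ _).continuous_tmul_right _))) fun x₃ x₄ => ?_) z
    simp [α, β, hV, hW, hP]
  · intro A B C f g
    exact ext₃ fun x y z => by
      simp only [CStarCorr.comp_toFun, hV, hW, hP, hL, hR]
      -- The triangle axiom is exactly the balancing relation `x b ⊗ y = x ⊗ b y`.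
      exact (t _ _).tmul_ract _ _ _

/-! ### Locally Hausdorff, locally compact spaces -/

/-- Locally compact spaces in which every point has an open Hausdorff neighbourhood. -/
class IsLocallyLCH (X : Type*) [TopologicalSpace X] : Prop where
  locallyCompactSpace : LocallyCompactSpace X
  exists_t2 : ∀ x : X, ∃ U : Set X, IsOpen U ∧ x ∈ U ∧ T2Space U

attribute [instance] IsLocallyLCH.locallyCompactSpace

section LocallyLCH

variable {X Y Z : Type*} [TopologicalSpace X] [TopologicalSpace Y] [TopologicalSpace Z]

theorem t2Space_of_injOn {f : X → Y} {U : Set X} {V : Set Y} [T2Space V] (hf : ContinuousOn f U)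
    (hi : Set.InjOn f U) (hUV : Set.MapsTo f U V) : T2Space U :=
  T2Space.of_injective_continuous (f := hUV.restrict f U V)
    (fun x y h => Subtype.ext (hi x.2 y.2 (congrArg Subtype.val h)))
    (hf.mapsToRestrict hUV)

theorem t2Space_subset {U V : Set X} [T2Space V] (h : U ⊆ V) : T2Space U :=
  t2Space_of_injOn (f := id) continuousOn_id (fun _ _ _ _ h => h) h

instance (priority := 100) IsLocallyLCH.of_t2 [T2Space X] [LocallyCompactSpace X] :
    IsLocallyLCH X :=
  ⟨inferInstance, fun x => ⟨Set.univ, isOpen_univ, Set.mem_univ x, inferInstance⟩⟩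

instance (priority := 100) IsLocallyLCH.t1Space [IsLocallyLCH X] : T1Space X := by
  rw [t1Space_iff_exists_open]
  intro x y hxy
  obtain ⟨U, hU, hxU, _⟩ := IsLocallyLCH.exists_t2 x
  by_cases hy : y ∈ U
  · obtain ⟨V, hV, h1, h2⟩ := t1Space_iff_exists_open.1 (inferInstance : T1Space U)
      (show (⟨x, hxU⟩ : U) ≠ ⟨y, hy⟩ from fun h => hxy (congrArg Subtype.val h))
    refine ⟨Subtype.val '' V, hU.isOpenMap_subtype_val _ hV, ⟨_, h1, rfl⟩, ?_⟩
    rintro ⟨z, hz, rfl⟩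
    exact h2 hz
  · exact ⟨U, hU, hxU, hy⟩

/-- Both properties are local and pass through charts. Thus arrow spaces and correspondences, though
possibly non-Hausdorff, inherit them from the object spaces via their anchor maps. -/
theorem IsLocalHomeomorph.isLocallyLCH [IsLocallyLCH Y] {f : X → Y} (hf : IsLocalHomeomorph f) :
    IsLocallyLCH X where
  locallyCompactSpace := ⟨fun x n hn => by
    obtain ⟨e, hx, rfl⟩ := hf x
    have h1 : e '' (n ∩ e.source) ∈ 𝓝 (e x) := by
      rw [← e.map_nhds_eq hx]
      exact Filter.image_mem_map (Filter.inter_mem hn (e.open_source.mem_nhds hx))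
    obtain ⟨K, hK, hKs, hKc⟩ := LocallyCompactSpace.local_compact_nhds _ _ h1
    have hKt : K ⊆ e.target := by
      rintro _ hk
      obtain ⟨y, hy, rfl⟩ := hKs hk
      exact e.map_source hy.2
    refine ⟨e.symm '' K, ?_, ?_, hKc.image_of_continuousOn (e.continuousOn_symm.mono hKt)⟩
    · have := Filter.image_mem_map (m := e.symm) hK
      rwa [e.symm.map_nhds_eq (e.map_source hx), e.left_inv hx] at this
    · rintro _ ⟨_, hk, rfl⟩
      obtain ⟨y, hy, rfl⟩ := hKs hk
      rw [e.left_inv hy.2]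
      exact hy.1⟩
  exists_t2 x := by
    obtain ⟨e, hx, rfl⟩ := hf x
    obtain ⟨V, hV, hxV, _⟩ := IsLocallyLCH.exists_t2 (e x)
    refine ⟨e.source ∩ e ⁻¹' V, e.isOpen_inter_preimage hV, ⟨hx, hxV⟩, ?_⟩
    exact t2Space_of_injOn (V := V) (e.continuousOn.mono Set.inter_subset_left)
      (e.injOn.mono Set.inter_subset_left) (fun _ h => h.2)

theorem IsLocalHomeomorph.exists_isOpen_injOn {f : X → Y} (hf : IsLocalHomeomorph f) (x : X) :
    ∃ U, IsOpen U ∧ x ∈ U ∧ Set.InjOn f U := by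
  obtain ⟨e, hx, rfl⟩ := hf x
  exact ⟨e.source, e.open_source, hx, e.injOn⟩

theorem IsLocalHomeomorph.isOpenEmbedding_restrict {f : X → Y} (hf : IsLocalHomeomorph f)
    {U : Set X} (hU : IsOpen U) (hi : Set.InjOn f U) : IsOpenEmbedding (U.domRestrict f) :=
  (hf.comp hU.isOpenEmbedding_subtypeVal.isLocalHomeomorph).isOpenEmbedding_of_injective
    (Set.injOn_iff_injective.1 hi)

/-- Fibres of local homeomorphisms meet compact sets in finite sets. -/
theorem IsLocalHomeomorph.finite_fiber [T1Space Y] {f : X → Y} (hf : IsLocalHomeomorph f)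
    {C : Set X} (hC : IsCompact C) (y : Y) : {x | x ∈ C ∧ f x = y}.Finite := by
  have hcl : IsClosed (f ⁻¹' {y}) := isClosed_singleton.preimage hf.continuous
  refine (hC.inter_right hcl).finite (IsDiscrete.of_nhdsWithin fun x hx => ?_)
  obtain ⟨U, hU, hxU, hi⟩ := hf.exists_isOpen_injOn x
  rw [Filter.le_pure_iff]
  refine Filter.mem_of_superset (inter_mem_nhdsWithin _ (hU.mem_nhds hxU)) ?_
  rintro z ⟨hz, hzU⟩
  exact hi hzU hxU (hz.2.trans hx.2.symm)

end LocallyLCH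

/-! ### The function spaces `𝔖(X)` -/

section SFun

variable {X Y Z : Type u} [TopologicalSpace X] [TopologicalSpace Y] [TopologicalSpace Z]

/-- `f` is continuous on the open Hausdorff set `V`, and zero outside a compact subset of `V`. -/
structure IsCcOn (V : Set X) (f : X → ℂ) : Prop where
  isOpen : IsOpen V
  t2Space : T2Space V
  continuousOn : ContinuousOn f V
  exists_compact : ∃ K, IsCompact K ∧ K ⊆ V ∧ ∀ x ∉ K, f x = 0

theorem IsCcOn.mem {V : Set X} {f : X → ℂ} (h : IsCcOn V f) : f ∈ SFun X := by
  obtain ⟨K, hK, hKV, hf⟩ := h.exists_compact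
  exact Submodule.subset_span ⟨V, K, h.isOpen, h.t2Space, hK, hKV, h.continuousOn, hf⟩

/-- Closure of `p` under scalars is not required, because a multiple of a generator is again a
generator; the induction carries an arbitrary scalar along. -/
theorem SFun.induction {p : (X → ℂ) → Prop} (cc : ∀ V f, IsCcOn V f → p f) (zero : p 0)
    (add : ∀ f g, f ∈ SFun X → g ∈ SFun X → p f → p g → p (f + g)) {f : X → ℂ}
    (hf : f ∈ SFun X) : p f := by
  have h : ∀ f (V K : Set X), IsOpen V → T2Space V → IsCompact K → K ⊆ V → ContinuousOn f V →
      (∀ x ∉ K, f x = 0) → IsCcOn V f := fun f V K h1 h2 h3 h4 h5 h6 => ⟨h1, h2, h5, K, h3, h4, h6⟩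
  have key : ∀ c : ℂ, p (c • f) := by
    refine Submodule.span_induction (p := fun f _ => ∀ c : ℂ, p (c • f)) ?_ ?_ ?_ ?_ hf
    · rintro f ⟨V, K, h1, h2, h3, h4, h5, h6⟩ c
      exact cc V _ ⟨h1, h2, h5.const_smul c, K, h3, h4, fun x hx => by simp [h6 x hx]⟩
    · intro c
      rwa [smul_zero]
    · intro f g hf hg h1 h2 c
      rw [smul_add]
      exact add _ _ (Submodule.smul_mem _ c hf) (Submodule.smul_mem _ c hg) (h1 c) (h2 c)
    · intro a f _ h c
      rw [smul_smul]
      exact h _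
  simpa using key 1

theorem SFun.exists_compact {f : X → ℂ} (hf : f ∈ SFun X) :
    ∃ C, IsCompact C ∧ ∀ x ∉ C, f x = 0 := by
  refine SFun.induction (p := fun f => ∃ C, IsCompact C ∧ ∀ x ∉ C, f x = 0) (fun V f h => ?_)
    ⟨∅, isCompact_empty, fun _ _ => rfl⟩ ?_ hf
  · obtain ⟨K, h1, -, h2⟩ := h.exists_compact
    exact ⟨K, h1, h2⟩
  · rintro f g - - ⟨C, hC, h1⟩ ⟨D, hD, h2⟩
    refine ⟨C ∪ D, hC.union hD, fun x hx => ?_⟩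
    rw [Set.mem_union, not_or] at hx
    simp [h1 x hx.1, h2 x hx.2]

/-- Functions in `𝔖(X)` are sums of functions supported in arbitrarily small open sets. -/
theorem SFun.induction_small [IsLocallyLCH X] {Q : Set X → Prop}
    (mono : ∀ U V, U ⊆ V → Q V → Q U) (cover : ∀ x, ∃ U, IsOpen U ∧ x ∈ U ∧ Q U)
    {p : (X → ℂ) → Prop} (cc : ∀ V f, Q V → IsCcOn V f → p f) (zero : p 0)
    (add : ∀ f g, f ∈ SFun X → g ∈ SFun X → p f → p g → p (f + g)) {f : X → ℂ}
    (hf : f ∈ SFun X) : p f := by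
  refine SFun.induction (fun V f h => ?_) zero add hf
  obtain ⟨hV, _, hfc, K, hK, hKV, hfK⟩ := h
  choose U hU hxU hQ using cover
  have hlc : LocallyCompactSpace V := hV.locallyCompactSpace
  obtain ⟨t, ht⟩ := hK.elim_finite_subcover U hU fun x _ => Set.mem_iUnion.2 ⟨x, hxU x⟩
  let n := t.card
  let e : Fin n ≃ t := t.equivFin.symm
  let s : Fin n → Set V := fun i => Subtype.val ⁻¹' U (e i)
  have hK' : IsCompact (Subtype.val ⁻¹' K : Set V) := by
    rwa [Subtype.isCompact_iff, Subtype.image_preimage_coe, Set.inter_eq_right.2 hKV]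
  -- Partitions of unity are available inside the locally compact Hausdorff set `V`. Multiplying `f`
  -- by them cuts it into pieces supported in the sets `V ∩ U (e i)`.
  obtain ⟨φ, h1, h2, h3, h4⟩ := exists_continuous_sum_one_of_isOpen_isCompact (s := s)
    (fun i => (hU _).preimage continuous_subtype_val) hK' (fun x hx => by
      obtain ⟨i, hi, hxi⟩ := Set.mem_iUnion₂.1 (ht hx)
      exact Set.mem_iUnion.2 ⟨e.symm ⟨i, hi⟩, by simpa [s] using hxi⟩)
  classical
  let F : Fin n → X → ℂ := fun i x => if hx : x ∈ V then (φ i ⟨x, hx⟩ : ℂ) * f x else 0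
  have hF : ∀ i, IsCcOn (V ∩ U (e i)) (F i) := fun i => by
    refine ⟨hV.inter (hU _), t2Space_subset Set.inter_subset_left, ?_,
      Subtype.val '' (tsupport (φ i)), (h4 i).image continuous_subtype_val, ?_, fun x hx => ?_⟩
    · refine ContinuousOn.mono (s := V) ?_ Set.inter_subset_left
      rw [continuousOn_iff_continuous_domRestrict] at hfc ⊢
      have : V.domRestrict (F i) = fun x : V => (φ i x : ℂ) * V.domRestrict f x := by
        ext x
        simp [F, Set.domRestrict_apply]
      rw [this]
      fun_prop
    · rintro _ ⟨x, hx, rfl⟩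
      exact ⟨x.2, h1 i hx⟩
    · by_cases hxV : x ∈ V
      · have : (⟨x, hxV⟩ : V) ∉ tsupport (φ i) := fun h => hx ⟨_, h, rfl⟩
        simp [F, hxV, image_eq_zero_of_notMem_tsupport this]
      · simp [F, hxV]
  have hsum : f = ∑ i, F i := by
    ext x
    rw [Finset.sum_apply]
    by_cases hxV : x ∈ V
    · simp only [F, hxV, dif_pos]
      rw [← Finset.sum_mul]
      by_cases hxK : x ∈ K
      · have := h2 (x := ⟨x, hxV⟩) hxK
        rw [Finset.sum_apply, Pi.one_apply] at this
        rw [← Complex.ofReal_sum]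
        rw [this, Complex.ofReal_one, one_mul]
      · simp [hfK x hxK]
    · simp [F, hxV, hfK x (fun h => hxV (hKV h))]
  rw [hsum]
  have : ∀ s : Finset (Fin n), p (∑ i ∈ s, F i) ∧ (∑ i ∈ s, F i) ∈ SFun X := fun s => by
    induction s using Finset.induction_on with
    | empty => exact ⟨by simpa using zero, by simp⟩
    | insert i s hi ih =>
      rw [Finset.sum_insert hi]
      exact ⟨add _ _ (hF i).mem ih.2 (cc _ _ (mono _ _ Set.inter_subset_right (hQ _)) (hF i)) ih.1,
        Submodule.add_mem _ (hF i).mem ih.2⟩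
  exact (this _).1

/-- Pullback along an injective proper map. -/
theorem SFun.comp_proper {φ : X → Y} (hφ : IsProperMap φ) (hi : Function.Injective φ)
    {f : Y → ℂ} (hf : f ∈ SFun Y) : f ∘ φ ∈ SFun X := by
  refine SFun.induction (p := fun f => f ∘ φ ∈ SFun X) (fun V f h => ?_) (Submodule.zero_mem _)
    (fun f g _ _ h1 h2 => Submodule.add_mem _ h1 h2) hf
  obtain ⟨hV, _, hfc, K, hK, hKV, hfK⟩ := h
  -- Injectivity keeps the preimage of `V` Hausdorff, and properness keeps the support compact.
  refine IsCcOn.mem (V := φ ⁻¹' V) ⟨hV.preimage hφ.continuous,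
    t2Space_of_injOn (V := V) hφ.continuous.continuousOn hi.injOn (fun _ h => h),
    hfc.comp hφ.continuous.continuousOn (fun _ h => h), φ ⁻¹' K, hφ.isCompact_preimage hK,
    fun _ h => hKV h, fun x hx => hfK _ hx⟩

theorem SFun.star_mem {f : X → ℂ} (hf : f ∈ SFun X) : star f ∈ SFun X := by
  refine SFun.induction (p := fun f => star f ∈ SFun X) (fun V f h => ?_) (by simp)
    (fun f g _ _ h1 h2 => by simpa using Submodule.add_mem _ h1 h2) hf
  obtain ⟨hV, h2, hfc, K, hK, hKV, hfK⟩ := h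
  exact IsCcOn.mem ⟨hV, h2, hfc.star, K, hK, hKV, fun x hx => by simp [hfK x hx]⟩

theorem SFun.continuous_mul_mem {k f : X → ℂ} (hk : Continuous k) (hf : f ∈ SFun X) :
    (fun x => k x * f x) ∈ SFun X := by
  refine SFun.induction (p := fun f => (fun x => k x * f x) ∈ SFun X) (fun V f h => ?_)
    (by simp only [Pi.zero_apply, mul_zero]; exact Submodule.zero_mem (SFun X))
    (fun f g _ _ h1 h2 => by
      simp only [Pi.add_apply, mul_add]
      exact Submodule.add_mem _ h1 h2) hf
  obtain ⟨hV, h2, hfc, K, hK, hKV, hfK⟩ := h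
  exact IsCcOn.mem ⟨hV, h2, hk.continuousOn.mul hfc, K, hK, hKV, fun x hx => by simp [hfK x hx]⟩

theorem SFun.prod_mem {f : X → ℂ} {g : Y → ℂ} (hf : f ∈ SFun X) (hg : g ∈ SFun Y) :
    (fun q : X × Y => f q.1 * g q.2) ∈ SFun (X × Y) := by
  refine SFun.induction (p := fun f => (fun q : X × Y => f q.1 * g q.2) ∈ SFun (X × Y))
    (fun V f h => ?_)
    (by simp only [Pi.zero_apply, zero_mul]; exact Submodule.zero_mem (SFun (X × Y)))
    (fun f g _ _ h1 h2 => by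
      simp only [Pi.add_apply, add_mul]
      exact Submodule.add_mem _ h1 h2) hf
  refine SFun.induction (p := fun g => (fun q : X × Y => f q.1 * g q.2) ∈ SFun (X × Y))
    (fun W g h' => ?_)
    (by simp only [Pi.zero_apply, mul_zero]; exact Submodule.zero_mem (SFun (X × Y)))
    (fun f g _ _ h1 h2 => by
      simp only [Pi.add_apply, mul_add]
      exact Submodule.add_mem _ h1 h2) hg
  obtain ⟨hV, _, hfc, K, hK, hKV, hfK⟩ := h
  obtain ⟨hW, _, hgc, L, hL, hLW, hgL⟩ := h'
  refine IsCcOn.mem (V := V ×ˢ W) ⟨hV.prod hW, ?_, ?_, K ×ˢ L, hK.prod hL,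
    Set.prod_mono hKV hLW, fun q hq => ?_⟩
  · exact (Homeomorph.Set.prod V W).isEmbedding.t2Space
  · exact (hfc.comp continuousOn_fst fun q hq => hq.1).mul
      (hgc.comp continuousOn_snd fun q hq => hq.2)
  · rw [Set.mem_prod, not_and_or] at hq
    rcases hq with hq | hq
    · simp [hfK _ hq]
    · simp [hgL _ hq]

end SFun

/-! ### Sums along the fibres of a local homeomorphism -/

section FiberSum

variable {P Z : Type u} [TopologicalSpace P] [TopologicalSpace Z]

/-- The function `z ↦ ∑_{m p = z} f p`. -/
noncomputable def fiberSum {P Z : Type*} (m : P → Z) (f : P → ℂ) (z : Z) : ℂ :=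
  ∑ᶠ p : {p // m p = z}, f p.1

theorem finite_support_fiber [T1Space Z] {m : P → Z} (hm : IsLocalHomeomorph m) {f : P → ℂ}
    (hf : ∃ C, IsCompact C ∧ ∀ x ∉ C, f x = 0) (z : Z) :
    (Function.support fun p : {p // m p = z} => f p.1).Finite := by
  obtain ⟨C, hC, hf⟩ := hf
  refine Set.Finite.of_finite_image ((hm.finite_fiber hC z).subset ?_) Subtype.val_injective.injOn
  rintro _ ⟨p, hp, rfl⟩
  exact ⟨by_contra fun h => hp (hf _ h), p.2⟩

theorem fiberSum_add [T1Space Z] {m : P → Z} (hm : IsLocalHomeomorph m) {f g : P → ℂ}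
    (hf : ∃ C, IsCompact C ∧ ∀ x ∉ C, f x = 0) (hg : ∃ C, IsCompact C ∧ ∀ x ∉ C, g x = 0) :
    fiberSum m (f + g) = fiberSum m f + fiberSum m g :=
  funext fun z => finsum_add_distrib (finite_support_fiber hm hf z) (finite_support_fiber hm hg z)

theorem fiberSum_apply_of_injOn {P Z : Type*} {m : P → Z} {U : Set P} (hU : Set.InjOn m U) {f : P → ℂ}
    (hf : ∀ x ∉ U, f x = 0) {x : P} (hx : x ∈ U) : fiberSum m f (m x) = f x := by
  refine (finsum_eq_single _ ⟨x, rfl⟩ fun p hp => hf _ fun hpU => hp ?_).trans rfl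
  exact Subtype.ext (hU hpU hx p.2)

theorem fiberSum_eq_zero {P Z : Type*} {m : P → Z} {f : P → ℂ} {z : Z} (h : ∀ x, m x = z → f x = 0) :
    fiberSum m f z = 0 :=
  finsum_eq_zero_of_forall_eq_zero fun p => h _ p.2

/-- On `U` the map `m` is a homeomorphism onto an open set, and each fibre sum has at most one
nonzero term, so `f` is merely transported to `m '' U`. -/
theorem IsCcOn.fiberSum {m : P → Z} (hm : IsLocalHomeomorph m) {U : Set P}
    (hi : Set.InjOn m U) {f : P → ℂ} (hf : IsCcOn U f) : IsCcOn (m '' U) (fiberSum m f) := by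
  obtain ⟨hU, _, hfc, K, hK, hKU, hfK⟩ := hf
  have he := hm.isOpenEmbedding_restrict hU hi
  have hval : ∀ x ∈ U, _root_.fiberSum m f (m x) = f x := fun x hx =>
    fiberSum_apply_of_injOn hi (fun x hx => hfK x fun h => hx (hKU h)) hx
  refine ⟨hm.isOpenMap _ hU, ?_, ?_, m '' K, hK.image hm.continuous, Set.image_mono hKU, ?_⟩
  · have : Set.range (U.domRestrict m) = m '' U := Set.range_domRestrict m U
    rw [← this]
    exact he.isEmbedding.toHomeomorph.symm.isEmbedding.t2Space
  · rintro _ ⟨x, hx, rfl⟩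
    refine ContinuousAt.continuousWithinAt ?_
    have h1 : ContinuousAt (_root_.fiberSum m f ∘ U.domRestrict m) ⟨x, hx⟩ := by
      have : _root_.fiberSum m f ∘ U.domRestrict m = U.domRestrict f :=
        funext fun y => hval y.1 y.2
      rw [this]
      exact (continuousOn_iff_continuous_domRestrict.1 hfc).continuousAt
    exact (he.continuousAt_iff (x := ⟨x, hx⟩)).1 h1
  · intro z hz
    exact fiberSum_eq_zero fun x hx => hfK _ fun h => hz ⟨x, h, hx⟩

/-- Decompose `f` into pieces supported where `m` is injective. Additivity of fibre sums rests on
compact sets meeting fibres in finite sets. -/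
theorem SFun.fiberSum_mem [IsLocallyLCH P] [T1Space Z] {m : P → Z} (hm : IsLocalHomeomorph m)
    {f : P → ℂ} (hf : f ∈ SFun P) : fiberSum m f ∈ SFun Z := by
  refine SFun.induction_small (Q := Set.InjOn m) (p := fun f => fiberSum m f ∈ SFun Z)
    (fun U V h hV => hV.mono h) hm.exists_isOpen_injOn (fun V f hV h => (h.fiberSum hm hV).mem) ?_
    (fun f g hf hg h1 h2 => ?_) hf
  · have : fiberSum m (0 : P → ℂ) = 0 := funext fun z => fiberSum_eq_zero fun _ _ => rfl
    rw [this]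
    exact Submodule.zero_mem _
  · rw [fiberSum_add hm (SFun.exists_compact hf) (SFun.exists_compact hg)]
    exact Submodule.add_mem _ h1 h2

theorem fiberSum_eq_extend {P Z : Type*} {m : P → Z} (hm : Function.Injective m) (f : P → ℂ) :
    fiberSum m f = Function.extend m f 0 := by
  ext z
  by_cases h : ∃ x, m x = z
  · obtain ⟨x, rfl⟩ := h
    rw [hm.extend_apply]
    exact (finsum_eq_single _ ⟨x, rfl⟩ fun p hp => absurd (Subtype.ext (hm p.2)) hp).trans rfl
  · rw [Function.extend_apply' _ _ _ h]
    exact finsum_eq_zero_of_forall_eq_zero fun p => absurd ⟨_, p.2⟩ h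

end FiberSum

/-! ### Products of functions along partially defined multiplications -/

section RelProd

/-- `(f · g)(z) = ∑ f(x) g(y)` over the pairs `(x, y)` with product `z`. -/
noncomputable def relProd {X Y Z : Type*} (R : X → Y → Z → Prop) (f : X → ℂ) (g : Y → ℂ) (z : Z) :
    ℂ :=
  ∑ᶠ p : {p : X × Y // R p.1 p.2 z}, f p.1.1 * g p.1.2

variable {X Y Z X₁ X₂ X₃ X₁₂ X₂₃ : Type u}

theorem relProd_comm (R : X → Y → Z → Prop) (f : X → ℂ) (g : Y → ℂ) :
    relProd R f g = relProd (fun y x z => R x y z) g f := by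
  ext z
  exact finsum_eq_of_bijective (fun p => ⟨p.1.swap, p.2⟩)
    ⟨fun p q h => Subtype.ext (Prod.swap_injective (congrArg Subtype.val h)),
      fun p => ⟨⟨p.1.swap, p.2⟩, Subtype.ext (Prod.swap_swap _)⟩⟩ fun p => mul_comm _ _

theorem star_relProd (R : X → Y → Z → Prop) (f : X → ℂ) (g : Y → ℂ) :
    star (relProd R f g) = relProd R (star f) (star g) := by
  ext z
  simp only [relProd, Pi.star_apply]
  refine ((starAddEquiv (R := ℂ)).toAddMonoidHom.map_finsum_of_injective
    (starAddEquiv (R := ℂ)).injective _).trans (finsum_congr fun p => ?_)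
  simp

theorem relProd_comp_left (R : X → Y → Z → Prop) (e : X ≃ X₁) (f : X₁ → ℂ) (g : Y → ℂ) :
    relProd R (f ∘ e) g = relProd (fun x y z => R (e.symm x) y z) f g := by
  ext z
  refine finsum_eq_of_bijective (fun p => ⟨(e p.1.1, p.1.2), by simpa using p.2⟩) ⟨?_, ?_⟩
    fun p => rfl
  · rintro ⟨⟨a, b⟩, _⟩ ⟨⟨a', b'⟩, _⟩ h
    simpa using h
  · rintro ⟨⟨a, b⟩, h⟩
    exact ⟨⟨(e.symm a, b), h⟩, by simp⟩

theorem finsum_sigma_of_finite {ι : Type*} {β : ι → Type*} {F : (Σ i, β i) → ℂ}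
    (hF : (Function.support F).Finite) : ∑ᶠ p, F p = ∑ᶠ i, ∑ᶠ j, F ⟨i, j⟩ := by
  have h1 : ∀ i, (Function.support fun j => F ⟨i, j⟩).Finite := fun i =>
    hF.preimage (f := fun j => (⟨i, j⟩ : Σ i, β i)) sigma_mk_injective.injOn
  have h2 : (Function.support fun i => ∑ᶠ j, F ⟨i, j⟩).Finite := by
    refine (hF.image Sigma.fst).subset fun i hi => ?_
    by_contra hc
    refine hi (finsum_eq_zero_of_forall_eq_zero fun j => ?_)
    by_contra hj
    exact hc ⟨⟨i, j⟩, hj, rfl⟩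
  rw [← tsum_eq_finsum (L := .unconditional _) hF, (summable_of_hasFiniteSupport hF).tsum_sigma,
    ← tsum_eq_finsum (L := .unconditional _) h2]
  exact tsum_congr fun i => tsum_eq_finsum (h1 i)

/-- Single-valuedness of `R₁₂` makes the intermediate product `a` a function of `x₁, x₂`, so the
iterated sum runs over triples without repetition. Finiteness of the nonzero terms justifies the
interchange of sums. -/
theorem relProd_relProd_left {R₁₂ : X₁ → X₂ → X₁₂ → Prop} {R : X₁₂ → X₃ → Z → Prop}
    (u : ∀ x y a b, R₁₂ x y a → R₁₂ x y b → a = b) {f₁ : X₁ → ℂ} {f₂ : X₂ → ℂ} {f₃ : X₃ → ℂ}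
    (z : Z) (fin : {q : X₁ × X₂ × X₃ | f₁ q.1 ≠ 0 ∧ f₂ q.2.1 ≠ 0 ∧ f₃ q.2.2 ≠ 0 ∧
      ∃ a, R₁₂ q.1 q.2.1 a ∧ R a q.2.2 z}.Finite) :
    relProd R (relProd R₁₂ f₁ f₂) f₃ z =
      ∑ᶠ q : {q : X₁ × X₂ × X₃ // ∃ a, R₁₂ q.1 q.2.1 a ∧ R a q.2.2 z},
        f₁ q.1.1 * f₂ q.1.2.1 * f₃ q.1.2.2 := by
  let e : (Σ p : {p : X₁₂ × X₃ // R p.1 p.2 z}, {q : X₁ × X₂ // R₁₂ q.1 q.2 p.1.1}) →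
      {q : X₁ × X₂ × X₃ // ∃ a, R₁₂ q.1 q.2.1 a ∧ R a q.2.2 z} := fun p =>
    ⟨(p.2.1.1, p.2.1.2, p.1.1.2), p.1.1.1, p.2.2, p.1.2⟩
  have he : Function.Bijective e := by
    constructor
    · rintro ⟨⟨⟨a, x₃⟩, h⟩, ⟨⟨x₁, x₂⟩, h'⟩⟩ ⟨⟨⟨b, y₃⟩, k⟩, ⟨⟨y₁, y₂⟩, k'⟩⟩ heq
      simp only [e, Subtype.mk.injEq, Prod.mk.injEq] at heq
      obtain ⟨rfl, rfl, rfl⟩ := heq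
      obtain rfl := u _ _ _ _ h' k'
      rfl
    · rintro ⟨⟨x₁, x₂, x₃⟩, a, h, h'⟩
      exact ⟨⟨⟨(a, x₃), h'⟩, ⟨(x₁, x₂), h⟩⟩, rfl⟩
  rw [← finsum_eq_of_bijective e he
    (f := fun p => f₁ p.2.1.1 * f₂ p.2.1.2 * f₃ p.1.1.2) (fun p => rfl)]
  rw [finsum_sigma_of_finite]
  · refine finsum_congr fun p => ?_
    simp only [relProd]
    rw [mul_comm, ← smul_eq_mul, smul_finsum]
    exact finsum_congr fun q => by rw [smul_eq_mul, mul_comm]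
  · refine Set.Finite.of_finite_image (f := fun p => (e p).1) (fin.subset ?_)
      (Subtype.val_injective.comp he.1).injOn
    rintro _ ⟨p, hp, rfl⟩
    simp only [Function.mem_support, ne_eq, mul_eq_zero, not_or] at hp
    exact ⟨hp.1.1, hp.1.2, hp.2, (e p).2⟩

/-- Both bracketings are the same sum over triples once the composed relations agree. The four
relations are unrelated a priori, so this covers associativity, adjointness and compatibility of
inner products alike. -/
theorem relProd_assoc {R₁₂ : X₁ → X₂ → X₁₂ → Prop} {R : X₁₂ → X₃ → Z → Prop}
    {R₂₃ : X₂ → X₃ → X₂₃ → Prop} {R' : X₁ → X₂₃ → Z → Prop}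
    (u₁₂ : ∀ x y a b, R₁₂ x y a → R₁₂ x y b → a = b)
    (u₂₃ : ∀ x y a b, R₂₃ x y a → R₂₃ x y b → a = b)
    (h : ∀ x₁ x₂ x₃ z, (∃ a, R₁₂ x₁ x₂ a ∧ R a x₃ z) ↔ ∃ b, R₂₃ x₂ x₃ b ∧ R' x₁ b z)
    {f₁ : X₁ → ℂ} {f₂ : X₂ → ℂ} {f₃ : X₃ → ℂ}
    (fin : ∀ z, {q : X₁ × X₂ × X₃ | f₁ q.1 ≠ 0 ∧ f₂ q.2.1 ≠ 0 ∧ f₃ q.2.2 ≠ 0 ∧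
      ∃ a, R₁₂ q.1 q.2.1 a ∧ R a q.2.2 z}.Finite) :
    relProd R (relProd R₁₂ f₁ f₂) f₃ = relProd R' f₁ (relProd R₂₃ f₂ f₃) := by
  ext z
  rw [relProd_relProd_left u₁₂ z (fin z), relProd_comm R', relProd_comm R₂₃,
    relProd_relProd_left (fun x y a b => u₂₃ y x a b) z]
  · refine finsum_eq_of_bijective (fun q => ⟨(q.1.2.2, q.1.2.1, q.1.1), (h _ _ _ _).1 q.2⟩)
      ⟨?_, ?_⟩ (fun q => by ring)
    · rintro ⟨⟨a, b, c⟩, _⟩ ⟨⟨a', b', c'⟩, _⟩ heq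
      simp only [Subtype.mk.injEq, Prod.mk.injEq] at heq ⊢
      tauto
    · rintro ⟨⟨a, b, c⟩, hq⟩
      exact ⟨⟨(c, b, a), (h _ _ _ _).2 hq⟩, rfl⟩
  · refine Set.Finite.of_finite_image (f := fun q => (q.2.2, q.2.1, q.1)) ((fin z).subset ?_) ?_
    · rintro _ ⟨⟨a, b, c⟩, ⟨h1, h2, h3, h4⟩, rfl⟩
      exact ⟨h3, h2, h1, (h _ _ _ _).2 h4⟩
    · rintro ⟨a, b, c⟩ _ ⟨a', b', c'⟩ _ heq
      simp only [Prod.mk.injEq] at heq ⊢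
      tauto

variable [TopologicalSpace X] [TopologicalSpace Y] [TopologicalSpace Z] [TopologicalSpace X₁]
  [TopologicalSpace X₂] [TopologicalSpace X₃] [TopologicalSpace X₁₂]

/-- A partially defined multiplication whose domain is a properly embedded space `P ⊆ X × Y` and
that is a local homeomorphism on `P`. -/
def IsEtaleRel (R : X → Y → Z → Prop) : Prop :=
  ∃ (P : Type u) (_ : TopologicalSpace P) (i : P → X × Y) (m : P → Z), IsProperMap i ∧
    Function.Injective i ∧ IsLocalHomeomorph m ∧ ∀ x y z, R x y z ↔ ∃ p, i p = (x, y) ∧ m p = z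

namespace IsEtaleRel

variable {R : X → Y → Z → Prop}

theorem unique (h : IsEtaleRel R) (x : X) (y : Y) (a b : Z) (ha : R x y a) (hb : R x y b) :
    a = b := by
  obtain ⟨P, _, i, m, -, hi, -, hR⟩ := h
  obtain ⟨p, h1, rfl⟩ := (hR _ _ _).1 ha
  obtain ⟨q, h2, rfl⟩ := (hR _ _ _).1 hb
  rw [hi (h1.trans h2.symm)]

theorem relProd_eq_fiberSum {X Y Z P : Type*} {R : X → Y → Z → Prop} {i : P → X × Y} {m : P → Z} (hi : Function.Injective i)
    (hR : ∀ x y z, R x y z ↔ ∃ p, i p = (x, y) ∧ m p = z) (f : X → ℂ) (g : Y → ℂ) :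
    relProd R f g = fiberSum m ((fun q : X × Y => f q.1 * g q.2) ∘ i) := by
  ext z
  let e : {p // m p = z} → {q : X × Y // R q.1 q.2 z} := fun p =>
    ⟨i p.1, (hR _ _ _).2 ⟨p.1, rfl, p.2⟩⟩
  refine (finsum_eq_of_bijective e ⟨?_, ?_⟩ fun p => rfl).symm
  · intro p q h
    exact Subtype.ext (hi (congrArg Subtype.val h))
  · rintro ⟨⟨x, y⟩, hxy⟩
    obtain ⟨p, h1, h2⟩ := (hR _ _ _).1 hxy
    exact ⟨⟨p, h2⟩, Subtype.ext h1⟩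

/-- The function `f ⊗ g` lies in `𝔖(X × Y)`; pulling it back along the proper injection `i` and
summing it along the local homeomorphism `m` both preserve `𝔖`. -/
theorem relProd_mem [IsLocallyLCH Z] (h : IsEtaleRel R) {f : X → ℂ} {g : Y → ℂ}
    (hf : f ∈ SFun X) (hg : g ∈ SFun Y) : relProd R f g ∈ SFun Z := by
  obtain ⟨P, _, i, m, hip, hi, hm, hR⟩ := h
  rw [relProd_eq_fiberSum hi hR]
  have := hm.isLocallyLCH
  exact SFun.fiberSum_mem hm (SFun.comp_proper hip hi (SFun.prod_mem hf hg))

theorem finite_inter [T1Space Z] (h : IsEtaleRel R) {C : Set X} {D : Set Y} (hC : IsCompact C)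
    (hD : IsCompact D) (z : Z) : {q : X × Y | q.1 ∈ C ∧ q.2 ∈ D ∧ R q.1 q.2 z}.Finite := by
  obtain ⟨P, _, i, m, hip, hi, hm, hR⟩ := h
  refine ((hm.finite_fiber (hip.isCompact_preimage (hC.prod hD)) z).image i).subset ?_
  rintro ⟨x, y⟩ ⟨hx, hy, hxy⟩
  obtain ⟨p, h1, h2⟩ := (hR _ _ _).1 hxy
  exact ⟨p, ⟨by rw [Set.mem_preimage, h1]; exact ⟨hx, hy⟩, h2⟩, h1⟩

theorem isCompact_image (h : IsEtaleRel R) {C : Set X} {D : Set Y} (hC : IsCompact C)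
    (hD : IsCompact D) : IsCompact {z | ∃ x ∈ C, ∃ y ∈ D, R x y z} := by
  obtain ⟨P, _, i, m, hip, hi, hm, hR⟩ := h
  convert (hip.isCompact_preimage (hC.prod hD)).image hm.continuous using 1
  ext z
  constructor
  · rintro ⟨x, hx, y, hy, hxy⟩
    obtain ⟨p, h1, h2⟩ := (hR _ _ _).1 hxy
    exact ⟨p, by rw [Set.mem_preimage, h1]; exact ⟨hx, hy⟩, h2⟩
  · rintro ⟨p, hp, rfl⟩
    exact ⟨_, hp.1, _, hp.2, (hR _ _ _).2 ⟨p, rfl, rfl⟩⟩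

theorem finite_support [T1Space Z] (h : IsEtaleRel R) {f : X → ℂ} {g : Y → ℂ} (hf : f ∈ SFun X)
    (hg : g ∈ SFun Y) (z : Z) :
    (Function.support fun p : {p : X × Y // R p.1 p.2 z} => f p.1.1 * g p.1.2).Finite := by
  obtain ⟨C, hC, hfC⟩ := SFun.exists_compact hf
  obtain ⟨D, hD, hgD⟩ := SFun.exists_compact hg
  refine Set.Finite.of_finite_image ((h.finite_inter hC hD z).subset ?_)
    Subtype.val_injective.injOn
  rintro _ ⟨p, hp, rfl⟩
  simp only [Function.mem_support, ne_eq, mul_eq_zero, not_or] at hp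
  exact ⟨by_contra fun h => hp.1 (hfC _ h), by_contra fun h => hp.2 (hgD _ h), p.2⟩

theorem swap (h : IsEtaleRel R) : IsEtaleRel fun y x z => R x y z := by
  obtain ⟨P, _, i, m, hip, hi, hm, hR⟩ := h
  refine ⟨P, inferInstance, fun p => (i p).swap, m,
    (Homeomorph.prodComm X Y).isProperMap.comp hip, Prod.swap_injective.comp hi, hm,
    fun y x z => (hR x y z).trans ?_⟩
  simp [Prod.ext_iff, and_comm]

/-- The supports lie in compact sets, so the intermediate products lie in a compact image; for fixed
`z` there are finitely many last steps, each with finitely many first steps. -/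
theorem finite_triple [T1Space X₁₂] [T1Space Z] {R₁₂ : X₁ → X₂ → X₁₂ → Prop}
    {R : X₁₂ → X₃ → Z → Prop} (h₁₂ : IsEtaleRel R₁₂) (h : IsEtaleRel R)
    {f₁ : X₁ → ℂ} {f₂ : X₂ → ℂ} {f₃ : X₃ → ℂ} (hf₁ : f₁ ∈ SFun X₁) (hf₂ : f₂ ∈ SFun X₂)
    (hf₃ : f₃ ∈ SFun X₃) (z : Z) :
    {q : X₁ × X₂ × X₃ | f₁ q.1 ≠ 0 ∧ f₂ q.2.1 ≠ 0 ∧ f₃ q.2.2 ≠ 0 ∧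
      ∃ a, R₁₂ q.1 q.2.1 a ∧ R a q.2.2 z}.Finite := by
  obtain ⟨C₁, hC₁, hfC₁⟩ := SFun.exists_compact hf₁
  obtain ⟨C₂, hC₂, hfC₂⟩ := SFun.exists_compact hf₂
  obtain ⟨C₃, hC₃, hfC₃⟩ := SFun.exists_compact hf₃
  refine ((h.finite_inter (h₁₂.isCompact_image hC₁ hC₂) hC₃ z).biUnion fun p _ =>
    (h₁₂.finite_inter hC₁ hC₂ p.1).image fun q => (q.1, q.2, p.2)).subset ?_
  rintro ⟨x₁, x₂, x₃⟩ ⟨h1, h2, h3, a, ha, ha'⟩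
  have m1 : x₁ ∈ C₁ := by_contra fun h => h1 (hfC₁ _ h)
  have m2 : x₂ ∈ C₂ := by_contra fun h => h2 (hfC₂ _ h)
  have m3 : x₃ ∈ C₃ := by_contra fun h => h3 (hfC₃ _ h)
  exact Set.mem_biUnion (x := (a, x₃)) ⟨⟨x₁, m1, x₂, m2, ha⟩, m3, ha'⟩ ⟨(x₁, x₂), ⟨m1, m2, ha⟩, rfl⟩

end IsEtaleRel

end RelProd

/-! ### Local homeomorphisms and fibre products -/

theorem IsLocalHomeomorph.of_isOpenMap {X Y : Type*} [TopologicalSpace X] [TopologicalSpace Y]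
    {f : X → Y} (hc : Continuous f) (ho : IsOpenMap f)
    (hi : ∀ x, ∃ U, IsOpen U ∧ x ∈ U ∧ Set.InjOn f U) : IsLocalHomeomorph f := by
  rw [isLocalHomeomorph_iff_isOpenEmbedding_restrict]
  intro x
  obtain ⟨U, hU, hx, hinj⟩ := hi x
  exact ⟨U, hU.mem_nhds hx, .of_continuous_injective_isOpenMap (hc.comp continuous_subtype_val)
    (Set.injOn_iff_injective.1 hinj) (ho.comp hU.isOpenMap_subtype_val)⟩

section FiberProduct

variable {X Y B : Type*} [TopologicalSpace X] [TopologicalSpace Y] [TopologicalSpace B]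
  {f : X → B} {g : Y → B}

theorem isOpenMap_snd_fiberProd (hf : IsOpenMap f) (hg : Continuous g) :
    IsOpenMap fun p : {p : X × Y // f p.1 = g p.2} => p.1.2 := by
  rintro _ ⟨O, hO, rfl⟩
  rw [isOpen_iff_mem_nhds]
  rintro _ ⟨⟨⟨x, y⟩, h⟩, hp, rfl⟩
  obtain ⟨A, C, hA, hC, hx, hy, hAC⟩ := isOpen_prod_iff.1 hO x y hp
  filter_upwards [hC.mem_nhds hy, ((hf A hA).preimage hg).mem_nhds ⟨x, hx, h⟩] with y' hy' hy''
  obtain ⟨x', hx', h'⟩ := hy''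
  exact ⟨⟨(x', y'), h'⟩, hAC ⟨hx', hy'⟩, rfl⟩

theorem IsLocalHomeomorph.snd_fiberProd (hf : IsLocalHomeomorph f) (hg : Continuous g) :
    IsLocalHomeomorph fun p : {p : X × Y // f p.1 = g p.2} => p.1.2 := by
  refine .of_isOpenMap (by fun_prop) (isOpenMap_snd_fiberProd hf.isOpenMap hg) fun p => ?_
  obtain ⟨U, hU, hx, hi⟩ := hf.exists_isOpen_injOn p.1.1
  refine ⟨(fun q => q.1.1) ⁻¹' U, hU.preimage (by fun_prop), hx, fun q hq q' hq' h => ?_⟩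
  refine Subtype.ext (Prod.ext (hi hq hq' ?_) h)
  rw [q.2, q'.2]
  exact congrArg g h

theorem isClosedEmbedding_fiberProd [T2Space B] (hf : Continuous f) (hg : Continuous g) :
    IsClosedEmbedding (Subtype.val : {p : X × Y // f p.1 = g p.2} → X × Y) :=
  (isClosed_eq (hf.comp continuous_fst) (hg.comp continuous_snd)).isClosedEmbedding_subtypeVal

end FiberProduct

/-! ### Actions as ternary relations -/

namespace EtaleGroupoid

variable (G : EtaleGroupoid.{u})

theorem mul_congr {g g' h h' : G.Arr} (hg : g = g') (hh : h = h') (e : G.s g = G.r h) :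
    G.mul g h e = G.mul g' h' (by rw [← hg, ← hh, e]) := by
  subst hg hh
  rfl

theorem inv_unique {g h : G.Arr} (e : G.s g = G.r h) (he : G.mul g h e = G.unit (G.r g)) :
    h = G.inv g := by
  rw [← G.inv_mul_cancel_left g h e, G.mul_congr rfl he]
  have h1 : G.r g = G.s (G.inv g) := (G.s_inv g).symm
  rw [G.mul_congr rfl (congrArg G.unit h1)]
  exact G.mul_unit _

theorem inv_inv (g : G.Arr) : G.inv (G.inv g) = g :=
  (G.inv_unique (G.s_inv g) ((G.inv_mul g).trans (congrArg G.unit (G.r_inv g).symm))).symm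

/-- Inversion as a homeomorphism. -/
def invHomeomorph : G.Arr ≃ₜ G.Arr where
  toFun := G.inv
  invFun := G.inv
  left_inv := G.inv_inv
  right_inv := G.inv_inv
  continuous_toFun := G.continuous_inv
  continuous_invFun := G.continuous_inv

theorem r_surjective : Function.Surjective G.r := fun x => ⟨G.unit x, G.r_unit x⟩

/-- The range map is a quotient map, and composing with it gives the continuous map `g ↦ g g⁻¹`. -/
theorem continuous_unit : Continuous G.unit := by
  have hq : IsQuotientMap G.r :=
    G.isLocalHomeomorph_r.isOpenMap.isQuotientMap G.isLocalHomeomorph_r.continuous G.r_surjective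
  rw [hq.continuous_iff]
  have : G.unit ∘ G.r = (fun p : {p : G.Arr × G.Arr // G.s p.1 = G.r p.2} =>
      G.mul p.1.1 p.1.2 p.2) ∘ fun g => ⟨(g, G.inv g), (G.r_inv g).symm⟩ :=
    funext fun g => (G.mul_inv g).symm
  rw [this]
  exact G.continuous_mul.comp
    (Continuous.subtype_mk (continuous_id.prodMk G.continuous_inv) _)

instance : IsLocallyLCH G.Arr := G.isLocalHomeomorph_r.isLocallyLCH

theorem isOpenEmbedding_unit : IsOpenEmbedding G.unit := by
  have h : IsLocalHomeomorph G.unit := by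
    refine .of_comp ?_ G.isLocalHomeomorph_r G.continuous_unit
    have : G.r ∘ G.unit = id := funext G.r_unit
    rw [this]
    exact (Homeomorph.refl _).isLocalHomeomorph
  exact h.isOpenEmbedding_of_injective (Function.LeftInverse.injective G.r_unit)

end EtaleGroupoid

namespace GroupoidCorr

variable {H G K : EtaleGroupoid.{u}} (X : GroupoidCorr H G)

instance : IsLocallyLCH X := X.isLocalHomeomorph_s.isLocallyLCH

/-- `x · g = y`. -/
def RMul (x : X) (g : G.Arr) (y : X) : Prop := ∃ e, X.ract x g e = y

/-- `h · x = y`. -/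
def LMul (h : H.Arr) (x : X) (y : X) : Prop := ∃ e, X.lact h x e = y

variable {X}

theorem RMul.s_eq {x y : X} {g : G.Arr} (h : X.RMul x g y) : X.s x = G.r g := h.1

theorem RMul.s_right {x y : X} {g : G.Arr} (h : X.RMul x g y) : X.s y = G.s g := by
  obtain ⟨e, rfl⟩ := h
  exact X.right.s_act x g e

theorem RMul.r_eq {x y : X} {g : G.Arr} (h : X.RMul x g y) : X.r y = X.r x := by
  obtain ⟨e, rfl⟩ := h
  exact X.r_right_act x g e

theorem LMul.r_eq {x y : X} {h : H.Arr} (hl : X.LMul h x y) : H.s h = X.r x := hl.1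

theorem LMul.r_left {x y : X} {h : H.Arr} (hl : X.LMul h x y) : X.r y = H.r h := by
  obtain ⟨e, rfl⟩ := hl
  exact X.left.r_act h x e

theorem LMul.s_eq {x y : X} {h : H.Arr} (hl : X.LMul h x y) : X.s y = X.s x := by
  obtain ⟨e, rfl⟩ := hl
  exact X.s_left_act h x e

theorem RMul.eq {x y z : X} {g : G.Arr} (h : X.RMul x g y) (h' : X.RMul x g z) : y = z :=
  h.2.symm.trans h'.2

theorem LMul.eq {x y z : X} {h : H.Arr} (hl : X.LMul h x y) (hl' : X.LMul h x z) : y = z :=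
  hl.2.symm.trans hl'.2

theorem RMul.free {x y : X} {g g' : G.Arr} (h : X.RMul x g y) (h' : X.RMul x g' y) : g = g' := by
  have := @X.isFree ⟨(x, g), h.1⟩ ⟨(x, g'), h'.1⟩ (Prod.ext (h.2.trans h'.2.symm) rfl)
  simpa using this

theorem rmul_unit (x : X) : X.RMul x (G.unit (X.s x)) x := ⟨_, X.right.act_unit x⟩

theorem lmul_unit (x : X) : X.LMul (H.unit (X.r x)) x x := ⟨_, X.left.unit_act x⟩

/-- Associativity of the right action. -/
theorem RMul.trans {x y z : X} {g h k : G.Arr} (h₁ : X.RMul x g y) (h₂ : X.RMul y h z)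
    (hk : (one G).RMul g h k) : X.RMul x k z := by
  obtain ⟨e, rfl⟩ := h₁
  obtain ⟨e', rfl⟩ := h₂
  obtain ⟨e'', rfl⟩ := hk
  exact ⟨e.trans (G.r_mul _ _ _).symm, (X.right.act_act x g h e e'').symm⟩

theorem LMul.trans {x y z : X} {g h k : H.Arr} (h₁ : X.LMul g x y) (h₂ : X.LMul h y z)
    (hk : (one H).LMul h g k) : X.LMul k x z := by
  obtain ⟨e, rfl⟩ := h₁
  obtain ⟨e', rfl⟩ := h₂
  obtain ⟨e'', rfl⟩ := hk
  exact ⟨(H.s_mul _ _ _).trans e, (X.left.act_act h g x e'' e).symm⟩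

theorem RMul.inv {x y : X} {g : G.Arr} (h : X.RMul x g y) : X.RMul y (G.inv g) x := by
  have e : X.s y = G.r (G.inv g) := h.s_right.trans (G.r_inv g).symm
  refine ⟨e, ?_⟩
  have h1 : X.RMul x (G.unit (G.r g)) (X.ract y (G.inv g) e) :=
    h.trans ⟨e, rfl⟩ ⟨(G.r_inv g).symm, G.mul_inv g⟩
  rw [← h.s_eq] at h1
  exact h1.eq (rmul_unit x)

theorem LMul.inv {x y : X} {h : H.Arr} (hl : X.LMul h x y) : X.LMul (H.inv h) y x := by
  have e : H.s (H.inv h) = X.r y := (H.s_inv h).trans hl.r_left.symm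
  refine ⟨e, ?_⟩
  have h1 : X.LMul (H.unit (H.s h)) x (X.lact (H.inv h) y e) :=
    hl.trans ⟨e, rfl⟩ ⟨H.s_inv h, H.inv_mul h⟩
  rw [hl.r_eq] at h1
  exact h1.eq (lmul_unit x)

theorem rmul_inv_iff {x y : X} {g : G.Arr} : X.RMul y (G.inv g) x ↔ X.RMul x g y :=
  ⟨fun h => by simpa only [G.inv_inv] using h.inv, RMul.inv⟩

theorem lmul_inv_iff {x y : X} {h : H.Arr} : X.LMul (H.inv h) y x ↔ X.LMul h x y :=
  ⟨fun h => by simpa only [H.inv_inv] using h.inv, LMul.inv⟩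

theorem rmul_assoc_iff {x z : X} {g h : G.Arr} :
    (∃ k, (one G).RMul g h k ∧ X.RMul x k z) ↔ ∃ y, X.RMul x g y ∧ X.RMul y h z := by
  constructor
  · rintro ⟨k, hk, hx⟩
    have e : X.s x = G.r g := by
      obtain ⟨e, rfl⟩ := hk
      exact hx.s_eq.trans (G.r_mul g h e)
    have h1 : X.RMul x g (X.ract x g e) := ⟨e, rfl⟩
    have e' : X.s (X.ract x g e) = G.r h := h1.s_right.trans hk.1
    refine ⟨_, h1, e', ?_⟩
    exact (h1.trans ⟨e', rfl⟩ hk).eq hx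
  · rintro ⟨y, h1, h2⟩
    have e : G.s g = G.r h := h1.s_right.symm.trans h2.s_eq
    exact ⟨_, ⟨e, rfl⟩, h1.trans h2 ⟨e, rfl⟩⟩

/-- Commutation of the actions as an equality of composed relations, as needed for adjointness of
the left action. -/
theorem lmul_rmul_comm {h : H.Arr} {g : G.Arr} {x z : X} :
    (∃ y, X.LMul h x y ∧ X.RMul y g z) ↔ ∃ y, X.RMul x g y ∧ X.LMul h y z := by
  constructor
  · rintro ⟨_, ⟨e, rfl⟩, e', rfl⟩
    exact ⟨_, ⟨(X.s_left_act h x e).symm.trans e', rfl⟩, e.trans (X.r_right_act _ _ _).symm,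
      (X.act_comm _ _ _ _ _).symm⟩
  · rintro ⟨_, ⟨e, rfl⟩, e', rfl⟩
    exact ⟨_, ⟨e'.trans (X.r_right_act _ _ _), rfl⟩, (X.s_left_act _ _ _).trans e,
      X.act_comm _ _ _ _ _⟩

/-- The relational content of `⟨ξ, η γ⟩ = ⟨ξ, η⟩ γ`. -/
theorem rmul_eq_iff {x y : X} {g h : G.Arr} :
    (∃ k, X.RMul x k y ∧ (one G).RMul k g h) ↔ ∃ z, X.RMul y g z ∧ X.RMul x h z := by
  constructor
  · rintro ⟨k, h1, h2⟩
    have e : X.s y = G.r g := h1.s_right.trans h2.1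
    exact ⟨_, ⟨e, rfl⟩, h1.trans ⟨e, rfl⟩ h2⟩
  · rintro ⟨z, h1, h2⟩
    have e : G.s h = G.r (G.inv g) := by
      rw [G.r_inv, ← h2.s_right, h1.s_right]
    have h3 : (one G).RMul h (G.inv g) (G.mul h (G.inv g) e) := ⟨e, rfl⟩
    exact ⟨_, h2.trans h1.inv h3, rmul_inv_iff.1 h3⟩

end GroupoidCorr

/-! ### Composites of groupoid correspondences -/

namespace GroupoidCorr

variable {H G K : EtaleGroupoid.{u}} {X : GroupoidCorr H G}

namespace Composite

variable {Y : GroupoidCorr G K} {Z : GroupoidCorr H K} (c : X.Composite Y Z)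

/-- `[x, y] = z`. -/
def Rel (x : X) (y : Y) (z : Z) : Prop := ∃ e, c.cls x y e = z

variable {c}

variable (c)

theorem exists_rel (z : Z) : ∃ x y, c.Rel x y z := by
  obtain ⟨p, rfl⟩ := c.isQuotientMap_cls.surjective z
  exact ⟨_, _, p.2, rfl⟩

theorem lmul_iff {h : H.Arr} {x : X} {y : Y} {z : Z} :
    (∃ x', X.LMul h x x' ∧ c.Rel x' y z) ↔ ∃ z', c.Rel x y z' ∧ Z.LMul h z' z := by
  constructor
  · rintro ⟨_, ⟨e, rfl⟩, e', rfl⟩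
    exact ⟨_, ⟨(X.s_left_act _ _ _).symm.trans e', rfl⟩, e.trans (c.r_cls _ _ _).symm,
      c.lact_cls _ _ _ _ _⟩
  · rintro ⟨_, ⟨e, rfl⟩, e', rfl⟩
    have e'' := e'.trans (c.r_cls _ _ _)
    exact ⟨_, ⟨e'', rfl⟩, (X.s_left_act _ _ _).trans e, (c.lact_cls _ _ _ e e'').symm⟩

theorem rmul_iff {x : X} {y : Y} {k : K.Arr} {z : Z} :
    (∃ z', c.Rel x y z' ∧ Z.RMul z' k z) ↔ ∃ y', Y.RMul y k y' ∧ c.Rel x y' z := by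
  constructor
  · rintro ⟨_, ⟨e, rfl⟩, e', rfl⟩
    have e'' := (c.s_cls _ _ _).symm.trans e'
    exact ⟨_, ⟨e'', rfl⟩, e.trans (Y.r_right_act _ _ _).symm, (c.ract_cls _ _ _ e e'').symm⟩
  · rintro ⟨_, ⟨e, rfl⟩, e', rfl⟩
    exact ⟨_, ⟨e'.trans (Y.r_right_act _ _ _), rfl⟩, (c.s_cls _ _ _).trans e,
      c.ract_cls _ _ _ _ _⟩

/-- Two pairs represent the same class exactly when one arrow connects both coordinates. Read as an
equality of composed relations, this trades the inner product on `X` for the product on the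
composite. -/
theorem rel_rel_iff {x x' : X} {y y' : Y} :
    (∃ g, X.RMul x g x' ∧ Y.LMul g y' y) ↔ ∃ z, c.Rel x' y' z ∧ c.Rel x y z := by
  constructor
  · rintro ⟨g, h1, h2⟩
    have e : X.s x = Y.r y := h1.s_eq.trans h2.r_left.symm
    have e' : X.s x' = Y.r y' := h1.s_right.trans h2.r_eq
    refine ⟨_, ⟨e', rfl⟩, e, ?_⟩
    refine ((c.cls_eq_cls_iff _ _ e' _ _ e).2 ⟨g, h2.1, ?_, h2.2⟩).symm
    exact h1.inv.2
  · rintro ⟨z, ⟨e, h1⟩, e', h2⟩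
    obtain ⟨g, eg, h3, h4⟩ := (c.cls_eq_cls_iff _ _ e _ _ e').1 (h1.trans h2.symm)
    exact ⟨g, rmul_inv_iff.1 ⟨_, h3⟩, eg, h4⟩

/-- The arrow connecting the two representatives fixes `x`, so freeness makes it a unit. -/
theorem rel_right_unique {x : X} {y y' : Y} {z : Z} (h : c.Rel x y z) (h' : c.Rel x y' z) :
    y = y' := by
  obtain ⟨g, h1, h2⟩ := c.rel_rel_iff.2 ⟨z, h', h⟩
  have := h1.free (rmul_unit x)
  subst this
  have h3 := lmul_unit y'
  rw [← h'.1] at h3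
  exact h2.eq h3

/-- Composing with the local homeomorphism `Z.s` gives `Y.s` after the second projection, which is a
local homeomorphism as well; the claim follows by cancellation. -/
theorem isLocalHomeomorph_cls :
    IsLocalHomeomorph fun p : {p : X × Y // X.s p.1 = Y.r p.2} => c.cls p.1.1 p.1.2 p.2 := by
  refine .of_comp ?_ Z.isLocalHomeomorph_s c.isQuotientMap_cls.continuous
  have : (Z.s ∘ fun p : {p : X × Y // X.s p.1 = Y.r p.2} => c.cls p.1.1 p.1.2 p.2) =
      Y.s ∘ fun p => p.1.2 := funext fun p => c.s_cls _ _ _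
  rw [this]
  exact Y.isLocalHomeomorph_s.comp (X.isLocalHomeomorph_s.snd_fiberProd Y.left.continuous_r)

/-- Since `G.Obj` is Hausdorff, the fibre product is closed in `X × Y`, hence properly embedded. -/
theorem isEtaleRel : IsEtaleRel c.Rel :=
  ⟨_, inferInstance, _, _,
    (isClosedEmbedding_fiberProd X.right.continuous_s Y.left.continuous_r).isProperMap,
    Subtype.val_injective, c.isLocalHomeomorph_cls, fun _ _ _ =>
      ⟨fun ⟨e, h⟩ => ⟨⟨_, e⟩, rfl, h⟩, by
        rintro ⟨⟨⟨x, y⟩, e⟩, h, rfl⟩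
        obtain ⟨rfl, rfl⟩ := Prod.ext_iff.1 h
        exact ⟨e, rfl⟩⟩⟩

end Composite

variable (X)

/-- `X` is the composite of the unit correspondence and `X`. -/
def leftUnitComposite : (one H).Composite X X where
  cls := X.lact
  isQuotientMap_cls := by
    refine IsQuotientMap.of_comp (f := fun x : X =>
      (⟨(H.unit (X.r x), x), H.s_unit _⟩ : {p : H.Arr × X // H.s p.1 = X.r p.2}))
      ?_ X.left.continuous_act ?_
    · exact Continuous.subtype_mk
        ((H.continuous_unit.comp X.left.continuous_r).prodMk continuous_id) _
    · exact (congrArg IsQuotientMap (funext fun x => X.left.unit_act x)).mpr .id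
  cls_eq_cls_iff h x e h' x' e' := by
    constructor
    · intro heq
      have h1 : X.LMul h x (X.lact h x e) := ⟨e, rfl⟩
      have h2 : X.LMul h' x' (X.lact h x e) := ⟨e', heq.symm⟩
      have e2 : H.s (H.inv h') = H.r h := (H.s_inv h').trans (h2.r_left.symm.trans h1.r_left)
      have h3 : (one H).LMul (H.inv h') h (H.mul (H.inv h') h e2) := ⟨e2, rfl⟩
      have h4 := h1.trans h2.inv h3
      have h5 : (one H).RMul (H.inv h') h (H.mul (H.inv h') h e2) := ⟨e2, rfl⟩
      have h6 : (one H).RMul h (H.inv (H.mul (H.inv h') h e2)) h' := by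
        have h7 := lmul_inv_iff.1 h3
        exact RMul.inv (X := one H) ⟨h7.1, h7.2⟩
      exact ⟨_, h4.1, h6.2, h4.2⟩
    · rintro ⟨g, eg, h1, h2⟩
      have h3 : (one H).RMul h' g h := rmul_inv_iff.1 ⟨_, h1⟩
      have h4 : X.LMul g x x' := ⟨eg, h2⟩
      have h5 : X.LMul h' x' (X.lact h' x' e') := ⟨e', rfl⟩
      exact ((h4.trans h5 ⟨h3.1, h3.2⟩).2.symm.trans rfl).symm
  r_cls := X.left.r_act
  s_cls := X.s_left_act
  lact_cls h x y e eh := X.left.act_act _ _ _ _ _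
  ract_cls x y k e ek := X.act_comm _ _ _ _ _

/-- `X` is the composite of `X` and the unit correspondence. -/
def rightUnitComposite : X.Composite (one G) X where
  cls := X.ract
  isQuotientMap_cls := by
    refine IsQuotientMap.of_comp (f := fun x : X =>
      (⟨(x, G.unit (X.s x)), (G.r_unit _).symm⟩ : {p : X × G.Arr // X.s p.1 = G.r p.2}))
      ?_ X.right.continuous_act ?_
    · exact Continuous.subtype_mk
        (continuous_id.prodMk (G.continuous_unit.comp X.right.continuous_s)) _
    · exact (congrArg IsQuotientMap (funext fun x => X.right.act_unit x)).mpr .id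
  cls_eq_cls_iff x h e x' h' e' := by
    constructor
    · intro heq
      have h1 : X.RMul x h (X.ract x h e) := ⟨e, rfl⟩
      have h2 : X.RMul x' h' (X.ract x h e) := ⟨e', heq.symm⟩
      obtain ⟨k, h3, h4⟩ := rmul_eq_iff.2 ⟨_, h1, h2⟩
      exact ⟨k, h4.1, h3.inv.2, h4.2⟩
    · rintro ⟨g, eg, h1, h2⟩
      have h3 : X.RMul x' g x := rmul_inv_iff.1 ⟨_, h1⟩
      exact ((h3.trans ⟨e, rfl⟩ ⟨eg, h2⟩).2).symm
  r_cls := X.r_right_act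
  s_cls := X.right.s_act
  lact_cls h x y e eh := (X.act_comm _ _ _ _ _).symm
  ract_cls x y k e ek := X.right.act_act _ _ _ _ _

/-- Both actions are composites with a unit correspondence, so no separate argument is needed. -/
theorem isEtaleRel_lmul : IsEtaleRel X.LMul := X.leftUnitComposite.isEtaleRel

theorem isEtaleRel_rmul : IsEtaleRel X.RMul := X.rightUnitComposite.isEtaleRel

/-- Here freeness and properness enter: they say that the action map embeds `X ×_{s,r} G` properly
into `X × X`. The projection to `g` is a base change of `X.s`. -/
theorem isEtaleRel_quotient : IsEtaleRel fun x y g => X.RMul x g y := by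
  refine ⟨_, inferInstance, Prod.swap ∘ X.right.actionMap, fun p => p.1.2,
    (Homeomorph.prodComm X X).isProperMap.comp X.isProper,
    Prod.swap_injective.comp X.isFree,
    X.isLocalHomeomorph_s.snd_fiberProd G.isLocalHomeomorph_r.continuous, fun x y g => ⟨?_, ?_⟩⟩
  · rintro ⟨e, rfl⟩
    exact ⟨⟨(x, g), e⟩, rfl, rfl⟩
  · rintro ⟨⟨⟨x', g'⟩, e⟩, h, rfl⟩
    obtain ⟨rfl, rfl⟩ := Prod.ext_iff.1 h
    exact ⟨e, rfl⟩

theorem lmul_assoc_iff {g h : H.Arr} {x z : X} :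
    (∃ k, (one H).LMul g h k ∧ X.LMul k x z) ↔ ∃ y, X.LMul h x y ∧ X.LMul g y z :=
  X.leftUnitComposite.lmul_iff

end GroupoidCorr

/-! ### Convolution products on the function spaces -/

theorem relProd_eq_finsum {X Y Z A : Type*} {R : X → Y → Z → Prop} (z : Z) (a : A → X × Y)
    (ha : Function.Injective a) (hR : ∀ i, R (a i).1 (a i).2 z)
    (h : ∀ x y, R x y z → ∃ i, a i = (x, y)) (f : X → ℂ) (g : Y → ℂ) :
    relProd R f g z = ∑ᶠ i, f (a i).1 * g (a i).2 := by
  let e : A → {p : X × Y // R p.1 p.2 z} := fun i => ⟨a i, hR i⟩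
  refine (finsum_eq_of_bijective e ⟨fun i j hij => ha (congrArg Subtype.val hij), ?_⟩
    fun p => rfl).symm
  rintro ⟨⟨x, y⟩, hxy⟩
  obtain ⟨i, hi⟩ := h x y hxy
  exact ⟨i, Subtype.ext hi⟩

theorem relProd_congr {X Y Z Z' : Type*} {R : X → Y → Z → Prop} {R' : X → Y → Z' → Prop} {z : Z}
    {z' : Z'} (h : ∀ x y, R x y z ↔ R' x y z') {f : X → ℂ} {g : Y → ℂ} :
    relProd R f g z = relProd R' f g z' :=
  finsum_eq_of_bijective _ (Equiv.subtypeEquivRight (p := fun p : X × Y => R p.1 p.2 z)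
    (q := fun p => R' p.1 p.2 z') fun p => h p.1 p.2).bijective fun _ => rfl

/-- The product of functions along an étale relation, as a bilinear map. -/
noncomputable def IsEtaleRel.prod {X Y Z : Type u} [TopologicalSpace X] [TopologicalSpace Y]
    [TopologicalSpace Z] [IsLocallyLCH Z] {R : X → Y → Z → Prop} (h : IsEtaleRel R) :
    SFun X →ₗ[ℂ] SFun Y →ₗ[ℂ] SFun Z :=
  LinearMap.mk₂ ℂ (fun f g => ⟨relProd R f g, h.relProd_mem f.2 g.2⟩)
    (fun f f' g => Subtype.ext <| funext fun z => by
      simp only [relProd, Submodule.coe_add, Pi.add_apply, add_mul]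
      exact finsum_add_distrib (h.finite_support f.2 g.2 z) (h.finite_support f'.2 g.2 z))
    (fun a f g => Subtype.ext <| funext fun z => by
      simp only [relProd, Submodule.coe_smul, Pi.smul_apply, smul_mul_assoc]
      exact (smul_finsum a _).symm)
    (fun f g g' => Subtype.ext <| funext fun z => by
      simp only [relProd, Submodule.coe_add, Pi.add_apply, mul_add]
      exact finsum_add_distrib (h.finite_support f.2 g.2 z) (h.finite_support f.2 g'.2 z))
    (fun a f g => Subtype.ext <| funext fun z => by
      simp only [relProd, Submodule.coe_smul, Pi.smul_apply, mul_smul_comm]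
      exact (smul_finsum a _).symm)

theorem IsEtaleRel.prod_assoc {X₁ X₂ X₃ X₁₂ X₂₃ Z : Type u} [TopologicalSpace X₁]
    [TopologicalSpace X₂] [TopologicalSpace X₃] [TopologicalSpace X₁₂] [TopologicalSpace X₂₃]
    [TopologicalSpace Z] [IsLocallyLCH X₁₂] [IsLocallyLCH X₂₃] [IsLocallyLCH Z]
    {R₁₂ : X₁ → X₂ → X₁₂ → Prop} {R : X₁₂ → X₃ → Z → Prop}
    {R₂₃ : X₂ → X₃ → X₂₃ → Prop} {R' : X₁ → X₂₃ → Z → Prop} (h₁₂ : IsEtaleRel R₁₂)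
    (h : IsEtaleRel R) (h₂₃ : IsEtaleRel R₂₃) (h' : IsEtaleRel R')
    (hR : ∀ x₁ x₂ x₃ z, (∃ a, R₁₂ x₁ x₂ a ∧ R a x₃ z) ↔ ∃ b, R₂₃ x₂ x₃ b ∧ R' x₁ b z)
    (f₁ : SFun X₁) (f₂ : SFun X₂) (f₃ : SFun X₃) :
    h.prod (h₁₂.prod f₁ f₂) f₃ = h'.prod f₁ (h₂₃.prod f₂ f₃) :=
  Subtype.ext <| relProd_assoc h₁₂.unique h₂₃.unique hR
    (IsEtaleRel.finite_triple h₁₂ h f₁.2 f₂.2 f₃.2)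

/-- Pointwise complex conjugation on `𝔖(X)`. -/
noncomputable def SFun.conj (X : Type u) [TopologicalSpace X] : SFun X →ₗ⋆[ℂ] SFun X where
  toFun f := ⟨star (f : X → ℂ), SFun.star_mem f.2⟩
  map_add' _ _ := Subtype.ext (star_add _ _)
  map_smul' _ _ := Subtype.ext (star_smul _ _)

namespace GroupoidCorr

variable {H G K : EtaleGroupoid.{u}} (X : GroupoidCorr H G)

/-- The defining formula parametrizes the factorizations `x = h · (h⁻¹ x)` by `h`, whereas `relProd`
sums over the factorizations themselves. The next results are analogous. -/
theorem lconv_eq_relProd (ζ : H.Arr → ℂ) (ξ : X → ℂ) : X.lconv ζ ξ = relProd X.LMul ζ ξ := by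
  ext x
  refine (relProd_eq_finsum x (A := {h : H.Arr // H.r h = X.r x})
    (fun h => (h.1, X.lact (H.inv h.1) x ((H.s_inv h.1).trans h.2))) ?_ ?_ ?_ ζ ξ).symm
  · intro h h' heq
    exact Subtype.ext (Prod.ext_iff.1 heq).1
  · exact fun h => lmul_inv_iff.1 ⟨_, rfl⟩
  · intro h x' hx
    exact ⟨⟨h, hx.r_left.symm⟩, Prod.ext rfl hx.inv.2⟩

theorem rconv_eq_relProd (ξ : X → ℂ) (γ : G.Arr → ℂ) : X.rconv ξ γ = relProd X.RMul ξ γ := by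
  ext x
  refine (relProd_eq_finsum x (A := {g : G.Arr // X.s x = G.r g})
    (fun g => (X.ract x g.1 g.2, G.inv g.1)) ?_ ?_ ?_ ξ γ).symm
  · intro h h' heq
    exact Subtype.ext (G.invHomeomorph.injective (Prod.ext_iff.1 heq).2)
  · exact fun h => RMul.inv ⟨_, rfl⟩
  · intro x' g hx
    exact ⟨⟨G.inv g, hx.inv.1⟩, Prod.ext hx.inv.2 (G.inv_inv g)⟩

theorem braket_eq_relProd (ξ η : X → ℂ) :
    X.braket ξ η = relProd (fun x y g => X.RMul x g y) (star ξ) η := by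
  ext g
  refine (relProd_eq_finsum g (A := {x : X // X.s x = G.r g})
    (fun x => (x.1, X.ract x.1 g x.2)) ?_ ?_ ?_ (star ξ) η).symm
  · intro x x' heq
    exact Subtype.ext (Prod.ext_iff.1 heq).1
  · exact fun x => ⟨x.2, rfl⟩
  · intro x y h
    exact ⟨⟨x, h.1⟩, Prod.ext rfl h.2⟩

theorem conv_eq_relProd (ξ η : G.Arr → ℂ) : G.conv ξ η = relProd (one G).LMul ξ η :=
  (one G).lconv_eq_relProd ξ η

variable {X}

/-- The representatives of `[x, y]` are the pairs `(x g, g⁻¹ y)`, and freeness makes `g` unique for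
each of them. -/
theorem Composite.pairing_eq_relProd {Y : GroupoidCorr G K} {Z : GroupoidCorr H K}
    (c : X.Composite Y Z) (f₁ : X → ℂ) (f₂ : Y → ℂ) (x : X) (y : Y) (e : X.s x = Y.r y) :
    X.pairing Y f₁ f₂ x y e = relProd c.Rel f₁ f₂ (c.cls x y e) := by
  refine (relProd_eq_finsum _ (A := {g : G.Arr // X.s x = G.r g})
    (fun g => (X.ract x g.1 g.2,
      Y.lact (G.inv g.1) y ((G.s_inv g.1).trans (g.2.symm.trans e)))) ?_ ?_ ?_ f₁ f₂).symm
  · intro g g' heq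
    have h1 : X.RMul x g.1 (X.ract x g.1 g.2) := ⟨_, rfl⟩
    have h2 : X.RMul x g'.1 (X.ract x g.1 g.2) := ⟨g'.2, (Prod.ext_iff.1 heq).1.symm⟩
    exact Subtype.ext (h1.free h2)
  · intro g
    have h2 : Y.LMul g.1 _ y := lmul_inv_iff.1 ⟨(G.s_inv g.1).trans (g.2.symm.trans e), rfl⟩
    obtain ⟨z, h3, h4⟩ := c.rel_rel_iff.1 ⟨g.1, ⟨g.2, rfl⟩, h2⟩
    exact h4.2 ▸ h3
  · intro x' y' h
    obtain ⟨g, h1, h2⟩ := c.rel_rel_iff.2 ⟨_, h, e, rfl⟩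
    exact ⟨⟨g, h1.1⟩, Prod.ext h1.2 h2.inv.2⟩

/-- The product `𝔖(X) × 𝔖(Y) → 𝔖(X ∘ Y)`. -/
noncomputable def Composite.prod {Y : GroupoidCorr G K} {Z : GroupoidCorr H K}
    (c : X.Composite Y Z) : SFun X →ₗ[ℂ] SFun Y →ₗ[ℂ] SFun Z :=
  c.isEtaleRel.prod

variable (X)

/-- The left action of `𝔖(H)` on `𝔖(X)`. -/
noncomputable def sLact : SFun H.Arr →ₗ[ℂ] SFun X →ₗ[ℂ] SFun X := X.isEtaleRel_lmul.prod

/-- The right action of `𝔖(G)` on `𝔖(X)`. -/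
noncomputable def sRact : SFun X →ₗ[ℂ] SFun G.Arr →ₗ[ℂ] SFun X := X.isEtaleRel_rmul.prod

/-- The `𝔖(G)`-valued inner product on `𝔖(X)`. -/
noncomputable def sInner : SFun X →ₗ⋆[ℂ] SFun X →ₗ[ℂ] SFun G.Arr :=
  X.isEtaleRel_quotient.prod.comp (SFun.conj X)

theorem sLact_eq_relProd (ζ : SFun H.Arr) (ξ : SFun X) :
    (X.sLact ζ ξ : X → ℂ) = relProd X.LMul ζ ξ := rfl

theorem sInner_eq_relProd (ξ η : SFun X) : (X.sInner ξ η : G.Arr → ℂ) =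
    relProd (fun x y g => X.RMul x g y) (star (ξ : X → ℂ)) η := rfl

theorem Composite.coe_prod {X : GroupoidCorr H G} {Y : GroupoidCorr G K} {Z : GroupoidCorr H K}
    (c : X.Composite Y Z) (f₁ : SFun X) (f₂ : SFun Y) :
    (c.prod f₁ f₂ : Z → ℂ) = relProd c.Rel f₁ f₂ := rfl

theorem coe_sLact (ζ : SFun H.Arr) (ξ : SFun X) : (X.sLact ζ ξ : X → ℂ) = X.lconv ζ ξ :=
  (X.lconv_eq_relProd ζ ξ).symm

theorem coe_sRact (ξ : SFun X) (γ : SFun G.Arr) : (X.sRact ξ γ : X → ℂ) = X.rconv ξ γ :=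
  (X.rconv_eq_relProd ξ γ).symm

theorem coe_sInner (ξ η : SFun X) : (X.sInner ξ η : G.Arr → ℂ) = X.braket ξ η :=
  (X.braket_eq_relProd ξ η).symm

end GroupoidCorr

namespace EtaleGroupoid

variable (G : EtaleGroupoid.{u})

/-- The convolution on `𝔖(G)`. -/
noncomputable def sMul : SFun G.Arr →ₗ[ℂ] SFun G.Arr →ₗ[ℂ] SFun G.Arr :=
  (GroupoidCorr.one G).isEtaleRel_lmul.prod

/-- The involution on `𝔖(G)`. -/
noncomputable def sStar : SFun G.Arr →ₗ⋆[ℂ] SFun G.Arr where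
  toFun f := ⟨G.involution f, SFun.star_mem (SFun.comp_proper G.invHomeomorph.isProperMap
    G.invHomeomorph.injective f.2)⟩
  map_add' f g := Subtype.ext (funext fun x => star_add (f.1 (G.inv x)) (g.1 (G.inv x)))
  map_smul' a f := Subtype.ext (funext fun x => star_smul a (f.1 (G.inv x)))

theorem coe_sMul (ξ η : SFun G.Arr) : (G.sMul ξ η : G.Arr → ℂ) = G.conv ξ η :=
  (GroupoidCorr.conv_eq_relProd (G := G) ξ η).symm

theorem coe_sStar (ξ : SFun G.Arr) : (G.sStar ξ : G.Arr → ℂ) = G.involution ξ := rfl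

theorem sStar_sStar (ξ : SFun G.Arr) : G.sStar (G.sStar ξ) = ξ := by
  refine Subtype.ext (funext fun g => ?_)
  simp only [coe_sStar, involution, G.inv_inv, star_star]

end EtaleGroupoid

/-! ### Algebraic identities -/

namespace GroupoidCorr

variable {H G K : EtaleGroupoid.{u}} (X : GroupoidCorr H G)

theorem sLact_sMul (ζ ζ' : SFun H.Arr) (ξ : SFun X) :
    X.sLact (H.sMul ζ ζ') ξ = X.sLact ζ (X.sLact ζ' ξ) :=
  IsEtaleRel.prod_assoc (one H).isEtaleRel_lmul X.isEtaleRel_lmul X.isEtaleRel_lmul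
    X.isEtaleRel_lmul (fun _ _ _ _ => X.lmul_assoc_iff) ζ ζ' ξ

theorem sInner_sRact (ξ η : SFun X) (γ : SFun G.Arr) :
    X.sInner ξ (X.sRact η γ) = G.sMul (X.sInner ξ η) γ :=
  (IsEtaleRel.prod_assoc X.isEtaleRel_quotient (one G).isEtaleRel_rmul X.isEtaleRel_rmul
    X.isEtaleRel_quotient (fun _ _ _ _ => rmul_eq_iff) (SFun.conj X ξ) η γ).symm

theorem sStar_sInner (ξ η : SFun X) : G.sStar (X.sInner ξ η) = X.sInner η ξ := by
  refine Subtype.ext (funext fun g => ?_)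
  rw [G.coe_sStar, EtaleGroupoid.involution, sInner_eq_relProd, sInner_eq_relProd]
  rw [← Pi.star_apply (relProd (fun x y g => X.RMul x g y) _ _), star_relProd, star_star,
    relProd_comm]
  exact relProd_congr (R' := fun x y g => X.RMul x g y) (R := fun x y g => X.RMul y g x)
    fun x y => rmul_inv_iff

/-- After the substitution `h ↦ h⁻¹` hidden in the involution, this is commutation of the two
actions. -/
theorem sInner_sLact (ζ : SFun H.Arr) (ξ η : SFun X) :
    X.sInner (X.sLact ζ ξ) η = X.sInner ξ (X.sLact (H.sStar ζ) η) := by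
  refine Subtype.ext ?_
  rw [sInner_eq_relProd, sInner_eq_relProd, sLact_eq_relProd, sLact_eq_relProd]
  have h : ((H.sStar ζ : SFun H.Arr) : H.Arr → ℂ) =
      star (ζ : H.Arr → ℂ) ∘ H.invHomeomorph.toEquiv := rfl
  rw [star_relProd, relProd_comm X.LMul (star _), h, relProd_comp_left]
  have hL := X.isEtaleRel_lmul
  refine relProd_assoc (R₁₂ := fun x h y => X.LMul h x y) (R := fun x y g => X.RMul x g y)
    (R₂₃ := fun h y x => X.LMul (H.inv h) y x) (R' := fun x y g => X.RMul x g y)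
    (fun x y a b => hL.unique y x a b)
    (fun h y a b => hL.unique (H.inv h) y a b) (fun x h y g => ?_)
    (IsEtaleRel.finite_triple hL.swap X.isEtaleRel_quotient (SFun.conj X ξ).2
      (SFun.conj _ ζ).2 η.2)
  simp only [lmul_inv_iff, lmul_rmul_comm, and_comm]

variable {X} {Y : GroupoidCorr G K} {Z : GroupoidCorr H K} (c : X.Composite Y Z)

theorem Composite.sLact_prod (ζ : SFun H.Arr) (f₁ : SFun X) (f₂ : SFun Y) :
    Z.sLact ζ (c.prod f₁ f₂) = c.prod (X.sLact ζ f₁) f₂ :=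
  (IsEtaleRel.prod_assoc X.isEtaleRel_lmul c.isEtaleRel c.isEtaleRel Z.isEtaleRel_lmul
    (fun _ _ _ _ => c.lmul_iff) ζ f₁ f₂).symm

/-- Two reassociations. The first uses `rmul_iff` to bring the conjugate of `f₂` to the outside; the
second uses `rel_rel_iff` to replace the conjugate of `f₁` paired with `f₁' f₂'` by `⟨f₁, f₁'⟩`
acting on `f₂'`. This makes `μ` isometric. -/
theorem Composite.sInner_prod (f₁ f₁' : SFun X) (f₂ f₂' : SFun Y) :
    Z.sInner (c.prod f₁ f₂) (c.prod f₁' f₂') = Y.sInner f₂ (Y.sLact (X.sInner f₁ f₁') f₂') := by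
  refine Subtype.ext ?_
  rw [sInner_eq_relProd, sInner_eq_relProd, sLact_eq_relProd, sInner_eq_relProd,
    c.coe_prod, c.coe_prod, star_relProd, relProd_comm c.Rel (star _)]
  rw [relProd_assoc (R₂₃ := fun x z y => c.Rel x y z) (R' := fun y y' k => Y.RMul y k y')
    (fun y x a b => c.isEtaleRel.unique x y a b) (fun x z a b => c.rel_right_unique)
    (fun y x z k => ?_) (IsEtaleRel.finite_triple c.isEtaleRel.swap Z.isEtaleRel_quotient
      (SFun.conj Y f₂).2 (SFun.conj X f₁).2 (c.prod f₁' f₂').2)]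
  · congr 1
    exact (relProd_assoc (R₁₂ := fun x y g => X.RMul x g y) (R := Y.LMul) (R₂₃ := c.Rel)
      (R' := fun x z y => c.Rel x y z) X.isEtaleRel_quotient.unique c.isEtaleRel.unique
      (fun _ _ _ _ => c.rel_rel_iff)
      (IsEtaleRel.finite_triple X.isEtaleRel_quotient Y.isEtaleRel_lmul
        (SFun.conj X f₁).2 f₁'.2 f₂'.2)).symm
  · rw [c.rmul_iff]
    simp only [and_comm]

end GroupoidCorr

/-! ### Slices and frames -/

theorem exists_isCcOn_eq_one {X : Type u} [TopologicalSpace X] [IsLocallyLCH X] {V K : Set X}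
    (hV : IsOpen V) (hV2 : T2Space V) (hK : IsCompact K) (hKV : K ⊆ V) :
    ∃ h : X → ℝ, IsCcOn V (fun x => (h x : ℂ)) ∧ (∀ x ∈ K, h x = 1) ∧ ∀ x, h x ∈ Set.Icc 0 1 := by
  classical
  have hlc : LocallyCompactSpace V := hV.locallyCompactSpace
  have hK' : IsCompact (Subtype.val ⁻¹' K : Set V) := by
    rwa [Subtype.isCompact_iff, Subtype.image_preimage_coe, Set.inter_eq_right.2 hKV]
  obtain ⟨φ, h1, -, h2, h3⟩ := exists_continuous_one_zero_of_isCompact hK' isClosed_empty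
    (Set.disjoint_empty _)
  let h : X → ℝ := fun x => if hx : x ∈ V then φ ⟨x, hx⟩ else 0
  have hval : ∀ x : V, h x = φ x := fun x => dif_pos x.2
  refine ⟨h, ⟨hV, hV2, ?_, Subtype.val '' (tsupport φ), h2.isCompact.image continuous_subtype_val,
    ?_, fun x hx => ?_⟩, fun x hx => ?_, fun x => ?_⟩
  · rw [continuousOn_iff_continuous_domRestrict]
    have : V.domRestrict (fun x => (h x : ℂ)) = fun x : V => (φ x : ℂ) :=
      funext fun x => congrArg _ (hval x)
    rw [this]
    fun_prop
  · rintro _ ⟨x, -, rfl⟩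
    exact x.2
  · by_cases hxV : x ∈ V
    · have : (⟨x, hxV⟩ : V) ∉ tsupport φ := fun h => hx ⟨_, h, rfl⟩
      simp [h, hxV, image_eq_zero_of_notMem_tsupport this]
    · simp [h, hxV]
  · exact (hval ⟨x, hKV hx⟩).trans (h1 hx)
  · by_cases hxV : x ∈ V
    · exact (hval ⟨x, hxV⟩) ▸ h3 _
    · simp [h, hxV]

theorem relProd_eq_single {X Y Z : Type*} {R : X → Y → Z → Prop} {f : X → ℂ} {g : Y → ℂ} {x : X}
    {y : Y} {z : Z} (h : R x y z)
    (h' : ∀ x' y', R x' y' z → f x' ≠ 0 → g y' ≠ 0 → x' = x ∧ y' = y) :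
    relProd R f g z = f x * g y := by
  refine (finsum_eq_single _ ⟨(x, y), h⟩ fun p hp => ?_).trans rfl
  by_contra hc
  obtain ⟨h1, h2⟩ := mul_ne_zero_iff.1 hc
  obtain ⟨h3, h4⟩ := h' _ _ p.2 h1 h2
  exact hp (Subtype.ext (Prod.ext h3 h4))

theorem relProd_eq_zero {X Y Z : Type*} {R : X → Y → Z → Prop} {f : X → ℂ} {g : Y → ℂ} {z : Z}
    (h : ∀ x y, R x y z → f x ≠ 0 → g y = 0) : relProd R f g z = 0 := by
  refine finsum_eq_zero_of_forall_eq_zero fun p => ?_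
  by_contra hc
  obtain ⟨h1, h2⟩ := mul_ne_zero_iff.1 hc
  exact h2 (h _ _ p.2 h1)

namespace GroupoidCorr

variable {H G : EtaleGroupoid.{u}} (X : GroupoidCorr H G)

theorem isClosedEmbedding_actionMap : IsClosedEmbedding X.right.actionMap :=
  .of_continuous_injective_isClosedMap X.isProper.continuous X.isFree X.isProper.isClosedMap

/-- Properness makes the orbit relation closed in `X × X`, and projecting along a compact factor
preserves closedness; `X` need not be Hausdorff. -/
theorem isClosed_orbit {C : Set X} (hC : IsCompact C) :
    IsClosed {y | ∃ x ∈ C, ∃ g, X.RMul x g y} := by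
  have h1 : IsClosed (Set.range X.right.actionMap) := X.isClosedEmbedding_actionMap.isClosed_range
  have : CompactSpace C := isCompact_iff_compactSpace.1 hC
  have h2 : IsClosed {p : X × C | ((p.1, p.2.1) : X × X) ∈ Set.range X.right.actionMap} :=
    h1.preimage (by fun_prop)
  convert isClosedMap_fst_of_compactSpace _ h2 using 1
  ext y
  constructor
  · rintro ⟨x, hx, g, e, rfl⟩
    exact ⟨(_, ⟨x, hx⟩), ⟨⟨(x, g), e⟩, rfl⟩, rfl⟩
  · rintro ⟨⟨_, ⟨x, hx⟩⟩, ⟨⟨⟨x', g⟩, e⟩, h⟩, rfl⟩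
    obtain ⟨rfl, rfl⟩ := Prod.ext_iff.1 h
    exact ⟨_, hx, g, e, rfl⟩

/-- An open set on which the right anchor map and the orbit map are injective. -/
structure IsSlice (U : Set X) : Prop where
  isOpen : IsOpen U
  injOn : Set.InjOn X.s U
  eq_of_rmul : ∀ x ∈ U, ∀ y ∈ U, ∀ g, X.RMul x g y → x = y

variable {X}

theorem IsSlice.t2Space {U : Set X} (hU : X.IsSlice U) : T2Space U :=
  t2Space_of_injOn (V := Set.univ) X.right.continuous_s.continuousOn hU.injOn fun _ _ => trivial

variable (X)

/-- Units form an open set of arrows and the action map is an embedding, so some neighbourhood of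
`(x, x)` contains `(y g, y)` only when `g` is a unit. Shrinking a domain of injectivity of the
anchor map accordingly gives a slice. -/
theorem exists_isSlice (x : X) : ∃ U, x ∈ U ∧ X.IsSlice U := by
  obtain ⟨U, hU, hx, hi⟩ := X.isLocalHomeomorph_s.exists_isOpen_injOn x
  have h1 : IsOpen {p : {p : X × G.Arr // X.s p.1 = G.r p.2} | p.1.2 ∈ Set.range G.unit} :=
    G.isOpenEmbedding_unit.isOpen_range.preimage (by fun_prop)
  obtain ⟨O, hO, hOeq⟩ := X.isClosedEmbedding_actionMap.isInducing.isOpen_iff.1 h1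
  have hxO : ((x, x) : X × X) ∈ O := by
    have : (⟨(x, G.unit (X.s x)), (G.r_unit _).symm⟩ : {p : X × G.Arr // X.s p.1 = G.r p.2}) ∈
        X.right.actionMap ⁻¹' O := by
      rw [hOeq]
      exact ⟨_, rfl⟩
    have h2 : X.right.actionMap ⟨(x, G.unit (X.s x)), (G.r_unit _).symm⟩ ∈ O := this
    rwa [RightAction.actionMap, X.right.act_unit] at h2
  obtain ⟨A, B, hA, hB, hxA, hxB, hAB⟩ := isOpen_prod_iff.1 hO x x hxO
  refine ⟨U ∩ (A ∩ B), ⟨hx, hxA, hxB⟩, hU.inter (hA.inter hB), hi.mono Set.inter_subset_left, ?_⟩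
  rintro y hy z hz g ⟨e, rfl⟩
  have h3 : (⟨(y, g), e⟩ : {p : X × G.Arr // X.s p.1 = G.r p.2}) ∈ X.right.actionMap ⁻¹' O :=
    hAB ⟨hz.2.1, hy.2.2⟩
  rw [hOeq] at h3
  obtain ⟨a, rfl : G.unit a = g⟩ := h3
  obtain rfl : X.s y = a := e.trans (G.r_unit a)
  exact (X.right.act_unit y).symm

variable {X}

theorem IsSlice.rmul_eq {U : Set X} (hU : X.IsSlice U) {x x' y : X} {g g' : G.Arr} (hx : x ∈ U)
    (hx' : x' ∈ U) (h : X.RMul x g y) (h' : X.RMul x' g' y) : x = x' ∧ g = g' := by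
  obtain ⟨k, -, h1⟩ := rmul_assoc_iff.2 ⟨y, h, h'.inv⟩
  obtain rfl := hU.eq_of_rmul x hx x' hx' k h1
  exact ⟨rfl, h.free h'⟩

/-- The extension of a function on a slice to an invariant function. -/
theorem IsSlice.exists_invariant {U : Set X} (hU : X.IsSlice U) {h : X → ℝ}
    (hh : IsCcOn U fun x => (h x : ℂ)) :
    ∃ M : X → ℝ, Continuous M ∧ (∀ x ∈ U, ∀ g y, X.RMul x g y → M y = h x) ∧
      ∀ y, (∀ x ∈ U, ∀ g, ¬ X.RMul x g y) → M y = 0 := by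
  classical
  obtain ⟨-, -, hc, K, hK, hKU, hhK⟩ := hh
  let M : X → ℝ := fun y => if hy : ∃ x ∈ U, ∃ g, X.RMul x g y then h hy.choose else 0
  have hM : ∀ x ∈ U, ∀ g y, X.RMul x g y → M y = h x := fun x hx g y hxy => by
    have hy : ∃ x ∈ U, ∃ g, X.RMul x g y := ⟨x, hx, g, hxy⟩
    obtain ⟨h1, g', h2⟩ := hy.choose_spec
    rw [(hU.rmul_eq hx h1 hxy h2).1]
    exact dif_pos hy
  have hM0 : ∀ y, (∀ x ∈ U, ∀ g, ¬ X.RMul x g y) → M y = 0 := fun y hy =>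
    dif_neg fun ⟨x, hx, g, h⟩ => hy x hx g h
  refine ⟨M, continuous_iff_continuousAt.2 fun y => ?_, hM, hM0⟩
  -- On the saturation of `U`, the map `(x, g) ↦ x g` with `x ∈ U` is an open embedding through
  -- which `M` becomes `h`. Elsewhere, the complement of the closed saturation of `K` is a
  -- neighbourhood on which `M` vanishes.
  by_cases hy : ∃ x ∈ U, ∃ g, X.RMul x g y
  · obtain ⟨x, hx, g, e, rfl⟩ := hy
    let P := {p : X × G.Arr // X.s p.1 = G.r p.2}
    let m : P → X := fun p => X.ract p.1.1 p.1.2 p.2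
    have hm : IsLocalHomeomorph m := X.rightUnitComposite.isLocalHomeomorph_cls
    let W : Set P := (fun p => p.1.1) ⁻¹' U
    have hW : IsOpen W := hU.isOpen.preimage (by fun_prop)
    have hi : Set.InjOn m W := fun p hp q hq hpq => by
      have := hU.rmul_eq hp hq ⟨p.2, rfl⟩ ⟨q.2, hpq.symm⟩
      exact Subtype.ext (Prod.ext this.1 this.2)
    have he := hm.isOpenEmbedding_restrict hW hi
    refine (he.continuousAt_iff (x := ⟨⟨(x, g), e⟩, hx⟩)).1 ?_
    have : M ∘ W.domRestrict m = fun p => (fun x => ((h x : ℝ) : ℂ)) p.1.1.1 |>.re := by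
      ext p
      simpa using hM p.1.1.1 p.2 p.1.1.2 _ ⟨p.1.2, rfl⟩
    rw [this]
    have h2 : Continuous fun p : W => ((h p.1.1.1 : ℝ) : ℂ) :=
      hc.comp_continuous
        (continuous_fst.comp (continuous_subtype_val.comp continuous_subtype_val)) fun p => p.2
    exact (Complex.continuous_re.comp h2).continuousAt
  · have h1 := (X.isClosed_orbit hK).isOpen_compl.mem_nhds (x := y) fun ⟨x, hx, g, h⟩ =>
      hy ⟨x, hKU hx, g, h⟩
    refine ContinuousAt.congr (continuousAt_const (y := (0 : ℝ))) ?_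
    filter_upwards [h1] with z hz
    by_cases hz' : ∃ x ∈ U, ∃ g, X.RMul x g z
    · obtain ⟨x, hx, g, h⟩ := hz'
      rw [hM x hx g z h]
      have hxK : x ∉ K := fun hxK => hz ⟨x, hxK, g, h⟩
      exact (Complex.ofReal_eq_zero.1 (hhK x hxK)).symm
    · exact (hM0 z fun x hx g h => hz' ⟨x, hx, g, h⟩).symm

/-- At `y = x g` with `x` in the slice, the double sum has at most one nonzero term, `w(x)` times
its conjugate times `ξ(y)`. So the rank-one operator of `w` is multiplication by an invariant
function. -/
theorem IsSlice.sRact_sInner {U : Set X} (hU : X.IsSlice U) {w : SFun X}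
    (hw : ∀ x ∉ U, (w : X → ℂ) x = 0) (ξ : SFun X) {M : X → ℝ}
    (hM : ∀ x ∈ U, ∀ g y, X.RMul x g y → M y = ‖(w : X → ℂ) x‖ ^ 2)
    (hM0 : ∀ y, (∀ x ∈ U, ∀ g, ¬ X.RMul x g y) → M y = 0) (y : X) :
    (X.sRact w (X.sInner w ξ) : X → ℂ) y = M y * (ξ : X → ℂ) y := by
  have hwU : ∀ {x}, (w : X → ℂ) x ≠ 0 → x ∈ U := fun h => by_contra fun hx => h (hw _ hx)
  change relProd X.RMul w (relProd (fun x y g => X.RMul x g y) (star (w : X → ℂ)) ξ) y = _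
  by_cases hy : ∃ x ∈ U, ∃ g, X.RMul x g y
  · obtain ⟨x, hx, g, h⟩ := hy
    rw [relProd_eq_single h fun x' g' h' hx' _ => hU.rmul_eq (hwU hx') hx h' h,
      relProd_eq_single (R := fun x y g => X.RMul x g y) (x := x) (y := y) h, hM x hx g y h]
    · rw [← mul_assoc, Pi.star_apply, ← starRingEnd_apply, Complex.mul_conj,
        Complex.normSq_eq_norm_sq]
    · intro x' y' h' hx' _
      have hx'' : x' ∈ U := hwU (by simpa using hx')
      obtain rfl := hU.injOn hx'' hx (h'.s_eq.trans h.s_eq.symm)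
      exact ⟨rfl, h'.eq h⟩
  · have hy' : ∀ x ∈ U, ∀ g, ¬ X.RMul x g y := fun x hx g h => hy ⟨x, hx, g, h⟩
    rw [hM0 y hy', relProd_eq_zero fun x g h hx => absurd h (hy' x (hwU hx) g)]
    simp

variable (X)

/-- Functions supported in a given compact set are reproduced by a finite frame. -/
theorem exists_frame {C : Set X} (hC : IsCompact C) :
    ∃ (n : ℕ) (w : Fin n → SFun X), ∀ ξ : SFun X, (∀ x ∉ C, (ξ : X → ℂ) x = 0) →
      ∑ i, X.sRact (w i) (X.sInner (w i) ξ) = ξ := by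
  have hb : ∀ x : X, ∃ (U : Set X) (h : X → ℝ), X.IsSlice U ∧ IsCcOn U (fun x => (h x : ℂ)) ∧
      h x = 1 ∧ x ∈ U := fun x => by
    obtain ⟨U, hx, hU⟩ := X.exists_isSlice x
    obtain ⟨h, h1, h2, -⟩ := exists_isCcOn_eq_one hU.isOpen hU.t2Space (isCompact_singleton (x := x))
      (Set.singleton_subset_iff.2 hx)
    exact ⟨U, h, hU, h1, h2 x rfl, hx⟩
  choose U h hU hh hx hxU using hb
  have hsq : ∀ x, IsCcOn (U x) fun y => ((h x y ^ 2 : ℝ) : ℂ) := fun x => by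
    obtain ⟨h1, h2, h3, K, hK, hKU, hK0⟩ := hh x
    refine ⟨h1, h2, ?_, K, hK, hKU, fun y hy => ?_⟩
    · simp only [Complex.ofReal_pow]
      exact h3.pow 2
    · simpa using hK0 y hy
  choose M hMc hM hM0 using fun x => (hU x).exists_invariant (hsq x)
  have hMnn : ∀ x y, 0 ≤ M x y := fun x y => by
    by_cases hy : ∃ z ∈ U x, ∃ g, X.RMul z g y
    · obtain ⟨z, hz, g, hzy⟩ := hy
      rw [hM x z hz g y hzy]
      positivity
    · exact (hM0 x y fun z hz g h => hy ⟨z, hz, g, h⟩).ge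
  have hMx : ∀ x, M x x = 1 := fun x => by rw [hM x x (hxU x) _ _ (rmul_unit x), hx, one_pow]
  obtain ⟨t, ht⟩ := hC.elim_finite_subcover (fun x => {y | 1 / 2 < M x y})
    (fun x => isOpen_lt continuous_const (hMc x)) fun x _ => Set.mem_iUnion.2
      ⟨x, by simp only [Set.mem_ofPred_eq, hMx]; norm_num⟩
  let N : X → ℝ := fun y => ∑ x ∈ t, M x y
  have hNc : Continuous N := continuous_finsetSum _ fun x _ => hMc x
  have hN : ∀ y ∈ C, 1 / 2 ≤ N y := fun y hy => by
    obtain ⟨x, hx, hxy⟩ := Set.mem_iUnion₂.1 (ht hy)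
    exact hxy.le.trans (Finset.single_le_sum (fun x _ => hMnn x y) hx)
  have hMinv : ∀ x y g z, X.RMul y g z → M x z = M x y := fun x y g z hyz => by
    by_cases hy : ∃ u ∈ U x, ∃ g, X.RMul u g y
    · obtain ⟨u, hu, k, huy⟩ := hy
      obtain ⟨l, -, hl⟩ := rmul_assoc_iff.2 ⟨y, huy, hyz⟩
      rw [hM x u hu k y huy, hM x u hu l z hl]
    · rw [hM0 x y fun u hu g h => hy ⟨u, hu, g, h⟩, hM0 x z fun u hu k h => ?_]
      obtain ⟨l, -, hl⟩ := rmul_assoc_iff.2 ⟨z, h, hyz.inv⟩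
      exact hy ⟨u, hu, l, hl⟩
  -- Invariance is what permits normalizing `h x` on its slice: the factor taken at the slice point
  -- equals the factor at every point of its orbit.
  have hNinv : ∀ y g z, X.RMul y g z → N z = N y := fun y g z hyz =>
    Finset.sum_congr rfl fun x _ => hMinv x y g z hyz
  -- The maximum keeps `k` continuous on all of `X`; on `C`, where `N ≥ 1/2`, it has no effect, and
  -- there the squares `k² M x` sum to one.
  let k : X → ℝ := fun y => (√(max (N y) (1 / 2)))⁻¹
  have hpos : ∀ y, 0 < max (N y) (1 / 2) := fun y => lt_max_of_lt_right (by norm_num)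
  have hk : Continuous k :=
    (hNc.max continuous_const).sqrt.inv₀ fun y => (Real.sqrt_pos.2 (hpos y)).ne'
  have hk2 : ∀ y, k y ^ 2 = (max (N y) (1 / 2))⁻¹ := fun y => by
    simp only [k]
    rw [inv_pow, Real.sq_sqrt (hpos y).le]
  let w : X → SFun X := fun x => ⟨fun y => (k y : ℂ) * (h x y : ℂ),
    SFun.continuous_mul_mem (Complex.continuous_ofReal.comp hk) (hh x).mem⟩
  have hw : ∀ x (ξ : SFun X) y, (X.sRact (w x) (X.sInner (w x) ξ) : X → ℂ) y =
      ((max (N y) (1 / 2))⁻¹ * M x y : ℝ) * (ξ : X → ℂ) y := fun x ξ y => by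
    refine (hU x).sRact_sInner (M := fun y => (max (N y) (1 / 2))⁻¹ * M x y) (fun z hz => ?_) ξ
      (fun z hz g y hzy => ?_) (fun y hy => ?_) y
    · obtain ⟨-, -, -, K, -, hKU, hK0⟩ := hh x
      simp only [w]
      rw [hK0 z fun h => hz (hKU h), mul_zero]
    · simp only [w]
      rw [hM x z hz g y hzy, hNinv z g y hzy, ← hk2]
      simp [mul_pow]
    · rw [hM0 x y hy, mul_zero]
  refine ⟨t.card, fun i => w (t.equivFin.symm i), fun ξ hξ => Subtype.ext (funext fun y => ?_)⟩
  rw [Equiv.sum_comp t.equivFin.symm fun x : t => X.sRact (w x) (X.sInner (w x) ξ),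
    Finset.sum_coe_sort t fun x => X.sRact (w x) (X.sInner (w x) ξ), Submodule.coe_sum,
    Finset.sum_apply, Finset.sum_congr rfl fun x _ => hw x ξ y, ← Finset.sum_mul,
    ← Complex.ofReal_sum, ← Finset.mul_sum]
  by_cases hy : y ∈ C
  · have h1 : (max (N y) (1 / 2))⁻¹ * ∑ x ∈ t, M x y = 1 := by
      rw [max_eq_left (hN y hy)]
      exact inv_mul_cancel₀ (by have := hN y hy; positivity)
    rw [h1, Complex.ofReal_one, one_mul]
  · rw [hξ y hy, mul_zero]

end GroupoidCorr

/-! ### The operator seminorm of a represented *-algebra -/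

section OpSeminorm

variable {B : Type*} [NonUnitalCStarAlgebra B] {S SA : Type*} [AddCommGroup S] [Module ℂ S]
  [AddCommGroup SA] [Module ℂ SA]

/-- A bounded *-representation by adjointable operators induces a C*-seminorm. -/
theorem exists_opSeminorm {ip : S →ₗ⋆[ℂ] S →ₗ[ℂ] B} (pos : ∀ x, IsStarSquare (ip x x))
    {mul : SA → SA → SA} {st : SA → SA} (st_st : ∀ a, st (st a) = a)
    {la : SA →ₗ[ℂ] S →ₗ[ℂ] S} (la_mul : ∀ a b x, la (mul a b) x = la a (la b x))
    (ip_la : ∀ a x y, ip (la a x) y = ip x (la (st a) y))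
    (bdd : ∀ a, ∃ C, ∀ x, ‖ip (la a x) (la a x)‖ ≤ C * ‖ip x x‖) :
    ∃ p : Seminorm ℂ SA, (∀ a b, p (mul a b) ≤ p a * p b) ∧ (∀ a, p (mul (st a) a) = p a ^ 2) ∧
      ∀ a x, ‖ip (la a x) (la a x)‖ ≤ p a ^ 2 * ‖ip x x‖ := by
  set n := innerSeminorm pos with hn
  have hnn : ∀ x, 0 ≤ n x := fun x => apply_nonneg n x
  let T : SA → Set ℝ := fun a => {c | 0 ≤ c ∧ ∀ x, n (la a x) ≤ c * n x}
  let p : SA → ℝ := fun a => sInf (T a)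
  have hT0 : ∀ a, (T a).Nonempty := fun a => by
    obtain ⟨C, hC⟩ := bdd a
    refine ⟨√(max C 0), Real.sqrt_nonneg _, fun x => ?_⟩
    refine le_of_sq_le_sq ?_ (mul_nonneg (Real.sqrt_nonneg _) (hnn x))
    rw [mul_pow, Real.sq_sqrt (le_max_right _ _), hn, innerSeminorm_sq, innerSeminorm_sq]
    exact (hC x).trans (mul_le_mul_of_nonneg_right (le_max_left _ _) (norm_nonneg _))
  have hTb : ∀ a, BddBelow (T a) := fun a => ⟨0, fun c hc => hc.1⟩
  have hp0 : ∀ a, 0 ≤ p a := fun a => Real.sInf_nonneg fun c hc => hc.1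
  have hpm : ∀ a x, n (la a x) ≤ p a * n x := fun a x => by
    rcases (hnn x).eq_or_lt with h | h
    · obtain ⟨c, hc⟩ := hT0 a
      have := hc.2 x
      rwa [← h, mul_zero] at this ⊢
    · rw [← div_le_iff₀ h]
      exact le_csInf (hT0 a) fun c hc => (div_le_iff₀ h).2 (hc.2 x)
  have hple : ∀ a c, 0 ≤ c → (∀ x, n (la a x) ≤ c * n x) → p a ≤ c := fun a c h0 h =>
    csInf_le (hTb a) ⟨h0, h⟩
  let P : Seminorm ℂ SA := Seminorm.ofSMulLE p
    (le_antisymm (hple 0 0 le_rfl fun x => by simp) (hp0 0))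
    (fun a b => hple _ _ (add_nonneg (hp0 a) (hp0 b)) fun x => by
      rw [map_add, LinearMap.add_apply, add_mul]
      exact (map_add_le_add n _ _).trans (add_le_add (hpm a x) (hpm b x)))
    (fun c a => hple _ _ (mul_nonneg (norm_nonneg _) (hp0 a)) fun x => by
      rw [map_smul, LinearMap.smul_apply, map_smul_eq_mul, mul_assoc]
      exact mul_le_mul_of_nonneg_left (hpm a x) (norm_nonneg _))
  have hmul : ∀ a b, p (mul a b) ≤ p a * p b := fun a b =>
    hple _ _ (mul_nonneg (hp0 a) (hp0 b)) fun x => by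
      rw [la_mul, mul_assoc]
      exact (hpm _ _).trans (mul_le_mul_of_nonneg_left (hpm b x) (hp0 a))
  -- The Cauchy–Schwarz bound with constant 4 would not give the C*-identity. Instead, with `y = a*
  -- a x`, positivity of the inner square of `t x - t⁻¹ y` gives `2⟨a x, a x⟩ ≤ t²⟨x, x⟩ + t⁻²⟨y,
  -- y⟩` with sharp constants.
  have hsq : ∀ a, p a ^ 2 ≤ p (mul (st a) a) := fun a => by
    have h1 : ∀ x, n (la a x) ^ 2 ≤ p (mul (st a) a) * n x ^ 2 := fun x => by
      have key : ∀ t : ℝ, 0 < t →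
          2 * n (la a x) ^ 2 ≤ t ^ 2 * n x ^ 2 + t⁻¹ ^ 2 * n (la (mul (st a) a) x) ^ 2 := by
        intro t ht
        set y := la (mul (st a) a) x with hy
        have e1 : ip x y = ip (la a x) (la a x) := by rw [hy, la_mul, ip_la]
        have e2 : ip y x = ip (la a x) (la a x) := by rw [hy, la_mul, ip_la, st_st]
        have e : ((t ^ 2 : ℝ) : ℂ) • ip x x + ((t⁻¹ ^ 2 : ℝ) : ℂ) • ip y y -
            ((2 : ℝ) : ℂ) • ip (la a x) (la a x) =
            ip ((t : ℂ) • x - ((t⁻¹ : ℝ) : ℂ) • y) ((t : ℂ) • x - ((t⁻¹ : ℝ) : ℂ) • y) := by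
          have ht' : (t : ℂ) ≠ 0 := by exact_mod_cast ht.ne'
          simp only [map_sub, map_smulₛₗ, LinearMap.sub_apply, LinearMap.smul_apply,
            RingHom.id_apply, Complex.conj_ofReal, e1, e2]
          match_scalars <;> field_simp
          ring
        have h2 := IsStarSquare.norm_le (IsStarSquare.smul (by norm_num : (0 : ℝ) ≤ 2) (pos (la a x)))
          (b := ((t ^ 2 : ℝ) : ℂ) • ip x x + ((t⁻¹ ^ 2 : ℝ) : ℂ) • ip y y) (e ▸ pos _)
        have h3 := norm_add_le (((t ^ 2 : ℝ) : ℂ) • ip x x) (((t⁻¹ ^ 2 : ℝ) : ℂ) • ip y y)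
        rw [norm_smul, norm_smul, Complex.norm_real, Complex.norm_real,
          Real.norm_of_nonneg (by positivity), Real.norm_of_nonneg (by positivity)] at h3
        rw [norm_smul, Complex.norm_real, Real.norm_of_nonneg (by norm_num)] at h2
        rw [hn, innerSeminorm_sq, innerSeminorm_sq, innerSeminorm_sq]
        exact h2.trans h3
      refine le_of_forall_pos_le_add fun ε hε => ?_
      have hq := hp0 (mul (st a) a)
      set q := p (mul (st a) a)
      obtain ⟨δ, hδ, hδ'⟩ : ∃ δ : ℝ, 0 < δ ∧ δ * n x ^ 2 ≤ ε := by
        refine ⟨ε / (n x ^ 2 + 1), by positivity, ?_⟩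
        rw [div_mul_eq_mul_div, div_le_iff₀ (by positivity)]
        nlinarith [sq_nonneg (n x)]
      have ht : 0 < q + δ := by linarith
      -- The optimal weight is `t² = p (a* a)`; the small `δ` keeps it positive.
      have h3 := key (√(q + δ)) (Real.sqrt_pos.2 ht)
      rw [inv_pow, Real.sq_sqrt ht.le] at h3
      have h4 : n (la (mul (st a) a) x) ^ 2 ≤ (q + δ) ^ 2 * n x ^ 2 := by
        rw [← mul_pow]
        refine pow_le_pow_left₀ (hnn _) ((hpm _ x).trans ?_) 2
        exact mul_le_mul_of_nonneg_right (by linarith) (hnn x)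
      have h5 : (q + δ)⁻¹ * n (la (mul (st a) a) x) ^ 2 ≤ (q + δ) * n x ^ 2 := by
        rw [inv_mul_le_iff₀ ht]
        linarith
      nlinarith
    have h2 : p a ≤ √(p (mul (st a) a)) := hple _ _ (Real.sqrt_nonneg _) fun x => by
      refine le_of_sq_le_sq ?_ (mul_nonneg (Real.sqrt_nonneg _) (hnn x))
      rw [mul_pow, Real.sq_sqrt (hp0 _)]
      exact h1 x
    calc p a ^ 2 ≤ √(p (mul (st a) a)) ^ 2 := pow_le_pow_left₀ (hp0 a) h2 2
      _ = _ := Real.sq_sqrt (hp0 _)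
  have hst : ∀ a, p a ≤ p (st a) := fun a => by
    by_contra! hlt
    have h1 := (hsq a).trans (hmul (st a) a)
    rw [sq] at h1
    exact absurd (le_of_mul_le_mul_right h1 ((hp0 _).trans_lt hlt)) (not_le.2 hlt)
  refine ⟨P, hmul, fun a => le_antisymm ?_ (hsq a), fun a x => ?_⟩
  · refine (hmul _ _).trans ?_
    rw [sq]
    have := hst (st a)
    rw [st_st] at this
    exact mul_le_mul_of_nonneg_right this (hp0 a)
  · rw [← innerSeminorm_sq pos, ← innerSeminorm_sq pos, ← mul_pow]
    exact pow_le_pow_left₀ (hnn _) (hpm a x) 2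

end OpSeminorm

/-! ### Identities in the convolution algebra -/

namespace EtaleGroupoid

variable (G : EtaleGroupoid.{u})

theorem sMul_assoc (ξ η ζ : SFun G.Arr) :
    G.sMul (G.sMul ξ η) ζ = G.sMul ξ (G.sMul η ζ) :=
  (GroupoidCorr.one G).sLact_sMul ξ η ζ

/-- This makes statements about inner products on correspondences applicable to the algebra `𝔖(G)`
itself. -/
theorem sMul_sStar_left (ξ η : SFun G.Arr) :
    G.sMul (G.sStar ξ) η = (GroupoidCorr.one G).sInner ξ η := by
  refine Subtype.ext ?_
  have h : ((G.sStar ξ : SFun G.Arr) : G.Arr → ℂ) =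
      star (ξ : G.Arr → ℂ) ∘ G.invHomeomorph.toEquiv := rfl
  refine (congrArg (fun f => relProd (GroupoidCorr.one G).LMul f (η : G.Arr → ℂ)) h).trans ?_
  refine (relProd_comp_left (GroupoidCorr.one G).LMul G.invHomeomorph.toEquiv
    (star (ξ : G.Arr → ℂ)) (η : G.Arr → ℂ)).trans ?_
  funext z
  exact relProd_congr (R := fun x y z => (GroupoidCorr.one G).LMul (G.inv x) y z)
    (R' := fun x y g => (GroupoidCorr.one G).RMul x g y) fun x y =>
      GroupoidCorr.lmul_inv_iff (X := GroupoidCorr.one G)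

theorem sStar_sMul (ξ η : SFun G.Arr) :
    G.sStar (G.sMul ξ η) = G.sMul (G.sStar η) (G.sStar ξ) := by
  have h1 := (GroupoidCorr.one G).sStar_sInner (G.sStar ξ) η
  have h2 := G.sMul_sStar_left (G.sStar ξ) η
  rw [sStar_sStar] at h2
  exact (congrArg G.sStar h2).trans (h1.trans (G.sMul_sStar_left η (G.sStar ξ)).symm)

end EtaleGroupoid

/-! ### Multiplication by functions on the object space. -/

namespace GroupoidCorr

variable {H G : EtaleGroupoid.{u}} (X : GroupoidCorr H G)

/-- Multiplication of functions in `𝔖(X)` by functions on the objects of `H`. -/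
noncomputable def objMul {F : H.Obj → ℝ} (hF : Continuous F) (ξ : SFun X) : SFun X :=
  ⟨fun x => (F (X.r x) : ℂ) * (ξ : X → ℂ) x, SFun.continuous_mul_mem
    (Complex.continuous_ofReal.comp (hF.comp X.left.continuous_r)) ξ.2⟩

theorem sInner_objMul {F : H.Obj → ℝ} (hF : Continuous F) (ξ η : SFun X) :
    X.sInner (X.objMul hF ξ) η = X.sInner ξ (X.objMul hF η) := by
  refine Subtype.ext (funext fun g => ?_)
  rw [sInner_eq_relProd, sInner_eq_relProd]
  refine finsum_congr fun p => ?_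
  simp only [objMul, Pi.star_apply, star_mul', RCLike.star_def, Complex.conj_ofReal]
  rw [RMul.r_eq p.2]
  ring

/-- Take `η = √(C - F) ξ`: multiplication by a real function of the left anchor is self-adjoint,
because that anchor is invariant under the right action. -/
theorem sInner_smul_sub {F : H.Obj → ℝ} (hF : Continuous F) {C : ℝ} (hC : ∀ u, F u ≤ C)
    (ξ : SFun X) : ∃ η : SFun X,
      (C : ℂ) • X.sInner ξ ξ - X.sInner ξ (X.objMul hF ξ) = X.sInner η η := by
  have hk : Continuous fun u => √(C - F u) := (continuous_const.sub hF).sqrt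
  refine ⟨X.objMul hk ξ, ?_⟩
  rw [sInner_objMul, ← map_smul, ← map_sub]
  congr 1
  refine Subtype.ext (funext fun x => ?_)
  simp only [objMul, Submodule.coe_sub, Submodule.coe_smul, Pi.sub_apply, Pi.smul_apply,
    smul_eq_mul]
  rw [← mul_assoc, ← Complex.ofReal_mul, Real.mul_self_sqrt (sub_nonneg.2 (hC _)),
    Complex.ofReal_sub]
  ring

end GroupoidCorr

theorem IsCcOn.continuous {X : Type u} [TopologicalSpace X] [T2Space X] {V : Set X} {f : X → ℂ}
    (h : IsCcOn V f) : Continuous f := by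
  obtain ⟨hV, -, hc, K, hK, hKV, hK0⟩ := h
  refine continuous_iff_continuousAt.2 fun x => ?_
  by_cases hx : x ∈ V
  · exact hc.continuousAt (hV.mem_nhds hx)
  · refine ContinuousAt.congr (continuousAt_const (y := (0 : ℂ))) ?_
    filter_upwards [hK.isClosed.isOpen_compl.mem_nhds fun h => hx (hKV h)] with y hy
    exact (hK0 y hy).symm

theorem IsCcOn.exists_norm_le {X : Type u} [TopologicalSpace X] {V : Set X} {f : X → ℂ}
    (h : IsCcOn V f) : ∃ C, 0 ≤ C ∧ ∀ x, ‖f x‖ ≤ C := by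
  obtain ⟨-, -, hc, K, hK, hKV, hK0⟩ := h
  obtain ⟨C, hC⟩ := hK.exists_bound_of_continuousOn (hc.mono hKV)
  refine ⟨max C 0, le_max_right _ _, fun x => ?_⟩
  by_cases hx : x ∈ K
  · exact (hC x hx).trans (le_max_left _ _)
  · rw [hK0 x hx, norm_zero]
    exact le_max_right _ _

/-! ### Bisections and domination of the left action. -/

namespace EtaleGroupoid

variable (G : EtaleGroupoid.{u})

/-- An open set on which range and source are injective. -/
def IsBisection (V : Set G.Arr) : Prop := Set.InjOn G.r V ∧ Set.InjOn G.s V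

theorem exists_isBisection (g : G.Arr) : ∃ U, IsOpen U ∧ g ∈ U ∧ G.IsBisection U := by
  obtain ⟨U, h1, h2, h3⟩ := G.isLocalHomeomorph_r.exists_isOpen_injOn g
  obtain ⟨V, h4, h5, h6⟩ := G.isLocalHomeomorph_s.exists_isOpen_injOn g
  exact ⟨U ∩ V, h1.inter h4, ⟨h2, h5⟩, h3.mono Set.inter_subset_left,
    h6.mono Set.inter_subset_right⟩

variable {G}

/-- For `ζ` supported in a bisection, `ζ* ζ` is a continuous function on the objects. -/
theorem IsBisection.exists_objMul {V : Set G.Arr} (hV : G.IsBisection V) {ζ : SFun G.Arr}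
    (hζ : IsCcOn V (ζ : G.Arr → ℂ)) : ∃ (F : G.Obj → ℝ) (hF : Continuous F) (C : ℝ), 0 ≤ C ∧
      (∀ u, F u ≤ C) ∧ ∀ {K : EtaleGroupoid.{u}} (X : GroupoidCorr G K) (ξ : SFun X),
        X.sLact (G.sStar ζ) (X.sLact ζ ξ) = X.objMul hF ξ := by
  obtain ⟨C, hC0, hC⟩ := hζ.exists_norm_le
  have hsq : IsCcOn V fun g => ((‖(ζ : G.Arr → ℂ) g‖ ^ 2 : ℝ) : ℂ) := by
    obtain ⟨h1, h2, h3, K, hK, hKU, hK0⟩ := hζ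
    refine ⟨h1, h2, ?_, K, hK, hKU, fun y hy => by simp [hK0 y hy]⟩
    exact Complex.continuous_ofReal.comp_continuousOn (h3.norm.pow 2)
  have hζV : ∀ {g}, (ζ : G.Arr → ℂ) g ≠ 0 → g ∈ V := fun {g} hg => by
    obtain ⟨-, -, -, K, -, hKV, hK0⟩ := hζ
    exact hKV (by_contra fun h => hg (hK0 g h))
  -- At `u` this is `|ζ g|²` for the only `g` in the bisection with source `u`, or zero. It is
  -- continuous because the object space is Hausdorff, and it does not depend on `X`.
  let f := fiberSum G.s fun g => ((‖(ζ : G.Arr → ℂ) g‖ ^ 2 : ℝ) : ℂ)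
  have hf : Continuous f := (hsq.fiberSum G.isLocalHomeomorph_s hV.2).continuous
  have hf1 : ∀ g ∈ V, f (G.s g) = ((‖(ζ : G.Arr → ℂ) g‖ ^ 2 : ℝ) : ℂ) := fun g hg =>
    fiberSum_apply_of_injOn hV.2 (fun h hh => by
      rw [not_imp_comm.1 hζV hh]
      simp) hg
  have hf0 : ∀ u, (∀ g ∈ V, G.s g ≠ u) → f u = 0 := fun u hu =>
    fiberSum_eq_zero fun g hg => by
      rw [not_imp_comm.1 hζV fun h => hu g h hg]
      simp
  refine ⟨fun u => (f u).re, Complex.continuous_re.comp hf, C ^ 2, sq_nonneg C, fun u => ?_,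
    fun X ξ => Subtype.ext (funext fun x => ?_)⟩
  · by_cases hu : ∃ g ∈ V, G.s g = u
    · obtain ⟨g, hg, rfl⟩ := hu
      simp only [hf1 g hg, Complex.ofReal_re]
      exact pow_le_pow_left₀ (norm_nonneg _) (hC g) 2
    · simp only [hf0 u fun g hg h => hu ⟨g, hg, h⟩]
      exact sq_nonneg C
  · change relProd X.LMul (G.sStar ζ) (relProd X.LMul ζ ξ) x = ((f (X.r x)).re : ℂ) * _
    have hstar : ∀ g, (G.sStar ζ : G.Arr → ℂ) g = star ((ζ : G.Arr → ℂ) (G.inv g)) := fun _ => rfl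
    by_cases hu : ∃ g ∈ V, G.s g = X.r x
    · obtain ⟨g, hg, e⟩ := hu
      have hgx : X.LMul g x (X.lact g x e) := ⟨e, rfl⟩
      rw [relProd_eq_single hgx.inv, relProd_eq_single hgx, ← e, hf1 g hg, hstar, G.inv_inv,
        Complex.ofReal_re, ← _root_.mul_assoc, ← starRingEnd_apply, mul_comm ((starRingEnd ℂ) _),
        Complex.mul_conj, Complex.normSq_eq_norm_sq]
      · intro h y hy h1 _
        have : h = g := hV.1 (hζV h1) hg (hy.r_left.symm.trans hgx.r_left)
        subst this
        exact ⟨rfl, hy.inv.eq hgx.inv⟩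
      · intro h y hy h1 _
        rw [hstar, star_ne_zero] at h1
        have : G.inv h = g := hV.2 (hζV h1) hg (by rw [G.s_inv, ← hy.r_left, e])
        subst this
        exact ⟨(G.inv_inv h).symm, hy.inv.eq hgx⟩
    · rw [hf0 _ fun g hg h => hu ⟨g, hg, h⟩, relProd_eq_zero]
      · simp
      · intro h y hy h1
        rw [hstar, star_ne_zero] at h1
        exact absurd ⟨_, hζV h1, by rw [G.s_inv, ← hy.r_left]⟩ hu

/-- An algebraic domination inside `𝔖`, available before any norm or positivity statement. The unit
correspondence gives the bound on C*-seminorms, a general `X` the bound on its left action. -/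
theorem IsBisection.exists_sInner_sub {V : Set G.Arr} (hV : G.IsBisection V) {ζ : SFun G.Arr}
    (hζ : IsCcOn V (ζ : G.Arr → ℂ)) : ∃ C : ℝ, 0 ≤ C ∧
      ∀ {K : EtaleGroupoid.{u}} (X : GroupoidCorr G K) (ξ : SFun X), ∃ η : SFun X,
        (C : ℂ) • X.sInner ξ ξ - X.sInner (X.sLact ζ ξ) (X.sLact ζ ξ) = X.sInner η η := by
  obtain ⟨F, hF, C, hC0, hC, h⟩ := hV.exists_objMul hζ
  refine ⟨C, hC0, fun X ξ => ?_⟩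
  rw [X.sInner_sLact, h]
  exact X.sInner_smul_sub hF hC ξ

end EtaleGroupoid

/-! ### Existence of `C*(G)` and `C*(X)` -/

namespace EtaleGroupoid

variable {G : EtaleGroupoid.{u}}

theorem _root_.IsCStarSeminorm.le_sStar {p : Seminorm ℂ (SFun G.Arr)} (hp : IsCStarSeminorm G p)
    (ξ : SFun G.Arr) : p ξ ≤ p (G.sStar ξ) := by
  have h := hp.mul_le (G.sStar ξ) ξ (G.sMul (G.sStar ξ) ξ) (G.coe_sMul _ _)
  rw [hp.cstar ξ _ (G.coe_sMul _ _), sq] at h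
  by_contra! hlt
  exact absurd (le_of_mul_le_mul_right h ((apply_nonneg p _).trans_lt hlt)) (not_le.2 hlt)

theorem exists_cstarAlg_of_seminorm {p : Seminorm ℂ (SFun G.Arr)} (hp : IsCStarSeminorm G p) :
    ∃ (A : CStarAlg.{u}) (ι : SFun G.Arr →ₗ[ℂ] A), DenseRange ι ∧ (∀ x, ‖ι x‖ = p x) ∧
      (∀ x y, ι (G.sMul x y) = ι x * ι y) ∧ ∀ x, ι (G.sStar x) = star (ι x) :=
  exists_cstarAlg_completion G.sMul G.sStar G.sMul_assoc G.sStar_sMul G.sStar_sStar p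
    (fun ξ η => hp.mul_le ξ η _ (G.coe_sMul ξ η)) (fun ξ => hp.cstar ξ _ (G.coe_sMul _ _))

/-- For `ζ` on a bisection, the domination read in the completion for `p` gives `p (ζ η)² ≤ C
p(η)²`. With `η = ζ*` and `q = p(ζ*)` this says `q⁴ ≤ C q²`, so `q ≤ √C` with `C` independent of
`p`. General functions are sums of such `ζ`. -/
theorem exists_seminorm_bound {ξ : G.Arr → ℂ} (hξ : ξ ∈ SFun G.Arr) :
    ∃ C, ∀ p, IsCStarSeminorm G p → ∀ ζ : SFun G.Arr, (ζ : G.Arr → ℂ) = ξ → p ζ ≤ C := by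
  refine SFun.induction_small (Q := G.IsBisection)
    (p := fun ξ => ∃ C, ∀ p, IsCStarSeminorm G p → ∀ ζ : SFun G.Arr, (ζ : G.Arr → ℂ) = ξ → p ζ ≤ C)
    (fun U V h hV => ⟨hV.1.mono h, hV.2.mono h⟩) G.exists_isBisection (fun V f hV hf => ?_) ?_ ?_ hξ
  · obtain ⟨C, hC0, hC⟩ := hV.exists_sInner_sub (ζ := ⟨f, hf.mem⟩) hf
    refine ⟨√C, fun p hp ζ hζ => ?_⟩
    obtain rfl : ζ = ⟨f, hf.mem⟩ := Subtype.ext hζ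
    obtain ⟨A, ι, -, hn, hm, hs⟩ := exists_cstarAlg_of_seminorm hp
    have key : ∀ η, p (G.sMul ⟨f, hf.mem⟩ η) ^ 2 ≤ C * p η ^ 2 := fun η => by
      obtain ⟨(θ : SFun G.Arr), hθ⟩ := hC (GroupoidCorr.one G) η
      have e := fun a : SFun G.Arr => G.sMul_sStar_left a a
      have h1 : (C : ℂ) • G.sMul (G.sStar η) η -
          G.sMul (G.sStar (G.sMul ⟨f, hf.mem⟩ η)) (G.sMul ⟨f, hf.mem⟩ η) =
            G.sMul (G.sStar θ) θ :=
        (congrArg₂ (fun a b => (C : ℂ) • a - b) (e η) (e _)).trans (hθ.trans (e θ).symm)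
      have h3 : (C : ℂ) • (star (ι η) * ι η) -
          star (ι (G.sMul ⟨f, hf.mem⟩ η)) * ι (G.sMul ⟨f, hf.mem⟩ η) = star (ι θ) * ι θ := by
        rw [← hs, ← hs, ← hs, ← hm, ← hm (G.sStar (G.sMul _ _)), ← hm (G.sStar θ), ← h1, map_sub,
          map_smul]
      have h4 := IsStarSquare.norm_le ⟨ι (G.sMul ⟨f, hf.mem⟩ η), rfl⟩ ⟨_, h3⟩
      rw [norm_smul, CStarRing.norm_star_mul_self, CStarRing.norm_star_mul_self, hn, hn,
        Complex.norm_real, Real.norm_of_nonneg hC0] at h4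
      simpa only [sq] using h4
    have h1 := key (G.sStar ⟨f, hf.mem⟩)
    have h2 := hp.cstar (G.sStar ⟨f, hf.mem⟩) (G.sMul ⟨f, hf.mem⟩ (G.sStar ⟨f, hf.mem⟩)) (by
      rw [G.coe_sMul, ← G.coe_sStar, G.sStar_sStar])
    rw [h2] at h1
    refine (hp.le_sStar _).trans (Real.le_sqrt_of_sq_le ?_)
    set q := p (G.sStar ⟨f, hf.mem⟩)
    rcases eq_or_ne q 0 with h0 | h0
    · rw [h0]
      simpa using hC0
    · have hq : 0 < q ^ 2 := by positivity
      rw [sq (q ^ 2)] at h1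
      exact le_of_mul_le_mul_right h1 hq
  · refine ⟨0, fun p hp ζ hζ => ?_⟩
    obtain rfl : ζ = 0 := Subtype.ext hζ
    exact (map_zero p).le
  · rintro f g hf hg ⟨C, hC⟩ ⟨D, hD⟩
    refine ⟨C + D, fun p hp ζ hζ => ?_⟩
    obtain rfl : ζ = ⟨f, hf⟩ + ⟨g, hg⟩ := Subtype.ext hζ
    exact (map_add_le_add p _ _).trans (add_le_add (hC p hp _ rfl) (hD p hp _ rfl))

variable (G)

/-- Pointwise bounds make the supremum of all C*-seminorms a seminorm, and both defining conditions
pass to suprema. -/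
theorem exists_max_seminorm : ∃ q : Seminorm ℂ (SFun G.Arr), IsCStarSeminorm G q ∧
    ∀ p, IsCStarSeminorm G p → p ≤ q := by
  let T : Set (Seminorm ℂ (SFun G.Arr)) := {p | IsCStarSeminorm G p}
  have h0 : T.Nonempty := ⟨0, fun _ _ _ _ => by simp, fun _ _ _ => by simp⟩
  have hT : BddAbove T := by
    rw [Seminorm.bddAbove_iff]
    choose C hC using fun ξ : SFun G.Arr => exists_seminorm_bound ξ.2
    refine ⟨C, ?_⟩
    rintro _ ⟨p, hp, rfl⟩ ξ
    exact hC ξ p hp ξ rfl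
  have hle : ∀ p, IsCStarSeminorm G p → p ≤ sSup T := fun p hp => le_csSup hT hp
  have hlub : ∀ ξ C, (∀ p ∈ T, p ξ ≤ C) → sSup T ξ ≤ C := fun ξ C h => by
    rw [Seminorm.sSup_apply hT]
    have : Nonempty T := h0.to_subtype
    exact ciSup_le fun p => h p p.2
  refine ⟨sSup T, ⟨fun ξ η ζ h => ?_, fun ξ ζ h => le_antisymm ?_ ?_⟩, hle⟩
  · exact hlub _ _ fun p hp => (hp.mul_le ξ η ζ h).trans
      (mul_le_mul (hle p hp ξ) (hle p hp η) (apply_nonneg _ _) (apply_nonneg _ _))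
  · exact hlub _ _ fun p hp => (hp.cstar ξ ζ h).le.trans
      (pow_le_pow_left₀ (apply_nonneg _ _) (hle p hp ξ) 2)
  · have h1 : sSup T ξ ≤ √(sSup T ζ) := hlub _ _ fun p hp => Real.le_sqrt_of_sq_le
      ((hp.cstar ξ ζ h).ge.trans (hle p hp ζ))
    calc sSup T ξ ^ 2 ≤ √(sSup T ζ) ^ 2 := pow_le_pow_left₀ (apply_nonneg _ _) h1 2
      _ = _ := Real.sq_sqrt (apply_nonneg _ _)

theorem exists_groupoidCStarAlgebra :
    ∃ A : CStarAlg.{u}, Nonempty (GroupoidCStarAlgebra G A) := by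
  obtain ⟨q, hq, hmax⟩ := G.exists_max_seminorm
  obtain ⟨A, ι, hd, hn, hm, hs⟩ := exists_cstarAlg_of_seminorm hq
  exact ⟨A, ⟨ι, fun ξ η => ⟨_, G.coe_sMul ξ η, hm ξ η⟩, fun ξ => ⟨_, G.coe_sStar ξ, hs ξ⟩, hd,
    fun p hp ξ => (hmax p hp ξ).trans (hn ξ).ge⟩⟩

end EtaleGroupoid

namespace GroupoidCStarAlgebra

variable {G : EtaleGroupoid.{u}} {A : CStarAlg.{u}} (c : GroupoidCStarAlgebra G A)

theorem ι_sMul (ξ η : SFun G.Arr) : c.ι (G.sMul ξ η) = c.ι ξ * c.ι η := by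
  obtain ⟨ζ, h1, h2⟩ := c.map_conv ξ η
  rw [← h2, Subtype.ext (h1.trans (G.coe_sMul ξ η).symm)]

theorem ι_sStar (ξ : SFun G.Arr) : c.ι (G.sStar ξ) = star (c.ι ξ) := by
  obtain ⟨ζ, h1, h2⟩ := c.map_star ξ
  rw [← h2, Subtype.ext (h1.trans (G.coe_sStar ξ).symm)]

/-- The completed inner product. -/
noncomputable def inner {H : EtaleGroupoid.{u}} (X : GroupoidCorr H G) :
    SFun X →ₗ⋆[ℂ] SFun X →ₗ[ℂ] A :=
  LinearMap.mk₂'ₛₗ (starRingEnd ℂ) (RingHom.id ℂ) (fun ξ η => c.ι (X.sInner ξ η))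
    (fun ξ η ζ => by simp) (fun a ξ η => by simp) (fun ξ η ζ => by simp) (fun a ξ η => by simp)

theorem inner_apply {H : EtaleGroupoid.{u}} (X : GroupoidCorr H G) (ξ η : SFun X) :
    c.inner X ξ η = c.ι (X.sInner ξ η) := rfl

/-- Inserting a frame expansion `ξ = ∑ wᵢ ⟨wᵢ, ξ⟩` in the second argument gives `∑ ⟨wᵢ, ξ⟩* ⟨wᵢ,
ξ⟩`. -/
theorem inner_pos {H : EtaleGroupoid.{u}} (X : GroupoidCorr H G) (ξ : SFun X) :
    IsStarSquare (c.inner X ξ ξ) := by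
  obtain ⟨C, hC, hξ⟩ := SFun.exists_compact ξ.2
  obtain ⟨n, w, hw⟩ := X.exists_frame hC
  have h : c.inner X ξ ξ =
      ∑ i, star (c.ι (X.sInner (w i) ξ)) * c.ι (X.sInner (w i) ξ) := by
    rw [inner_apply]
    conv_lhs =>
      enter [2, 2]
      rw [← hw ξ hξ]
    rw [map_sum, map_sum]
    refine Finset.sum_congr rfl fun i _ => ?_
    rw [X.sInner_sRact, c.ι_sMul, ← c.ι_sStar, X.sStar_sInner]
  rw [h]
  exact IsStarSquare.sum _ fun i _ => ⟨_, rfl⟩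

/-- Bisection pieces are bounded by domination and positivity; sums are handled by the weighted
inequality at `t = 1`, whence the factor 2. -/
theorem exists_norm_inner_sLact_le {K : EtaleGroupoid.{u}} {X : GroupoidCorr K G}
    {ζ : K.Arr → ℂ} (hζ : ζ ∈ SFun K.Arr) :
    ∃ C, ∀ χ : SFun K.Arr, (χ : K.Arr → ℂ) = ζ → ∀ ξ : SFun X,
      ‖c.inner X (X.sLact χ ξ) (X.sLact χ ξ)‖ ≤ C * ‖c.inner X ξ ξ‖ := by
  refine SFun.induction_small (Q := K.IsBisection)
    (p := fun ζ => ∃ C, ∀ χ : SFun K.Arr, (χ : K.Arr → ℂ) = ζ → ∀ ξ : SFun X,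
      ‖c.inner X (X.sLact χ ξ) (X.sLact χ ξ)‖ ≤ C * ‖c.inner X ξ ξ‖)
    (fun U V h hV => ⟨hV.1.mono h, hV.2.mono h⟩) K.exists_isBisection (fun V f hV hf => ?_) ?_ ?_ hζ
  · obtain ⟨C, hC0, hC⟩ := hV.exists_sInner_sub (ζ := ⟨f, hf.mem⟩) hf
    refine ⟨C, fun χ hχ ξ => ?_⟩
    obtain rfl : χ = ⟨f, hf.mem⟩ := Subtype.ext hχ
    obtain ⟨η, hη⟩ := hC X ξ
    have h2 : (C : ℂ) • c.inner X ξ ξ -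
        c.inner X (X.sLact ⟨f, hf.mem⟩ ξ) (X.sLact ⟨f, hf.mem⟩ ξ) = c.inner X η η := by
      rw [inner_apply, inner_apply, inner_apply, ← hη, map_sub, map_smul]
    have h4 := IsStarSquare.norm_le (c.inner_pos X _) (h2 ▸ c.inner_pos X η)
    rwa [norm_smul, Complex.norm_real, Real.norm_of_nonneg hC0] at h4
  · refine ⟨0, fun χ hχ ξ => ?_⟩
    obtain rfl : χ = 0 := Subtype.ext hχ
    simp
  · rintro f g hf hg ⟨C, hC⟩ ⟨D, hD⟩
    refine ⟨2 * (C + D), fun χ hχ ξ => ?_⟩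
    obtain rfl : χ = ⟨f, hf⟩ + ⟨g, hg⟩ := Subtype.ext hχ
    have h1 := hC ⟨f, hf⟩ rfl ξ
    have h2 := hD ⟨g, hg⟩ rfl ξ
    have h3 := norm_inner_add_le_weighted (c.inner_pos X) (X.sLact ⟨f, hf⟩ ξ) (X.sLact ⟨g, hg⟩ ξ)
      one_pos
    rw [map_add, LinearMap.add_apply]
    refine h3.trans ?_
    norm_num
    linarith

end GroupoidCStarAlgebra

namespace GroupoidCorr

variable {H G : EtaleGroupoid.{u}} (X : GroupoidCorr H G)

/-- A cutoff function on objects, extended by zero from the open set of units, acts as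
multiplication by its value at the left anchor. Choosing it equal to 1 on the anchors of the support
of `ξ` gives nondegeneracy. -/
theorem exists_sLact_eq_self (ξ : SFun X) : ∃ χ : SFun H.Arr, X.sLact χ ξ = ξ := by
  obtain ⟨C, hC, hξ⟩ := SFun.exists_compact ξ.2
  obtain ⟨h, h1, h2, -⟩ := exists_isCcOn_eq_one (X := H.Obj) isOpen_univ inferInstance
    (hC.image X.left.continuous_r) (Set.subset_univ _)
  refine ⟨⟨_, SFun.fiberSum_mem H.isOpenEmbedding_unit.isLocalHomeomorph h1.mem⟩,
    Subtype.ext (funext fun x => ?_)⟩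
  change relProd X.LMul (fiberSum H.unit fun x => ((h x : ℝ) : ℂ)) ξ x = _
  rw [fiberSum_eq_extend H.isOpenEmbedding_unit.injective,
    relProd_eq_single (lmul_unit x), H.isOpenEmbedding_unit.injective.extend_apply]
  · by_cases hx : x ∈ C
    · rw [h2 _ ⟨x, hx, rfl⟩]
      simp
    · rw [hξ x hx, mul_zero]
  · intro k y hy hk _
    by_cases hk' : ∃ u, H.unit u = k
    · obtain ⟨u, rfl⟩ := hk'
      obtain rfl : X.r y = u := hy.r_eq.symm.trans (H.s_unit u)
      obtain rfl := hy.eq (lmul_unit y)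
      exact ⟨rfl, rfl⟩
    · exact absurd (Function.extend_apply' _ _ _ hk') hk

/-- The operator seminorm of the left action is a C*-seminorm on `𝔖(H)`, hence at most the norm of
`C*(H)`. This is where maximality of the norm is used. -/
theorem exists_groupoidCStarCorr {A B : CStarAlg.{u}} (cH : GroupoidCStarAlgebra H A)
    (cG : GroupoidCStarAlgebra G B) :
    ∃ E : CStarCorr A B, Nonempty (GroupoidCStarCorr X cH cG E) := by
  obtain ⟨p, hp1, hp2, hp3⟩ := exists_opSeminorm (cG.inner_pos X) (mul := fun a b => H.sMul a b)
    (st := H.sStar) H.sStar_sStar (la := X.sLact) X.sLact_sMul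
    (fun ζ ξ η => by rw [cG.inner_apply, cG.inner_apply, X.sInner_sLact])
    (fun ζ => by
      obtain ⟨C, hC⟩ := cG.exists_norm_inner_sLact_le (X := X) ζ.2
      exact ⟨C, hC ζ rfl⟩)
  have hp : IsCStarSeminorm H p := by
    refine ⟨fun ξ η ζ h => ?_, fun ξ ζ h => ?_⟩
    · obtain rfl : ζ = H.sMul ξ η := Subtype.ext (h.trans (H.coe_sMul ξ η).symm)
      exact hp1 ξ η
    · obtain rfl : ζ = H.sMul (H.sStar ξ) ξ := Subtype.ext (h.trans (H.coe_sMul (H.sStar ξ) ξ).symm)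
      exact hp2 ξ
  obtain ⟨E, ι, hd, hi, hr, hl⟩ := exists_cstarCorr_completion cH.denseRange cG.denseRange
    (cG.inner X) (fun ξ η => by
      rw [cG.inner_apply, cG.inner_apply, ← cG.ι_sStar, X.sStar_sInner])
    (cG.inner_pos X) X.sRact
    (fun ξ η γ => by rw [cG.inner_apply, cG.inner_apply, X.sInner_sRact, cG.ι_sMul]) X.sLact
    (fun ζ => ⟨H.sStar ζ, cH.ι_sStar ζ, fun ξ η => by
      rw [cG.inner_apply, cG.inner_apply, X.sInner_sLact]⟩)
    (fun ζ ζ' => ⟨H.sMul ζ ζ', cH.ι_sMul ζ ζ', X.sLact_sMul ζ ζ'⟩)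
    (fun ζ ξ => (hp3 ζ ξ).trans (mul_le_mul_of_nonneg_right
      (pow_le_pow_left₀ (apply_nonneg _ _) (cH.le_norm p hp ζ) 2) (norm_nonneg _)))
    Set.univ Submodule.span_univ (fun ξ _ ε hε => by
      obtain ⟨χ, hχ⟩ := X.exists_sLact_eq_self ξ
      exact ⟨ξ, Submodule.subset_span ⟨χ, ξ, hχ⟩, by simpa using hε⟩)
  exact ⟨E, ⟨ι, fun ξ η => ⟨_, X.coe_sInner ξ η, hi ξ η⟩, fun ξ γ => ⟨_, X.coe_sRact ξ γ, hr ξ γ⟩,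
    fun ζ ξ => ⟨_, X.coe_sLact ζ ξ, hl ζ ξ⟩, hd⟩⟩

end GroupoidCorr

/-! ### Extension by zero -/

theorem relProd_extend_left {X₁ X₂ Y Z : Type*} {α : X₁ → X₂} (hα : Function.Injective α)
    (R : X₂ → Y → Z → Prop) (f : X₁ → ℂ) (g : Y → ℂ) :
    relProd R (Function.extend α f 0) g = relProd (fun x y z => R (α x) y z) f g := by
  ext z
  let e : {p : X₁ × Y // R (α p.1) p.2 z} → {p : X₂ × Y // R p.1 p.2 z} := fun p =>
    ⟨(α p.1.1, p.1.2), p.2⟩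
  have he : Function.Injective e := by
    rintro ⟨⟨a, b⟩, _⟩ ⟨⟨a', b'⟩, _⟩ h
    simp only [e, Subtype.mk.injEq, Prod.mk.injEq] at h
    obtain rfl := hα h.1
    obtain rfl := h.2
    rfl
  have hsupp : (Function.support fun p : {p : X₂ × Y // R p.1 p.2 z} =>
      Function.extend α f 0 p.1.1 * g p.1.2) ⊆ Set.range e := by
    rintro ⟨⟨a, b⟩, hp⟩ h
    by_contra hc
    have : ¬ ∃ x, α x = a := by
      rintro ⟨x, rfl⟩
      exact hc ⟨⟨(x, b), hp⟩, rfl⟩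
    refine h ?_
    simp only [Function.extend_apply' _ _ _ this]
    simp
  have h1 := finsum_mem_univ (fun p : {p : X₂ × Y // R p.1 p.2 z} =>
    Function.extend α f 0 p.1.1 * g p.1.2)
  rw [relProd, ← h1, ← finsum_mem_inter_support, Set.univ_inter,
    ← Set.inter_eq_right.2 hsupp, finsum_mem_inter_support, finsum_mem_range he]
  exact finsum_congr fun p => by simp only [e, hα.extend_apply]

theorem relProd_eq_extend {X Y Z₁ Z₂ : Type*} {β : Z₁ → Z₂} (hβ : Function.Injective β)
    {R₁ : X → Y → Z₁ → Prop} {R₂ : X → Y → Z₂ → Prop}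
    (h : ∀ x y z, R₂ x y z ↔ ∃ z', β z' = z ∧ R₁ x y z') (f : X → ℂ) (g : Y → ℂ) :
    relProd R₂ f g = Function.extend β (relProd R₁ f g) 0 := by
  ext z
  by_cases hz : ∃ z', β z' = z
  · obtain ⟨z, rfl⟩ := hz
    rw [hβ.extend_apply]
    refine relProd_congr fun x y => ⟨fun h' => ?_, fun h' => (h _ _ _).2 ⟨z, rfl, h'⟩⟩
    obtain ⟨z', e, h''⟩ := (h _ _ _).1 h'
    exact hβ e ▸ h''
  · rw [Function.extend_apply' _ _ _ hz]
    refine relProd_eq_zero fun x y hxy => absurd ?_ hz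
    obtain ⟨z', e, -⟩ := (h _ _ _).1 hxy
    exact ⟨z', e⟩

namespace GroupoidCorr

variable {H G K : EtaleGroupoid.{u}}

/-- Compatibility with the right anchors, which are local homeomorphisms, forces openness. Extension
by zero is then a fibre sum and stays in `𝔖`. -/
theorem Hom.isOpenEmbedding {X Y : GroupoidCorr H G} (α : Hom X Y) : IsOpenEmbedding α.toFun := by
  have h : IsLocalHomeomorph α.toFun := by
    refine .of_comp ?_ Y.isLocalHomeomorph_s α.continuous_toFun
    have : Y.s ∘ α.toFun = X.s := funext α.s_map
    rw [this]
    exact X.isLocalHomeomorph_s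
  exact h.isOpenEmbedding_of_injective α.injective

/-- Extension of functions by zero along a 2-arrow. -/
noncomputable def Hom.extend {X Y : GroupoidCorr H G} (α : Hom X Y) : SFun X →ₗ[ℂ] SFun Y :=
  (Function.ExtendByZero.linearMap ℂ α.toFun).restrict fun f hf => by
    have := SFun.fiberSum_mem α.isOpenEmbedding.isLocalHomeomorph hf
    rwa [fiberSum_eq_extend α.injective] at this

theorem Hom.coe_extend {X Y : GroupoidCorr H G} (α : Hom X Y) (ξ : SFun X) :
    (α.extend ξ : Y → ℂ) = Function.extend α.toFun (ξ : X → ℂ) 0 := rfl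

theorem Hom.lmul_map_iff {X Y : GroupoidCorr H G} (α : Hom X Y) {h : H.Arr} {x : X} {y : Y} :
    Y.LMul h (α.toFun x) y ↔ ∃ x', α.toFun x' = y ∧ X.LMul h x x' := by
  constructor
  · rintro ⟨e, rfl⟩
    exact ⟨_, α.map_lact h x (e.trans (α.r_map x)), e.trans (α.r_map x), rfl⟩
  · rintro ⟨_, rfl, e, rfl⟩
    exact ⟨e.trans (α.r_map x).symm, (α.map_lact h x e).symm⟩

theorem Hom.rmul_map_iff {X Y : GroupoidCorr H G} (α : Hom X Y) {x x' : X} {g : G.Arr} :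
    Y.RMul (α.toFun x) g (α.toFun x') ↔ X.RMul x g x' := by
  constructor
  · rintro ⟨e, h⟩
    have e' := (α.s_map x).symm.trans e
    exact ⟨e', α.injective ((α.map_ract x g e').trans h)⟩
  · rintro ⟨e, rfl⟩
    exact ⟨(α.s_map x).trans e, (α.map_ract x g e).symm⟩

theorem Hom.sLact_extend {X Y : GroupoidCorr H G} (α : Hom X Y) (ζ : SFun H.Arr) (ξ : SFun X) :
    Y.sLact ζ (α.extend ξ) = α.extend (X.sLact ζ ξ) := by
  refine Subtype.ext ?_
  rw [α.coe_extend, sLact_eq_relProd, sLact_eq_relProd, α.coe_extend, relProd_comm,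
    relProd_extend_left α.injective, relProd_comm]
  exact relProd_eq_extend α.injective (R₁ := X.LMul) (R₂ := fun h x y => Y.LMul h (α.toFun x) y)
    (fun h x y => α.lmul_map_iff) _ _

theorem Hom.sInner_extend {X Y : GroupoidCorr H G} (α : Hom X Y) (ξ η : SFun X) :
    Y.sInner (α.extend ξ) (α.extend η) = X.sInner ξ η := by
  refine Subtype.ext ?_
  have hs : star (Function.extend α.toFun (ξ : X → ℂ) 0) =
      Function.extend α.toFun (star (ξ : X → ℂ)) 0 := by
    ext y
    by_cases hy : ∃ x, α.toFun x = y
    · obtain ⟨x, rfl⟩ := hy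
      simp [α.injective.extend_apply]
    · simp [Function.extend_apply' _ _ _ hy]
  rw [sInner_eq_relProd, sInner_eq_relProd, α.coe_extend, α.coe_extend, hs,
    relProd_extend_left α.injective, relProd_comm, relProd_extend_left α.injective, relProd_comm]
  funext g
  exact relProd_congr (R := fun x x' g => Y.RMul (α.toFun x) g (α.toFun x'))
    (R' := fun x x' g => X.RMul x g x') fun x x' => α.rmul_map_iff

/-! ### Products of functions under 2-arrows, and their span. -/

namespace Composite

variable {X X₁ X₂ : GroupoidCorr H G} {Y Y₁ Y₂ : GroupoidCorr G K} {Z Z₁ Z₂ : GroupoidCorr H K}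

theorem prod_extend_left (c₁ : X₁.Composite Y Z₁) (c₂ : X₂.Composite Y Z₂) (α : Hom X₁ X₂)
    (β : Hom Z₁ Z₂) (h : ∀ x y e, β.toFun (c₁.cls x y e) =
      c₂.cls (α.toFun x) y ((α.s_map x).trans e)) (f₁ : SFun X₁) (f₂ : SFun Y) :
    β.extend (c₁.prod f₁ f₂) = c₂.prod (α.extend f₁) f₂ := by
  refine Subtype.ext ?_
  rw [β.coe_extend, c₁.coe_prod, c₂.coe_prod, α.coe_extend, relProd_extend_left α.injective]
  refine (relProd_eq_extend β.injective (fun x y z => ⟨?_, ?_⟩) _ _).symm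
  · rintro ⟨e, rfl⟩
    have e' := (α.s_map x).symm.trans e
    exact ⟨_, h x y e', e', rfl⟩
  · rintro ⟨_, rfl, e, rfl⟩
    exact ⟨_, (h x y e).symm⟩

theorem prod_extend_right (c₁ : X.Composite Y₁ Z₁) (c₂ : X.Composite Y₂ Z₂) (α : Hom Y₁ Y₂)
    (β : Hom Z₁ Z₂) (h : ∀ x y e, β.toFun (c₁.cls x y e) =
      c₂.cls x (α.toFun y) (e.trans (α.r_map y).symm)) (f₁ : SFun X) (f₂ : SFun Y₁) :
    β.extend (c₁.prod f₁ f₂) = c₂.prod f₁ (α.extend f₂) := by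
  refine Subtype.ext ?_
  rw [β.coe_extend, c₁.coe_prod, c₂.coe_prod, α.coe_extend, relProd_comm c₂.Rel,
    relProd_extend_left α.injective, relProd_comm (fun y x z => c₂.Rel x (α.toFun y) z)]
  refine (relProd_eq_extend β.injective (fun x y z => ⟨?_, ?_⟩) _ _).symm
  · rintro ⟨e, rfl⟩
    have e' := e.trans (α.r_map y)
    exact ⟨_, h x y e', e', rfl⟩
  · rintro ⟨_, rfl, e, rfl⟩
    exact ⟨_, (h x y e).symm⟩

/-- With one of the two models a unit composite, this becomes the compatibility of `μ` with the
unitors. -/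
theorem extend_prod_eq (c₁ : X.Composite Y Z₁) (c₂ : X.Composite Y Z₂) (β : Hom Z₁ Z₂)
    (h : ∀ x y e, β.toFun (c₁.cls x y e) = c₂.cls x y e) (f₁ : SFun X) (f₂ : SFun Y) :
    β.extend (c₁.prod f₁ f₂) = c₂.prod f₁ f₂ := by
  refine Subtype.ext ?_
  rw [β.coe_extend, c₁.coe_prod, c₂.coe_prod]
  refine (relProd_eq_extend β.injective (fun x y z => ⟨?_, ?_⟩) _ _).symm
  · rintro ⟨e, rfl⟩
    exact ⟨_, h x y e, e, rfl⟩
  · rintro ⟨_, rfl, e, rfl⟩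
    exact ⟨_, (h x y e).symm⟩

theorem extend_prod_prod {G₁ G₂ G₃ G₄ : EtaleGroupoid.{u}} {X₁ : GroupoidCorr G₁ G₂}
    {X₂ : GroupoidCorr G₂ G₃} {X₃ : GroupoidCorr G₃ G₄} {X₁₂ : GroupoidCorr G₁ G₃}
    {X₂₃ : GroupoidCorr G₂ G₄} {Z Z' : GroupoidCorr G₁ G₄} (c₁₂ : X₁.Composite X₂ X₁₂)
    (c₂₃ : X₂.Composite X₃ X₂₃) (c : X₁.Composite X₂₃ Z) (c' : X₁₂.Composite X₃ Z')
    (β : Z ≅ Z') (h : ∀ x₁ x₂ x₃ e e', Hom.toFun β.hom (c.cls x₁ (c₂₃.cls x₂ x₃ e')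
      (e.trans (c₂₃.r_cls x₂ x₃ e').symm)) =
        c'.cls (c₁₂.cls x₁ x₂ e) x₃ ((c₁₂.s_cls x₁ x₂ e).trans e'))
    (f₁ : SFun X₁) (f₂ : SFun X₂) (f₃ : SFun X₃) :
    Hom.extend β.hom (c.prod f₁ (c₂₃.prod f₂ f₃)) = c'.prod (c₁₂.prod f₁ f₂) f₃ := by
  refine Subtype.ext ?_
  have hβ : ∀ z, Hom.toFun β.hom (Hom.toFun β.inv z) = z := fun z =>
    congrFun (congrArg Hom.toFun β.inv_hom_id) z
  have hinj : Function.Injective (Hom.toFun β.hom) := Hom.injective β.hom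
  rw [Hom.coe_extend, c.coe_prod, c'.coe_prod, c₁₂.coe_prod, c₂₃.coe_prod]
  -- Transporting the relation of `c` through the inverse of `β` places both bracketings over the
  -- same space `Z'`.
  have key := relProd_assoc (R₁₂ := c₁₂.Rel) (R := c'.Rel) (R₂₃ := c₂₃.Rel)
    (R' := fun x y z => c.Rel x y (Hom.toFun β.inv z)) c₁₂.isEtaleRel.unique
    c₂₃.isEtaleRel.unique (fun x₁ x₂ x₃ z => ⟨?_, ?_⟩)
    (IsEtaleRel.finite_triple c₁₂.isEtaleRel c'.isEtaleRel f₁.2 f₂.2 f₃.2)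
  · rw [key]
    refine (relProd_eq_extend hinj (fun x y z => ⟨fun h => ⟨_, hβ z, h⟩, ?_⟩) _ _).symm
    rintro ⟨z', rfl, h⟩
    rwa [← hinj (hβ (Hom.toFun β.hom z')).symm]
  · rintro ⟨_, ⟨e, rfl⟩, e', rfl⟩
    have e'' := (c₁₂.s_cls _ _ _).symm.trans e'
    refine ⟨_, ⟨e'', rfl⟩, e.trans (c₂₃.r_cls _ _ _).symm, hinj ?_⟩
    rw [hβ]
    exact h _ _ _ e e''
  · rintro ⟨_, ⟨e, rfl⟩, e', h'⟩
    have e'' := e'.trans (c₂₃.r_cls _ _ _)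
    refine ⟨_, ⟨e'', rfl⟩, (c₁₂.s_cls _ _ _).trans e, ?_⟩
    rw [← h _ _ _ e'' e, h', hβ]

/-- Functions on a composite are sums of products. -/
theorem mem_span_prod (c : X.Composite Y Z) (f : SFun Z) :
    f ∈ Submodule.span ℂ {φ | ∃ f₁ f₂, c.prod f₁ f₂ = φ} := by
  let P := {p : X × Y // X.s p.1 = Y.r p.2}
  let m : P → Z := fun p => c.cls p.1.1 p.1.2 p.2
  have hm : IsLocalHomeomorph m := c.isLocalHomeomorph_cls
  have hq : IsLocalHomeomorph fun p : P => p.1.2 :=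
    X.isLocalHomeomorph_s.snd_fiberProd Y.left.continuous_r
  have hP : IsLocallyLCH P := hq.isLocallyLCH
  suffices h : ∀ φ : SFun Z, (φ : Z → ℂ) = f →
      φ ∈ Submodule.span ℂ {φ | ∃ f₁ f₂, c.prod f₁ f₂ = φ} from h f rfl
  refine SFun.induction_small (Q := fun V => ∃ U, X.IsSlice U ∧ V ⊆ {z | ∃ x ∈ U, ∃ y, c.Rel x y z})
    (p := fun f => ∀ φ : SFun Z, (φ : Z → ℂ) = f →
      φ ∈ Submodule.span ℂ {φ | ∃ f₁ f₂, c.prod f₁ f₂ = φ})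
    (fun V V' h ⟨U, hU, hV⟩ => ⟨U, hU, h.trans hV⟩) (fun z => ?_) ?_ ?_ ?_ f.2
  · obtain ⟨x, y, e, rfl⟩ := c.exists_rel z
    obtain ⟨U, hx, hU⟩ := X.exists_isSlice x
    refine ⟨m '' ((fun p : P => p.1.1) ⁻¹' U), hm.isOpenMap _ (hU.isOpen.preimage
      (continuous_fst.comp continuous_subtype_val)), ⟨⟨(x, y), e⟩, hx, rfl⟩, U, hU, ?_⟩
    rintro _ ⟨p, hp, rfl⟩
    exact ⟨p.1.1, hp, p.1.2, p.2, rfl⟩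
  · rintro V f ⟨U, hU, hVU⟩ ⟨hV, _, hfc, L, hL, hLV, hf0⟩ φ rfl
    refine Submodule.subset_span ?_
    classical
    -- Over the slice `U` each class has at most one representative, so `φ` lifts to a function `F`
    -- on the part of the fibre product above `U`. The factors will be a cutoff `h` on `U` and the
    -- fibre sum of `F` along the second projection.
    have huniq : ∀ x ∈ U, ∀ x' ∈ U, ∀ y y' z, c.Rel x y z → c.Rel x' y' z → x = x' ∧ y = y' := by
      intro x hx x' hx' y y' z h h'
      obtain ⟨g, h1, -⟩ := c.rel_rel_iff.2 ⟨z, h', h⟩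
      obtain rfl := hU.eq_of_rmul x hx x' hx' g h1
      exact ⟨rfl, c.rel_right_unique h h'⟩
    let W : Set P := (fun p => p.1.1) ⁻¹' U
    have hW : IsOpen W := hU.isOpen.preimage (continuous_fst.comp continuous_subtype_val)
    have hWi : Set.InjOn m W := fun p hp q hq h => by
      obtain ⟨h1, h2⟩ := huniq _ hp _ hq _ _ _ ⟨p.2, rfl⟩ ⟨q.2, h.symm⟩
      exact Subtype.ext (Prod.ext h1 h2)
    have he := hm.isOpenEmbedding_restrict hW hWi
    let F : P → ℂ := fun p => if p ∈ W then (φ : Z → ℂ) (m p) else 0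
    let L' : Set P := Subtype.val '' (W.domRestrict m ⁻¹' L)
    have hL' : IsCompact L' := by
      refine IsCompact.image ?_ continuous_subtype_val
      rw [he.isInducing.isCompact_preimage_iff]
      · exact hL
      · intro z hz
        obtain ⟨x, hx, y, e, rfl⟩ := hVU (hLV hz)
        exact ⟨⟨⟨(x, y), e⟩, hx⟩, rfl⟩
    have hF : IsCcOn (W ∩ m ⁻¹' V) F := by
      refine ⟨hW.inter (hV.preimage hm.continuous), ?_, ?_, L', hL', ?_, fun p hp => ?_⟩
      · exact t2Space_of_injOn (V := V) hm.continuous.continuousOn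
          (hWi.mono Set.inter_subset_left) fun p hp => hp.2
      · refine ContinuousOn.congr (hfc.comp hm.continuous.continuousOn fun p hp => hp.2)
          fun p hp => ?_
        exact if_pos hp.1
      · rintro _ ⟨p, hp, rfl⟩
        exact ⟨p.2, hLV hp⟩
      · by_cases hpW : p ∈ W
        · exact (if_pos hpW).trans (hf0 _ fun h => hp ⟨⟨p, hpW⟩, h, rfl⟩)
        · exact if_neg hpW
    -- The cutoff equals 1 on the first coordinates of the lifted support, so multiplying by it does
    -- not alter `φ`.
    obtain ⟨h, hh, h1, -⟩ := exists_isCcOn_eq_one hU.isOpen hU.t2Space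
      (hL'.image (f := fun p : P => p.1.1) (continuous_fst.comp continuous_subtype_val)) (by
        rintro _ ⟨_, ⟨p, -, rfl⟩, rfl⟩
        exact p.2)
    have hhU : ∀ {x}, ((h x : ℝ) : ℂ) ≠ 0 → x ∈ U := fun {x} hx => by
      obtain ⟨-, -, -, M, -, hMU, hM0⟩ := hh
      exact hMU (by_contra fun h => hx (hM0 x h))
    refine ⟨⟨_, hh.mem⟩, ⟨_, SFun.fiberSum_mem hq hF.mem⟩, Subtype.ext (funext fun z => ?_)⟩
    change relProd c.Rel (fun x => ((h x : ℝ) : ℂ)) (fiberSum (fun p : P => p.1.2) F) z = _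
    by_cases hz : ∃ x ∈ U, ∃ y, c.Rel x y z
    · obtain ⟨x, hx, y, hxy⟩ := hz
      rw [relProd_eq_single hxy fun x' y' h' h1 _ => huniq _ (hhU h1) _ hx _ _ _ h' hxy]
      obtain ⟨e, rfl⟩ := hxy
      have h2 : fiberSum (fun p : P => p.1.2) F y = (φ : Z → ℂ) (c.cls x y e) := by
        refine (fiberSum_apply_of_injOn (U := W) (x := ⟨(x, y), e⟩) (fun p hp q hq hpq => ?_)
          (fun p hp => if_neg hp) hx).trans (if_pos hx)
        refine Subtype.ext (Prod.ext (hU.injOn hp hq ?_) hpq)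
        exact p.2.trans ((congrArg Y.r hpq).trans q.2.symm)
      rw [h2]
      by_cases hzL : c.cls x y e ∈ L
      · rw [h1 x ⟨⟨(x, y), e⟩, ⟨⟨⟨(x, y), e⟩, hx⟩, hzL, rfl⟩, rfl⟩]
        simp
      · rw [hf0 _ hzL, mul_zero]
    · rw [hf0 z fun h => hz (hVU (hLV h)), relProd_eq_zero]
      exact fun x y hxy hx => absurd ⟨x, hhU hx, y, hxy⟩ hz
  · intro φ hφ
    obtain rfl : φ = 0 := Subtype.ext hφ
    exact Submodule.zero_mem _
  · intro f g hf hg h1 h2 φ hφ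
    obtain rfl : φ = ⟨f, hf⟩ + ⟨g, hg⟩ := Subtype.ext hφ
    exact Submodule.add_mem _ (h1 _ rfl) (h2 _ rfl)

end Composite

end GroupoidCorr

/-! ### Maps between the completions -/

open scoped TensorProduct in
/-- Isometric bimodule maps out of a tensor product that are defined on dense subspaces. -/
theorem CStarCorr.TensorProduct.exists_hom_of_bilin_dense {A B C : CStarAlg.{u}}
    {E : CStarCorr A B} {F : CStarCorr B C} {T T' : CStarCorr A C} (t : E.TensorProduct F T)
    {P Q R : Type*} [AddCommGroup P] [Module ℂ P] [AddCommGroup Q] [Module ℂ Q]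
    {i : P →ₗ[ℂ] E} {j : Q →ₗ[ℂ] F} (hi : DenseRange i) (hj : DenseRange j)
    (m : P →ₗ[ℂ] Q →ₗ[ℂ] T')
    (hm : ∀ x y x' y', T'.inner (m x y) (m x' y') =
      F.inner (j y) (F.lact (E.inner (i x) (i x')) (j y')))
    {k : R → A} (hk : DenseRange k) (la : R → P →ₗ[ℂ] P)
    (hla : ∀ a x, E.lact (k a) (i x) = i (la a x))
    (hl : ∀ a x y, T'.lact (k a) (m x y) = m (la a x) y) :
    ∃ α : T ⟶ T', ∀ x y, Hom.toFun α (t.tmul (i x) (j y)) = m x y := by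
  let l : P ⊗[ℂ] Q →ₗ[ℂ] T := _root_.TensorProduct.lift ((t.tmul.comp i).compl₂ j)
  have hl' : ∀ x y, l (x ⊗ₜ y) = t.tmul (i x) (j y) := fun x y => rfl
  have hd : DenseRange l := by
    intro z
    refine t.mem_closure_of_tmul_dense hi hj (S := (LinearMap.range l).topologicalClosure)
      (Submodule.isClosed_topologicalClosure _) (fun x y => subset_closure ?_) z
    exact ⟨x ⊗ₜ[ℂ] y, rfl⟩
  obtain ⟨α, hα⟩ := exists_hom (F := T') hd (_root_.TensorProduct.lift m) (fun s s' => by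
    induction s with
    | zero => simp
    | add s₁ s₂ h₁ h₂ => simp only [map_add, LinearMap.add_apply, h₁, h₂]
    | tmul x y =>
      induction s' with
      | zero => simp
      | add s₁ s₂ h₁ h₂ => simp only [map_add, h₁, h₂]
      | tmul x' y' =>
        rw [hl', hl', _root_.TensorProduct.lift.tmul, _root_.TensorProduct.lift.tmul, hm,
          t.inner_tmul])
    hk (fun a s => by
      refine ⟨_root_.TensorProduct.map (la a) LinearMap.id s, ?_⟩
      induction s with
      | zero => simp
      | add s₁ s₂ h₁ h₂ => simp only [map_add, h₁, h₂, and_self]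
      | tmul x y =>
        rw [_root_.TensorProduct.map_tmul, hl', hl', _root_.TensorProduct.lift.tmul,
          _root_.TensorProduct.lift.tmul, LinearMap.id_apply, hl, t.lact_tmul, hla]
        exact ⟨rfl, rfl⟩)
  exact ⟨α, fun x y => hα (x ⊗ₜ[ℂ] y)⟩

theorem GroupoidCStarAlgebra.star_ι_mul_ι {G : EtaleGroupoid.{u}} {A : CStarAlg.{u}}
    (c : GroupoidCStarAlgebra G A) (ξ η : SFun G.Arr) :
    star (c.ι ξ) * c.ι η = c.ι ((GroupoidCorr.one G).sInner ξ η) := by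
  rw [← c.ι_sStar, ← c.ι_sMul]
  exact congrArg c.ι (G.sMul_sStar_left ξ η)

namespace GroupoidCStarCorr

variable {H G K : EtaleGroupoid.{u}} {A B C : CStarAlg.{u}} {cH : GroupoidCStarAlgebra H A}
  {cG : GroupoidCStarAlgebra G B} {cK : GroupoidCStarAlgebra K C}

section

variable {X : GroupoidCorr H G} {E : CStarCorr A B} (D : GroupoidCStarCorr X cH cG E)

theorem inner_eq (ξ η : SFun X) : E.inner (D.ι ξ) (D.ι η) = cG.ι (X.sInner ξ η) := by
  obtain ⟨γ, h1, h2⟩ := D.inner_ι ξ η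
  rw [h2, Subtype.ext (h1.trans (X.coe_sInner ξ η).symm)]

theorem ract_eq (ξ : SFun X) (γ : SFun G.Arr) : E.ract (D.ι ξ) (cG.ι γ) = D.ι (X.sRact ξ γ) := by
  obtain ⟨φ, h1, h2⟩ := D.ract_ι ξ γ
  rw [h2, Subtype.ext (h1.trans (X.coe_sRact ξ γ).symm)]

theorem lact_eq (ζ : SFun H.Arr) (ξ : SFun X) : E.lact (cH.ι ζ) (D.ι ξ) = D.ι (X.sLact ζ ξ) := by
  obtain ⟨φ, h1, h2⟩ := D.lact_ι ζ ξ
  rw [h2, Subtype.ext (h1.trans (X.coe_sLact ζ ξ).symm)]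

end

/-- The algebra `C*(G)` as the correspondence of the unit arrow on `G`. -/
noncomputable def one (cG : GroupoidCStarAlgebra G B) :
    GroupoidCStarCorr (GroupoidCorr.one G) cG cG (CStarCorr.one B) where
  ι := cG.ι
  inner_ι ξ η := ⟨_, (GroupoidCorr.one G).coe_sInner ξ η, cG.star_ι_mul_ι ξ η⟩
  ract_ι ξ γ := ⟨_, (GroupoidCorr.one G).coe_sRact ξ γ, (cG.ι_sMul ξ γ).symm⟩
  lact_ι ζ ξ := ⟨_, (GroupoidCorr.one G).coe_sLact ζ ξ, (cG.ι_sMul ζ ξ).symm⟩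
  denseRange := cG.denseRange

/-- The isometry induced by a 2-arrow. -/
theorem exists_map {X Y : GroupoidCorr H G} {E F : CStarCorr A B} (D : GroupoidCStarCorr X cH cG E)
    (D' : GroupoidCStarCorr Y cH cG F) (α : X ⟶ Y) :
    ∃ a : E ⟶ F, ∀ ξ, CStarCorr.Hom.toFun a (D.ι ξ) = D'.ι (GroupoidCorr.Hom.extend α ξ) := by
  refine CStarCorr.exists_hom D.denseRange (D'.ι.comp (GroupoidCorr.Hom.extend α)) (fun ξ η => ?_)
    cH.denseRange fun ζ ξ => ⟨X.sLact ζ ξ, D.lact_eq ζ ξ, ?_⟩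
  · rw [LinearMap.comp_apply, LinearMap.comp_apply, D'.inner_eq, D.inner_eq,
      GroupoidCorr.Hom.sInner_extend]
  · rw [LinearMap.comp_apply, LinearMap.comp_apply, D'.lact_eq, GroupoidCorr.Hom.sLact_extend]

/-- The unitary `C*(X) ⊗ C*(Y) ≅ C*(X ∘ Y)`. -/
theorem exists_mu {X : GroupoidCorr H G} {Y : GroupoidCorr G K} {Z : GroupoidCorr H K}
    (c : X.Composite Y Z) {E : CStarCorr A B} {F : CStarCorr B C} {T T' : CStarCorr A C}
    (DX : GroupoidCStarCorr X cH cG E) (DY : GroupoidCStarCorr Y cG cK F)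
    (DZ : GroupoidCStarCorr Z cH cK T') (t : E.TensorProduct F T) :
    ∃ e : T ≅ T', ∀ f₁ f₂, CStarCorr.Hom.toFun e.hom (t.tmul (DX.ι f₁) (DY.ι f₂)) =
      DZ.ι (c.prod f₁ f₂) := by
  obtain ⟨α, hα⟩ := t.exists_hom_of_bilin_dense DX.denseRange DY.denseRange (c.prod.compr₂ DZ.ι)
    (fun f₁ f₂ f₁' f₂' => by
      rw [LinearMap.compr₂_apply, LinearMap.compr₂_apply, DZ.inner_eq, DX.inner_eq, DY.lact_eq,
        DY.inner_eq, c.sInner_prod])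
    cH.denseRange (fun ζ => X.sLact ζ) DX.lact_eq (fun ζ f₁ f₂ => by
      rw [LinearMap.compr₂_apply, LinearMap.compr₂_apply, DZ.lact_eq, c.sLact_prod])
  obtain ⟨e, rfl⟩ := CStarCorr.exists_iso_of_dense α (by
    refine DZ.denseRange.mono ?_
    rintro _ ⟨f, rfl⟩
    suffices h : (⊤ : Submodule ℂ (SFun Z)) ≤
        (LinearMap.range (CStarCorr.Hom.toFun α)).comap DZ.ι from h (Submodule.mem_top (x := f))
    -- Products span `𝔖(Z)`, and each product lies in the range of `α`; hence the range is dense.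
    rw [← eq_top_iff.2 fun f _ => c.mem_span_prod f, Submodule.span_le]
    rintro _ ⟨f₁, f₂, rfl⟩
    exact ⟨_, hα f₁ f₂⟩)
  exact ⟨e, hα⟩

end GroupoidCStarCorr

/-! ### Choice of the completions, strictly compatible with units -/

section Choice

variable {A : EtaleGroupoid.{u} → CStarAlg.{u}} (c : ∀ G, GroupoidCStarAlgebra G (A G))

/-- The chosen completion for the unit arrow is the unit arrow. -/
inductive IsUnitChoice : ∀ {H G : EtaleGroupoid.{u}} (X : GroupoidCorr H G)
    (E : CStarCorr (A H) (A G)), GroupoidCStarCorr X (c H) (c G) E → Prop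
  | one (G : EtaleGroupoid.{u}) :
    IsUnitChoice (GroupoidCorr.one G) (CStarCorr.one (A G)) (GroupoidCStarCorr.one (c G))

/-- `X` is a unit arrow. -/
inductive IsUnitArrow : ∀ {H G : EtaleGroupoid.{u}}, GroupoidCorr H G → Prop
  | one (G : EtaleGroupoid.{u}) : IsUnitArrow (GroupoidCorr.one G)

/-- Strict unitality requires `C*(1_G) = C*(G)` on the nose, so unit arrows are treated apart from
the others. The inductive predicates allow this across dependent types without transports. -/
theorem exists_choice {H G : EtaleGroupoid.{u}} (X : GroupoidCorr H G) :
    ∃ (E : CStarCorr (A H) (A G)) (D : GroupoidCStarCorr X (c H) (c G) E),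
      IsUnitArrow X → IsUnitChoice c X E D := by
  by_cases h : IsUnitArrow X
  · cases h with
    | one => exact ⟨_, _, fun _ => .one _⟩
  · obtain ⟨E, ⟨D⟩⟩ := X.exists_groupoidCStarCorr (c H) (c G)
    exact ⟨E, D, fun h' => absurd h' h⟩

theorem IsUnitChoice.exists_eq {G : EtaleGroupoid.{u}} {E : CStarCorr (A G) (A G)}
    {D : GroupoidCStarCorr (GroupoidCorr.one G) (c G) (c G) E}
    (h : IsUnitChoice c (GroupoidCorr.one G) E D) :
    ∃ h : E = CStarCorr.one (A G), ∀ γ : SFun G.Arr,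
      CStarCorr.Hom.toFun (eqToHom h) (D.ι γ) = (c G).ι γ := by
  cases h
  exact ⟨rfl, fun γ => rfl⟩

end Choice

/-! ### The homomorphism of bicategories -/

/-- Chosen completions for all groupoids, correspondences, 2-arrows and composites. -/
structure CStarChoice (𝔊 : GrBicategory.{u}) (ℭ : CorrBicategory.{u}) where
  A : EtaleGroupoid.{u} → CStarAlg.{u}
  c : ∀ G, GroupoidCStarAlgebra G (A G)
  E : ∀ {H G : EtaleGroupoid.{u}}, GroupoidCorr H G → CStarCorr (A H) (A G)
  D : ∀ {H G : EtaleGroupoid.{u}} (X : GroupoidCorr H G), GroupoidCStarCorr X (c H) (c G) (E X)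
  E_one : ∀ G, E (GroupoidCorr.one G) = CStarCorr.one (A G)
  eqToHom_ι : ∀ G (γ : SFun G.Arr),
    CStarCorr.Hom.toFun (eqToHom (E_one G)) ((D (GroupoidCorr.one G)).ι γ) = (c G).ι γ
  map : ∀ {H G : EtaleGroupoid.{u}} {X Y : GroupoidCorr H G}, (X ⟶ Y) → (E X ⟶ E Y)
  map_ι : ∀ {H G : EtaleGroupoid.{u}} {X Y : GroupoidCorr H G} (α : X ⟶ Y) (ξ : SFun X),
    CStarCorr.Hom.toFun (map α) ((D X).ι ξ) = (D Y).ι (GroupoidCorr.Hom.extend α ξ)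
  mu : ∀ {H G K : EtaleGroupoid.{u}} (X : GroupoidCorr H G) (Y : GroupoidCorr G K),
    ℭ.comp (E Y) (E X) ≅ E (𝔊.comp Y X)
  mu_ι : ∀ {H G K : EtaleGroupoid.{u}} (X : GroupoidCorr H G) (Y : GroupoidCorr G K)
    (f₁ : SFun X) (f₂ : SFun Y),
    CStarCorr.Hom.toFun (mu X Y).hom ((ℭ.tensor (E X) (E Y)).tmul ((D X).ι f₁) ((D Y).ι f₂)) =
      (D (𝔊.comp Y X)).ι ((𝔊.composite X Y).prod f₁ f₂)

theorem nonempty_cStarChoice (𝔊 : GrBicategory.{u}) (ℭ : CorrBicategory.{u}) :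
    Nonempty (CStarChoice 𝔊 ℭ) := by
  choose A hA using fun G : EtaleGroupoid.{u} => G.exists_groupoidCStarAlgebra
  let c := fun G => (hA G).some
  choose E D hD using fun (H G : EtaleGroupoid.{u}) (X : GroupoidCorr H G) => exists_choice c X
  choose h1 h2 using fun G => (hD G G _ (.one G)).exists_eq
  choose m hm using fun (H G : EtaleGroupoid.{u}) (X Y : GroupoidCorr H G) (α : X ⟶ Y) =>
    (D H G X).exists_map (D H G Y) α
  choose μ hμ using fun (H G K : EtaleGroupoid.{u}) (X : GroupoidCorr H G)
    (Y : GroupoidCorr G K) => GroupoidCStarCorr.exists_mu (𝔊.composite X Y) (D H G X) (D G K Y)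
      (D H K (𝔊.comp Y X)) (ℭ.tensor (E H G X) (E G K Y))
  exact ⟨{
    A := A
    c := c
    E := fun X => E _ _ X
    D := fun X => D _ _ X
    E_one := h1
    eqToHom_ι := h2
    map := fun α => m _ _ _ _ α
    map_ι := fun α => hm _ _ _ _ α
    mu := fun X Y => μ _ _ _ X Y
    mu_ι := fun X Y => hμ _ _ _ X Y }⟩

/-- The unit constraint of a strictly unital homomorphism enters the unitor axioms as a transport;
this computes it on elementary tensors. -/
theorem CorrBicategory.eqToHom_whiskerRight (ℭ : CorrBicategory.{u}) {A B C : CStarAlg.{u}}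
    (E : CStarCorr A B) {F F' : CStarCorr B C} (h : F = F') (h' : ℭ.comp F E = ℭ.comp F' E) (x : E)
    (y : F) : CStarCorr.Hom.toFun (eqToHom h') ((ℭ.tensor E F).tmul x y) =
      (ℭ.tensor E F').tmul x (CStarCorr.Hom.toFun (eqToHom h) y) := by
  subst h
  rfl

theorem CorrBicategory.eqToHom_whiskerLeft (ℭ : CorrBicategory.{u}) {A B C : CStarAlg.{u}}
    {E E' : CStarCorr A B} (F : CStarCorr B C) (h : E = E') (h' : ℭ.comp F E = ℭ.comp F E') (x : E)
    (y : F) : CStarCorr.Hom.toFun (eqToHom h') ((ℭ.tensor E F).tmul x y) =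
      (ℭ.tensor E' F).tmul (CStarCorr.Hom.toFun (eqToHom h) x) y := by
  subst h
  rfl

namespace CStarChoice

variable {𝔊 : GrBicategory.{u}} {ℭ : CorrBicategory.{u}} (S : CStarChoice 𝔊 ℭ)

theorem map_id {H G : EtaleGroupoid.{u}} (X : GroupoidCorr H G) : S.map (𝟙 X) = 𝟙 (S.E X) := by
  refine CStarCorr.Hom.ext_dense (S.D X).denseRange fun ξ => ?_
  rw [S.map_ι, CStarCorr.id_toFun]
  congr 1
  refine Subtype.ext ?_
  exact funext fun x => Function.injective_id.extend_apply (ξ : X → ℂ) 0 x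

theorem map_comp {H G : EtaleGroupoid.{u}} {X Y Z : GroupoidCorr H G} (α : X ⟶ Y) (β : Y ⟶ Z) :
    S.map (α ≫ β) = S.map α ≫ S.map β := by
  refine CStarCorr.Hom.ext_dense (S.D X).denseRange fun ξ => ?_
  rw [S.map_ι, CStarCorr.comp_toFun, S.map_ι, S.map_ι]
  congr 1
  refine Subtype.ext (funext fun z => ?_)
  have hα := GroupoidCorr.Hom.injective α
  have hβ := GroupoidCorr.Hom.injective β
  change Function.extend (GroupoidCorr.Hom.toFun β ∘ GroupoidCorr.Hom.toFun α) (ξ : X → ℂ) 0 z =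
    Function.extend (GroupoidCorr.Hom.toFun β)
      (Function.extend (GroupoidCorr.Hom.toFun α) (ξ : X → ℂ) 0) 0 z
  by_cases hz : ∃ y, GroupoidCorr.Hom.toFun β y = z
  · obtain ⟨y, rfl⟩ := hz
    rw [hβ.extend_apply]
    by_cases hy : ∃ x, GroupoidCorr.Hom.toFun α x = y
    · obtain ⟨x, rfl⟩ := hy
      rw [hα.extend_apply]
      exact (hβ.comp hα).extend_apply _ _ x
    · rw [Function.extend_apply' _ _ _ hy, Function.extend_apply']
      · rfl
      · exact fun ⟨x, hx⟩ => hy ⟨x, hβ hx⟩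
  · rw [Function.extend_apply' _ _ _ hz, Function.extend_apply']
    exact fun ⟨x, hx⟩ => hz ⟨_, hx⟩

/-- Naturality of `μ`: on tensors of functions, extension by zero commutes with the product. The
laws below follow the same pattern. -/
theorem whiskerLeft {H G K : EtaleGroupoid.{u}} (Y : GroupoidCorr G K) {X₁ X₂ : GroupoidCorr H G}
    (α : X₁ ⟶ X₂) : S.map (𝔊.whiskerLeft Y α) =
      (S.mu X₁ Y).inv ≫ ℭ.whiskerLeft (S.E Y) (S.map α) ≫ (S.mu X₂ Y).hom := by
  rw [Iso.eq_inv_comp]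
  refine (ℭ.tensor _ _).hom_ext_dense (S.D X₁).denseRange (S.D Y).denseRange fun f₁ f₂ => ?_
  rw [CStarCorr.comp_toFun, CStarCorr.comp_toFun, S.mu_ι, S.map_ι, ℭ.whiskerLeft_tmul, S.map_ι,
    S.mu_ι]
  congr 1
  exact GroupoidCorr.Composite.prod_extend_left _ _ _ _ (𝔊.whiskerLeft_cls Y α) f₁ f₂

theorem whiskerRight {H G K : EtaleGroupoid.{u}} {Y₁ Y₂ : GroupoidCorr G K} (β : Y₁ ⟶ Y₂)
    (X : GroupoidCorr H G) : S.map (𝔊.whiskerRight β X) =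
      (S.mu X Y₁).inv ≫ ℭ.whiskerRight (S.map β) (S.E X) ≫ (S.mu X Y₂).hom := by
  rw [Iso.eq_inv_comp]
  refine (ℭ.tensor _ _).hom_ext_dense (S.D X).denseRange (S.D Y₁).denseRange fun f₁ f₂ => ?_
  rw [CStarCorr.comp_toFun, CStarCorr.comp_toFun, S.mu_ι, S.map_ι, ℭ.whiskerRight_tmul, S.map_ι,
    S.mu_ι]
  congr 1
  exact GroupoidCorr.Composite.prod_extend_right _ _ _ _ (𝔊.whiskerRight_cls β X) f₁ f₂

theorem leftUnitor {H G : EtaleGroupoid.{u}} (X : GroupoidCorr H G)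
    (h : ℭ.comp (S.E (GroupoidCorr.one G)) (S.E X) = ℭ.comp (CStarCorr.one (S.A G)) (S.E X)) :
    S.map (𝔊.leftUnitor X).hom =
      (S.mu X (GroupoidCorr.one G)).inv ≫ eqToHom h ≫ (ℭ.leftUnitor (S.E X)).hom := by
  rw [Iso.eq_inv_comp]
  refine (ℭ.tensor _ _).hom_ext_dense (S.D X).denseRange (S.D _).denseRange
    fun f₁ f₂ => ?_
  rw [CStarCorr.comp_toFun, CStarCorr.comp_toFun, S.mu_ι, S.map_ι,
    ℭ.eqToHom_whiskerRight _ (S.E_one G)]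
  refine Eq.trans ?_ (congrArg (fun b => CStarCorr.Hom.toFun (ℭ.leftUnitor (S.E X)).hom
    ((ℭ.tensor (S.E X) _).tmul ((S.D X).ι f₁) b)) (S.eqToHom_ι G f₂)).symm
  refine Eq.trans ?_ ((ℭ.leftUnitor_tmul (S.E X) ((S.D X).ι f₁) ((S.c G).ι f₂)).trans
    ((S.D X).ract_eq f₁ f₂)).symm
  exact congrArg (S.D X).ι (GroupoidCorr.Composite.extend_prod_eq
    (𝔊.composite X (GroupoidCorr.one G)) X.rightUnitComposite (𝔊.leftUnitor X).hom
    (𝔊.leftUnitor_cls X) f₁ f₂)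

theorem rightUnitor {H G : EtaleGroupoid.{u}} (X : GroupoidCorr H G)
    (h : ℭ.comp (S.E X) (S.E (GroupoidCorr.one H)) = ℭ.comp (S.E X) (CStarCorr.one (S.A H))) :
    S.map (𝔊.rightUnitor X).hom =
      (S.mu (GroupoidCorr.one H) X).inv ≫ eqToHom h ≫ (ℭ.rightUnitor (S.E X)).hom := by
  rw [Iso.eq_inv_comp]
  refine (ℭ.tensor _ _).hom_ext_dense (S.D _).denseRange (S.D X).denseRange
    fun f₁ f₂ => ?_
  rw [CStarCorr.comp_toFun, CStarCorr.comp_toFun, S.mu_ι, S.map_ι,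
    ℭ.eqToHom_whiskerLeft _ (S.E_one H)]
  refine Eq.trans ?_ (congrArg (fun b => CStarCorr.Hom.toFun (ℭ.rightUnitor (S.E X)).hom
    ((ℭ.tensor _ (S.E X)).tmul b ((S.D X).ι f₂))) (S.eqToHom_ι H f₁)).symm
  refine Eq.trans ?_ ((ℭ.rightUnitor_tmul (S.E X) ((S.c H).ι f₁) ((S.D X).ι f₂)).trans
    ((S.D X).lact_eq f₁ f₂)).symm
  exact congrArg (S.D X).ι (GroupoidCorr.Composite.extend_prod_eq
    (𝔊.composite (GroupoidCorr.one H) X) X.leftUnitComposite (𝔊.rightUnitor X).hom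
    (𝔊.rightUnitor_cls X) f₁ f₂)

theorem associator {G₁ G₂ G₃ G₄ : EtaleGroupoid.{u}} (X₃ : GroupoidCorr G₃ G₄)
    (X₂ : GroupoidCorr G₂ G₃) (X₁ : GroupoidCorr G₁ G₂) :
    S.map (𝔊.associator X₃ X₂ X₁).hom =
      (S.mu X₁ (𝔊.comp X₃ X₂)).inv ≫ ℭ.whiskerRight (S.mu X₂ X₃).inv (S.E X₁) ≫
        (ℭ.associator (S.E X₃) (S.E X₂) (S.E X₁)).hom ≫
          ℭ.whiskerLeft (S.E X₃) (S.mu X₁ X₂).hom ≫ (S.mu (𝔊.comp X₂ X₁) X₃).hom := by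
  rw [Iso.eq_inv_comp]
  refine (ℭ.tensor _ _).hom_ext_dense (S.D X₁).denseRange (S.D _).denseRange fun f₁ φ => ?_
  -- The inverse of `μ` is explicit only on products, so the function `φ` on the composite is first
  -- reduced to `f₂ · f₃`.
  have hφ := (𝔊.composite X₂ X₃).mem_span_prod φ
  induction hφ using Submodule.span_induction with
  | zero => simp only [map_zero]
  | add x y _ _ hx hy => simp only [map_add, hx, hy]
  | smul a x _ hx => simp only [map_smul, hx]
  | mem x hx =>
    obtain ⟨f₂, f₃, rfl⟩ := hx
    have hinv : CStarCorr.Hom.toFun (S.mu X₂ X₃).inv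
        ((S.D (𝔊.comp X₃ X₂)).ι ((𝔊.composite X₂ X₃).prod f₂ f₃)) =
        (ℭ.tensor _ _).tmul ((S.D X₂).ι f₂) ((S.D X₃).ι f₃) := by
      rw [← S.mu_ι, CStarCorr.inv_hom_toFun]
    simp only [CStarCorr.comp_toFun]
    rw [S.mu_ι, S.map_ι, ℭ.whiskerRight_tmul, hinv, ℭ.associator_tmul, ℭ.whiskerLeft_tmul, S.mu_ι,
      S.mu_ι]
    congr 1
    exact GroupoidCorr.Composite.extend_prod_prod _ _ _ _ (𝔊.associator X₃ X₂ X₁)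
      (𝔊.associator_cls X₁ X₂ X₃) f₁ f₂ f₃

/-- The groupoid C*-algebra construction as a strictly unital homomorphism of bicategories. -/
noncomputable def functorCore : StrictlyUnitaryPseudofunctorCore 𝔊.Ob ℭ.Ob where
  obj G := S.A G
  map X := S.E X
  map_id G := S.E_one G
  map₂ α := S.map α
  map₂_id X := S.map_id X
  map₂_comp α β := S.map_comp α β
  mapComp Y X := (S.mu X Y).symm
  map₂_whisker_left Y _ _ α := S.whiskerLeft Y α
  map₂_whisker_right β X := S.whiskerRight β X
  map₂_left_unitor X := S.leftUnitor X _
  map₂_right_unitor X := S.rightUnitor X _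
  map₂_associator X₃ X₂ X₁ := S.associator X₃ X₂ X₁

end CStarChoice

theorem exists_homomorphism (𝔊 : GrBicategory.{u}) (ℭ : CorrBicategory.{u}) :
    ∃ (F : StrictlyUnitaryPseudofunctor 𝔊.Ob ℭ.Ob)
      (cstar : ∀ G : 𝔊.Ob,
        GroupoidCStarAlgebra (GrBicategory.gpd G) (CorrBicategory.alg (F.obj G)))
      (cstarCorr : ∀ {G H : 𝔊.Ob} (X : G ⟶ H),
        GroupoidCStarCorr (GrBicategory.corr X) (cstar H) (cstar G)
          (CorrBicategory.corr (F.map X))),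
      (∀ {G H : 𝔊.Ob} {X Y : G ⟶ H} (α : X ⟶ Y) (ξ : SFun (GrBicategory.corr X)),
        ∃ φ : SFun (GrBicategory.corr Y),
          (φ : GrBicategory.corr Y → ℂ) =
              Function.extend (GrBicategory.fn α) (ξ : GrBicategory.corr X → ℂ) 0 ∧
            CorrBicategory.fn (F.map₂ α) ((cstarCorr X).ι ξ) = (cstarCorr Y).ι φ) ∧
      (∀ (G : 𝔊.Ob) (ξ : SFun (GrBicategory.gpd G).Arr),
        CorrBicategory.fn (F.mapId G).hom ((cstarCorr (𝟙 G)).ι ξ) = (cstar G).ι ξ) ∧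
      (∀ {K G H : 𝔊.Ob} (Y : K ⟶ G) (X : G ⟶ H) (f₁ : SFun (GrBicategory.corr X))
        (f₂ : SFun (GrBicategory.corr Y)),
        ∃ φ : SFun (GrBicategory.corr (Y ≫ X)),
          (∀ x y e, (φ : GrBicategory.corr (Y ≫ X) → ℂ)
              ((𝔊.composite (GrBicategory.corr X) (GrBicategory.corr Y)).cls x y e) =
            (GrBicategory.corr X).pairing (GrBicategory.corr Y) f₁ f₂ x y e) ∧
          CorrBicategory.fn (F.mapComp Y X).inv
              ((ℭ.tensor (CorrBicategory.corr (F.map X)) (CorrBicategory.corr (F.map Y))).tmul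
                ((cstarCorr X).ι f₁) ((cstarCorr Y).ι f₂)) =
            (cstarCorr (Y ≫ X)).ι φ) := by
  obtain ⟨S⟩ := nonempty_cStarChoice 𝔊 ℭ
  exact ⟨StrictlyUnitaryPseudofunctor.mk' S.functorCore, S.c, fun X => S.D X,
    fun α ξ => ⟨_, GroupoidCorr.Hom.coe_extend α ξ, S.map_ι α ξ⟩, S.eqToHom_ι,
    fun Y X f₁ f₂ => ⟨(𝔊.composite X Y).prod f₁ f₂,
      fun x y e => ((𝔊.composite X Y).pairing_eq_relProd f₁ f₂ x y e).symm, S.mu_ι X Y f₁ f₂⟩⟩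

/-! ### Open quotient maps -/

theorem IsOpenQuotientMap.subtypeMap {A B : Type*} [TopologicalSpace A] [TopologicalSpace B]
    {q : A → B} (hq : IsOpenQuotientMap q) {P : A → Prop} {P' : B → Prop}
    (h : ∀ a, P a ↔ P' (q a)) :
    IsOpenQuotientMap fun a : {a // P a} => (⟨q a.1, (h a.1).1 a.2⟩ : {b // P' b}) where
  surjective := by
    rintro ⟨b, hb⟩
    obtain ⟨a, rfl⟩ := hq.surjective b
    exact ⟨⟨a, (h a).2 hb⟩, rfl⟩
  continuous := (hq.continuous.comp continuous_subtype_val).subtype_mk _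
  isOpenMap := by
    rintro _ ⟨O, hO, rfl⟩
    refine ⟨q '' O, hq.isOpenMap O hO, ?_⟩
    ext ⟨b, hb⟩
    constructor
    · rintro ⟨a, ha, rfl⟩
      exact ⟨⟨a, (h a).2 hb⟩, ha, rfl⟩
    · rintro ⟨⟨a, ha⟩, hO, he⟩
      exact ⟨a, hO, congrArg Subtype.val he⟩

theorem IsLocalHomeomorph.of_comp_isOpenQuotientMap {A B C : Type*} [TopologicalSpace A]
    [TopologicalSpace B] [TopologicalSpace C] {q : A → B} {f : B → C} (hq : IsOpenQuotientMap q)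
    (h : IsLocalHomeomorph (f ∘ q)) : IsLocalHomeomorph f := by
  refine .of_isOpenMap (hq.continuous_comp_iff.1 h.continuous)
    (hq.isOpenMap_iff.2 h.isOpenMap) fun b => ?_
  obtain ⟨a, rfl⟩ := hq.surjective b
  obtain ⟨U, hU, ha, hi⟩ := h.exists_isOpen_injOn a
  refine ⟨q '' U, hq.isOpenMap U hU, ⟨a, ha, rfl⟩, ?_⟩
  rintro _ ⟨x, hx, rfl⟩ _ ⟨y, hy, rfl⟩ hxy
  exact congrArg q (hi hx hy hxy)

/-- Properness descends along open quotient maps of the target. -/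
theorem IsProperMap.of_fiberProd_isOpenQuotientMap {A B R : Type*} [TopologicalSpace A]
    [TopologicalSpace B] [TopologicalSpace R] {q : A → B} {f : R → B} (hq : IsOpenQuotientMap q)
    (hf : Continuous f) (h : IsProperMap fun p : {p : R × A // f p.1 = q p.2} => p.1.2) :
    IsProperMap f := by
  refine isProperMap_iff_ultrafilter.2 ⟨hf, fun 𝒰 b hb => ?_⟩
  obtain ⟨a, rfl⟩ := hq.surjective b
  -- A lift of `𝒰` to the fibre product that converges to `a` in the second coordinate. It is proper
  -- as a filter because `q` is open, so that `q`-images of neighbourhoods of `a` meet the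
  -- `f`-images of members of `𝒰`.
  let F : Filter {p : R × A // f p.1 = q p.2} :=
    Filter.comap (fun p => p.1.1) (𝒰 : Filter R) ⊓ Filter.comap (fun p => p.1.2) (𝓝 a)
  have hF : F.NeBot := by
    rw [Filter.inf_neBot_iff]
    rintro s ⟨U, hU, hs⟩ t ⟨N, hN, ht⟩
    have hN' : q '' N ∈ 𝓝 (q a) := hq.isOpenMap.image_mem_nhds hN
    obtain ⟨r, hr, a', ha', hra⟩ := 𝒰.nonempty_of_mem (Filter.inter_mem hU (hb hN'))
    exact ⟨⟨(r, a'), hra.symm⟩, hs hr, ht ha'⟩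
  have hle := Ultrafilter.of_le F
  obtain ⟨t, ht, hlim⟩ := (isProperMap_iff_ultrafilter.1 h).2 (𝒰 := Ultrafilter.of F) (y := a)
    (Filter.tendsto_iff_comap.2 (hle.trans inf_le_right))
  refine ⟨t.1.1, t.2.trans (congrArg q ht), ?_⟩
  have h1 : (Ultrafilter.of F).map (fun p => p.1.1) = 𝒰 := by
    refine Ultrafilter.coe_le_coe.1 ?_
    rw [Ultrafilter.coe_map]
    exact Filter.tendsto_iff_comap.2 (hle.trans inf_le_left)
  rw [← h1, Ultrafilter.coe_map]
  exact (continuous_fst.comp continuous_subtype_val).continuousAt.mono_left hlim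

/-! ### Orbit spaces -/

namespace GroupoidCorr

variable {H G K : EtaleGroupoid.{u}} (X : GroupoidCorr H G) (Y : GroupoidCorr G K)

/-- The fibre product `X ×_{s,r} Y`. -/
abbrev FiberProd : Type u := {p : X × Y // X.s p.1 = Y.r p.2}

/-- The orbit relation of the diagonal action on `X ×_{s,r} Y`. -/
def orbitSetoid : Setoid (X.FiberProd Y) where
  r p p' := ∃ g, X.RMul p'.1.1 g p.1.1 ∧ Y.LMul g p.1.2 p'.1.2
  iseqv :=
    { refl := fun p => ⟨_, rmul_unit _, p.2 ▸ lmul_unit _⟩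
      symm := fun ⟨g, h₁, h₂⟩ => ⟨G.inv g, h₁.inv, h₂.inv⟩
      trans := fun {p p' p''} ⟨g, h₁, h₂⟩ ⟨g', h₁', h₂'⟩ => by
        have e : G.s g' = G.r g := h₁'.s_right.symm.trans h₁.s_eq
        exact ⟨G.mul g' g e, h₁'.trans h₁ ⟨e, rfl⟩, h₂.trans h₂' ⟨e, rfl⟩⟩ }

/-- The orbit space `X ∘_G Y`. -/
abbrev OrbitSpace : Type u := Quotient (X.orbitSetoid Y)

variable {X Y}

/-- The orbit map. -/
abbrev orbitMk (p : X.FiberProd Y) : X.OrbitSpace Y := Quotient.mk _ p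

theorem orbitMk_eq_iff {p p' : X.FiberProd Y} :
    orbitMk p = orbitMk p' ↔ ∃ g, X.RMul p'.1.1 g p.1.1 ∧ Y.LMul g p.1.2 p'.1.2 :=
  Quotient.eq (r := X.orbitSetoid Y)

/-- The saturation of an open set is the projection of its preimage under the action map, and that
projection is open as a base change of the source map of `G`. -/
theorem isOpenQuotientMap_orbitMk : IsOpenQuotientMap (orbitMk (X := X) (Y := Y)) := by
  refine ⟨Quotient.mk_surjective, continuous_quotient_mk', fun O hO => ?_⟩
  rw [← (isQuotientMap_quotient_mk' (s := X.orbitSetoid Y)).isOpen_preimage]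
  let A := {a : G.Arr × X.FiberProd Y // G.s a.1 = Y.r a.2.1.2}
  have hr : Continuous fun p : X.FiberProd Y => Y.r p.1.2 :=
    Y.left.continuous_r.comp (by fun_prop)
  have hX : ∀ a : A, X.s a.1.2.1.1 = G.r (G.inv a.1.1) := fun a =>
    a.1.2.2.trans (a.2.symm.trans (G.r_inv _).symm)
  let m : A → X.FiberProd Y := fun a =>
    ⟨(X.ract a.1.2.1.1 (G.inv a.1.1) (hX a), Y.lact a.1.1 a.1.2.1.2 a.2),
      ((X.right.s_act _ _ _).trans (G.s_inv _)).trans (Y.left.r_act _ _ _).symm⟩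
  have hm : Continuous m := by
    refine (Continuous.prodMk ?_ ?_).subtype_mk _
    · exact X.right.continuous_act.comp (Continuous.subtype_mk ((by fun_prop : Continuous
        fun a : A => a.1.2.1.1).prodMk (G.continuous_inv.comp (by fun_prop))) hX)
    · exact Y.left.continuous_act.comp (Continuous.subtype_mk ((by fun_prop : Continuous
        fun a : A => a.1.1).prodMk (by fun_prop)) fun a => a.2)
  convert isOpenMap_snd_fiberProd G.isLocalHomeomorph_s.isOpenMap hr (m ⁻¹' O) (hO.preimage hm)
    using 1
  ext p
  constructor
  · rintro ⟨p', hp', h⟩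
    obtain ⟨g, h₁, h₂⟩ := orbitMk_eq_iff.1 h.symm
    refine ⟨⟨(g, p), h₂.1⟩, ?_, rfl⟩
    have : m ⟨(g, p), h₂.1⟩ = p' := Subtype.ext (Prod.ext h₁.inv.2 h₂.2)
    rw [Set.mem_preimage, this]
    exact hp'
  · rintro ⟨⟨⟨g, p⟩, e⟩, h, rfl⟩
    refine ⟨_, h, (orbitMk_eq_iff.2 ⟨g, rmul_inv_iff.1 ⟨_, rfl⟩, e, rfl⟩).symm⟩

variable (X Y)

/-- The left anchor map of the orbit space. -/
def orbitR : X.OrbitSpace Y → H.Obj :=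
  Quotient.lift (fun p => X.r p.1.1) fun _ _ ⟨_, h, _⟩ => h.r_eq

/-- The right anchor map of the orbit space. -/
def orbitS : X.OrbitSpace Y → K.Obj :=
  Quotient.lift (fun p => Y.s p.1.2) fun _ _ ⟨_, _, h⟩ => h.s_eq.symm

variable {X Y}

theorem orbitR_out (z : X.OrbitSpace Y) : X.orbitR Y z = X.r z.out.1.1 :=
  congrArg (X.orbitR Y) z.out_eq.symm

theorem orbitS_out (z : X.OrbitSpace Y) : X.orbitS Y z = Y.s z.out.1.2 :=
  congrArg (X.orbitS Y) z.out_eq.symm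

/-- `h · [x, y] = [h · x, y]`. -/
noncomputable def orbitLact (h : H.Arr) (z : X.OrbitSpace Y) (e : H.s h = X.orbitR Y z) :
    X.OrbitSpace Y :=
  orbitMk ⟨(X.lact h z.out.1.1 (e.trans (orbitR_out z)), z.out.1.2),
    (X.s_left_act _ _ _).trans z.out.2⟩

/-- `[x, y] · k = [x, y · k]`. -/
noncomputable def orbitRact (z : X.OrbitSpace Y) (k : K.Arr) (e : X.orbitS Y z = K.r k) :
    X.OrbitSpace Y :=
  orbitMk ⟨(z.out.1.1, Y.ract z.out.1.2 k ((orbitS_out z).symm.trans e)),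
    z.out.2.trans (Y.r_right_act _ _ _).symm⟩

/-- Independence of the representative chosen by `Quotient.out`, which follows from commutation of
the actions on `X`. -/
theorem orbitLact_eq {h : H.Arr} {z : X.OrbitSpace Y} {p : X.FiberProd Y} (hz : orbitMk p = z)
    (e : H.s h = X.orbitR Y z) (e' : H.s h = X.r p.1.1) :
    orbitLact h z e =
      orbitMk ⟨(X.lact h p.1.1 e', p.1.2), (X.s_left_act _ _ _).trans p.2⟩ := by
  subst hz
  obtain ⟨g, h₁, h₂⟩ := orbitMk_eq_iff.1 (Quotient.out_eq (orbitMk p))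
  refine orbitMk_eq_iff.2 ⟨g, ?_, h₂⟩
  obtain ⟨_, ⟨_, rfl⟩, h₄⟩ := lmul_rmul_comm.2 ⟨_, h₁, e'.trans h₁.r_eq.symm, rfl⟩
  exact h₄

theorem orbitRact_eq {k : K.Arr} {z : X.OrbitSpace Y} {p : X.FiberProd Y} (hz : orbitMk p = z)
    (e : X.orbitS Y z = K.r k) (e' : Y.s p.1.2 = K.r k) :
    orbitRact z k e =
      orbitMk ⟨(p.1.1, Y.ract p.1.2 k e'), p.2.trans (Y.r_right_act _ _ _).symm⟩ := by
  subst hz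
  obtain ⟨g, h₁, h₂⟩ := orbitMk_eq_iff.1 (Quotient.out_eq (orbitMk p))
  refine orbitMk_eq_iff.2 ⟨g, h₁, ?_⟩
  obtain ⟨_, ⟨_, rfl⟩, h₄⟩ := lmul_rmul_comm.1 ⟨_, h₂, e', rfl⟩
  exact h₄

variable (X Y)

/-- The left action on the orbit space. -/
noncomputable def orbitLeft : LeftAction H (X.OrbitSpace Y) where
  r := X.orbitR Y
  act := orbitLact
  continuous_r := isOpenQuotientMap_orbitMk.continuous_comp_iff.1
    (X.left.continuous_r.comp (by fun_prop))
  continuous_act := by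
    have hq := (IsOpenQuotientMap.id (X := H.Arr)).prodMap
      (isOpenQuotientMap_orbitMk (X := X) (Y := Y)) |>.subtypeMap
        (P := fun a : H.Arr × X.FiberProd Y => H.s a.1 = X.r a.2.1.1)
        (P' := fun a : H.Arr × X.OrbitSpace Y => H.s a.1 = X.orbitR Y a.2) fun a => Iff.rfl
    refine hq.continuous_comp_iff.1 ?_
    refine (congrArg Continuous (funext fun a : {a : H.Arr × X.FiberProd Y //
      H.s a.1 = X.r a.2.1.1} => orbitLact_eq rfl a.2 a.2)).mpr ?_
    refine isOpenQuotientMap_orbitMk.continuous.comp ((Continuous.prodMk ?_ ?_).subtype_mk _)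
    · exact X.left.continuous_act.comp (Continuous.subtype_mk ((by fun_prop : Continuous
        fun a : {a : H.Arr × X.FiberProd Y // H.s a.1 = X.r a.2.1.1} => a.1.1).prodMk
          (by fun_prop)) fun a => a.2)
    · fun_prop
  r_act h z e := X.left.r_act _ _ _
  act_act h₁ h₂ z e₁ e₂ := by
    obtain ⟨p, rfl⟩ := Quotient.exists_rep z
    have e₃ : H.s h₂ = X.r p.1.1 := e₂
    rw [orbitLact_eq (orbitLact_eq rfl e₂ e₃).symm _ (e₁.trans (X.left.r_act _ _ _).symm),
      orbitLact_eq (p := p) rfl _ ((H.s_mul _ _ _).trans e₃)]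
    exact congrArg orbitMk (Subtype.ext (Prod.ext (X.left.act_act _ _ _ e₁ e₃) rfl))
  unit_act z := by
    obtain ⟨p, rfl⟩ := Quotient.exists_rep z
    refine (orbitLact_eq (p := p) rfl _ (H.s_unit _)).trans ?_
    exact congrArg orbitMk (Subtype.ext (Prod.ext (X.left.unit_act _) rfl))

/-- The right action on the orbit space. -/
noncomputable def orbitRight : RightAction K (X.OrbitSpace Y) where
  s := X.orbitS Y
  act := orbitRact
  continuous_s := isOpenQuotientMap_orbitMk.continuous_comp_iff.1
    (Y.right.continuous_s.comp (by fun_prop))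
  continuous_act := by
    have hq := (isOpenQuotientMap_orbitMk (X := X) (Y := Y)).prodMap
      (IsOpenQuotientMap.id (X := K.Arr)) |>.subtypeMap
        (P := fun a : X.FiberProd Y × K.Arr => Y.s a.1.1.2 = K.r a.2)
        (P' := fun a : X.OrbitSpace Y × K.Arr => X.orbitS Y a.1 = K.r a.2) fun a => Iff.rfl
    refine hq.continuous_comp_iff.1 ?_
    refine (congrArg Continuous (funext fun a : {a : X.FiberProd Y × K.Arr //
      Y.s a.1.1.2 = K.r a.2} => orbitRact_eq rfl a.2 a.2)).mpr ?_
    refine isOpenQuotientMap_orbitMk.continuous.comp ((Continuous.prodMk ?_ ?_).subtype_mk _)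
    · fun_prop
    · exact Y.right.continuous_act.comp (Continuous.subtype_mk ((by fun_prop : Continuous
        fun a : {a : X.FiberProd Y × K.Arr // Y.s a.1.1.2 = K.r a.2} => a.1.1.1.2).prodMk
          (by fun_prop)) fun a => a.2)
  s_act z k e := Y.right.s_act _ _ _
  act_act z k₁ k₂ e₁ e₂ := by
    obtain ⟨p, rfl⟩ := Quotient.exists_rep z
    have e₃ : Y.s p.1.2 = K.r k₁ := e₁
    rw [orbitRact_eq (orbitRact_eq rfl e₁ e₃).symm _ ((Y.right.s_act _ _ _).trans e₂),
      orbitRact_eq (p := p) rfl _ (e₃.trans (K.r_mul _ _ _).symm)]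
    exact congrArg orbitMk (Subtype.ext (Prod.ext rfl (Y.right.act_act _ _ _ e₃ e₂)))
  act_unit z := by
    obtain ⟨p, rfl⟩ := Quotient.exists_rep z
    refine (orbitRact_eq (p := p) rfl _ (K.r_unit _).symm).trans ?_
    exact congrArg orbitMk (Subtype.ext (Prod.ext rfl (Y.right.act_unit _)))

theorem isFree_orbitRight : (X.orbitRight Y).IsFree := by
  rintro ⟨⟨z, k⟩, e⟩ ⟨⟨z', k'⟩, e'⟩ h
  obtain ⟨h₁, h₂⟩ := Prod.ext_iff.1 h
  obtain rfl : z = z' := h₂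
  obtain ⟨p, rfl⟩ := Quotient.exists_rep z
  obtain ⟨g, h₃, h₄⟩ := orbitMk_eq_iff.1 (((orbitRact_eq (k := k) (p := p) rfl e e).symm.trans
    h₁).trans (orbitRact_eq (k := k') (p := p) rfl e' e'))
  obtain rfl : g = G.unit (Y.r (Y.ract p.1.2 k e)) := (h₃.free (rmul_unit _)).trans
    (congrArg G.unit (p.2.trans (Y.r_right_act p.1.2 k e).symm))
  have hy : Y.ract p.1.2 k e = Y.ract p.1.2 k' e' := (lmul_unit (X := Y) _).eq h₄
  have hk : k = k' := RMul.free (X := Y) ⟨e, hy⟩ ⟨e', rfl⟩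
  subst hk
  rfl

/-- Properness descends along the open orbit map, so one may work with representatives `p', p` of
`[p] k = [p']` that converge along an ultrafilter. Properness for `X` makes the arrows connecting
the first coordinates converge; this makes the translated second coordinates converge, and
properness for `Y` then makes `k` converge. -/
theorem isProper_orbitRight : (X.orbitRight Y).IsProper := by
  have hZ : Continuous (X.orbitRight Y).actionMap :=
    (X.orbitRight Y).continuous_act.prodMk (by fun_prop)
  have hQ := (isOpenQuotientMap_orbitMk (X := X) (Y := Y)).prodMap
    (isOpenQuotientMap_orbitMk (X := X) (Y := Y))
  let T := {t : {a : X.OrbitSpace Y × K.Arr // (X.orbitRight Y).s a.1 = K.r a.2} ×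
    X.FiberProd Y × X.FiberProd Y // (X.orbitRight Y).actionMap t.1 =
      Prod.map orbitMk orbitMk t.2}
  refine .of_fiberProd_isOpenQuotientMap hQ hZ (?_ : IsProperMap fun t : T => t.1.2)
  refine isProperMap_iff_ultrafilter.2 ⟨by fun_prop, ?_⟩
  rintro 𝒰 ⟨p₀', p₀⟩ hlim
  have hT : ∀ t : T, ∃ g y, X.RMul t.1.2.1.1.1 g t.1.2.2.1.1 ∧
      Y.RMul t.1.2.2.1.2 t.1.1.1.2 y ∧ Y.LMul g y t.1.2.1.1.2 := by
    rintro ⟨⟨⟨⟨z, k⟩, e⟩, p', p⟩, h⟩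
    obtain ⟨h₁, h₂⟩ := Prod.ext_iff.1 h
    obtain rfl : z = orbitMk p := h₂
    obtain ⟨g, h₃, h₄⟩ := orbitMk_eq_iff.1
      ((orbitRact_eq (k := k) (p := p) rfl e e).symm.trans h₁)
    exact ⟨g, _, h₃, ⟨e, rfl⟩, h₄⟩
  choose g y hx hk hy using hT
  have hp' : Filter.Tendsto (fun t : T => t.1.2.1.1) 𝒰 (𝓝 p₀'.1) :=
    ((continuous_subtype_val.comp continuous_fst).tendsto _).comp hlim
  have hp : Filter.Tendsto (fun t : T => t.1.2.2.1) 𝒰 (𝓝 p₀.1) :=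
    ((continuous_subtype_val.comp continuous_snd).tendsto _).comp hlim
  obtain ⟨⟨⟨x₁, g₀⟩, e₀⟩, hx₀, hg⟩ := (isProperMap_iff_ultrafilter.1 X.isProper).2
    (𝒰 := 𝒰.map fun t : T => ⟨(t.1.2.1.1.1, g t), (hx t).1⟩) (y := (p₀.1.1, p₀'.1.1)) (by
      refine Filter.tendsto_map'_iff.2 (Filter.Tendsto.prodMk_nhds ?_
        ((continuous_fst.tendsto _).comp hp'))
      exact ((continuous_fst.tendsto _).comp hp).congr fun t => (hx t).2.symm)
  obtain ⟨hx₁, rfl⟩ := Prod.ext_iff.1 hx₀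
  have hx₁ : X.RMul p₀'.1.1 g₀ p₀.1.1 := ⟨e₀, hx₁⟩
  have hg : Filter.Tendsto g 𝒰 (𝓝 g₀) :=
    ((continuous_snd.comp continuous_subtype_val).tendsto _).comp hg
  have hy₀ : G.s (G.inv g₀) = Y.r p₀'.1.2 := (G.s_inv _).trans (hx₁.s_eq.symm.trans p₀'.2)
  have hylim : Filter.Tendsto y 𝒰 (𝓝 (Y.lact (G.inv g₀) p₀'.1.2 hy₀)) := by
    have hm : Filter.Tendsto (fun t : T => (⟨(G.inv (g t), t.1.2.1.1.2), (hy t).inv.1⟩ :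
        {p : G.Arr × Y // G.s p.1 = Y.r p.2})) 𝒰 (𝓝 ⟨(G.inv g₀, p₀'.1.2), hy₀⟩) :=
      tendsto_subtype_rng.2 (((G.continuous_inv.tendsto _).comp hg).prodMk_nhds
        ((continuous_snd.tendsto _).comp hp'))
    exact ((Y.left.continuous_act.tendsto _).comp hm).congr fun t => (hy t).inv.2
  obtain ⟨⟨⟨y₁, k₀⟩, f₀⟩, hk₀, hkl⟩ := (isProperMap_iff_ultrafilter.1 Y.isProper).2
    (𝒰 := 𝒰.map fun t : T => ⟨(t.1.2.2.1.2, t.1.1.1.2), (hk t).1⟩)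
    (y := (Y.lact (G.inv g₀) p₀'.1.2 hy₀, p₀.1.2)) (by
      refine Filter.tendsto_map'_iff.2 (Filter.Tendsto.prodMk_nhds ?_
        ((continuous_snd.tendsto _).comp hp))
      exact hylim.congr fun t => (hk t).2.symm)
  obtain ⟨hk₁, rfl⟩ := Prod.ext_iff.1 hk₀
  have hkl : Filter.Tendsto (fun t : T => t.1.1.1.2) 𝒰 (𝓝 k₀) :=
    ((continuous_snd.comp continuous_subtype_val).tendsto _).comp hkl
  have hz : Filter.Tendsto (fun t : T => t.1.1.1.1) 𝒰 (𝓝 (orbitMk p₀)) := by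
    refine Filter.Tendsto.congr (fun t => (congrArg Prod.snd t.2).symm)
      ((isOpenQuotientMap_orbitMk.continuous.tendsto p₀).comp (tendsto_subtype_rng.2 hp))
  refine ⟨⟨⟨⟨(orbitMk p₀, k₀), f₀⟩, p₀', p₀⟩, Prod.ext ?_ rfl⟩, rfl, ?_⟩
  · refine (orbitRact_eq (k := k₀) (p := p₀) rfl f₀ f₀).trans (orbitMk_eq_iff.2 ⟨g₀, hx₁, ?_⟩)
    exact lmul_inv_iff.1 ⟨hy₀, hk₁.symm⟩
  · refine tendsto_subtype_rng.2 (Filter.Tendsto.prodMk_nhds ?_ hlim)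
    exact tendsto_subtype_rng.2 (hz.prodMk_nhds hkl)

/-- The orbit space `X ∘_G Y` as a correspondence. -/
noncomputable def orbitCorr : GroupoidCorr H K where
  carrier := X.OrbitSpace Y
  left := X.orbitLeft Y
  right := X.orbitRight Y
  s_left_act h z e := (orbitS_out z).symm
  r_right_act z k e := (orbitR_out z).symm
  act_comm h z k e e' := by
    obtain ⟨p, rfl⟩ := Quotient.exists_rep z
    have e₁ : H.s h = X.r p.1.1 := e
    have e₂ : Y.s p.1.2 = K.r k := e'
    refine (orbitRact_eq (orbitLact_eq (p := p) rfl e e₁).symm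
      ((orbitS_out (orbitMk p)).symm.trans e') e₂).trans ?_
    exact (orbitLact_eq (orbitRact_eq (p := p) rfl e' e₂).symm
      (e.trans (orbitR_out (orbitMk p))) e₁).symm
  isLocalHomeomorph_s := .of_comp_isOpenQuotientMap isOpenQuotientMap_orbitMk
    (Y.isLocalHomeomorph_s.comp (X.isLocalHomeomorph_s.snd_fiberProd Y.left.continuous_r))
  isFree := X.isFree_orbitRight Y
  isProper := X.isProper_orbitRight Y

/-- The orbit space is the composite. -/
noncomputable def orbitComposite : X.Composite Y (X.orbitCorr Y) where
  cls x y e := orbitMk ⟨(x, y), e⟩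
  isQuotientMap_cls := (isOpenQuotientMap_orbitMk (X := X) (Y := Y)).isQuotientMap
  cls_eq_cls_iff x y e x' y' e' := by
    refine orbitMk_eq_iff.trans ⟨?_, ?_⟩
    · rintro ⟨g, h₁, h₂⟩
      exact ⟨g, h₂.1, h₁.inv.2, h₂.2⟩
    · rintro ⟨g, eg, h₁, h₂⟩
      exact ⟨g, rmul_inv_iff.1 ⟨_, h₁⟩, eg, h₂⟩
  r_cls x y e := rfl
  s_cls x y e := rfl
  lact_cls h x y e eh := orbitLact_eq (p := ⟨(x, y), e⟩) rfl eh eh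
  ract_cls x y k e ek := orbitRact_eq (p := ⟨(x, y), e⟩) rfl ek ek

end GroupoidCorr

/-! ### Maps out of quotients -/

namespace GroupoidCorr

variable {H G K : EtaleGroupoid.{u}}

/-- The equivalence `hk` yields well-definedness in one direction and injectivity in the other.
Equivariance is tested on lifts of translated points. -/
theorem exists_hom_of_isQuotientMap {Z W : GroupoidCorr H G} {T : Type*} [TopologicalSpace T]
    {q : T → Z} {φ : T → W} (hq : IsQuotientMap q) (hφ : Continuous φ)
    (hk : ∀ t t', q t = q t' ↔ φ t = φ t') (hr : ∀ t, W.r (φ t) = Z.r (q t))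
    (hs : ∀ t, W.s (φ t) = Z.s (q t))
    (hl : ∀ h t z, Z.LMul h (q t) z → ∃ t', q t' = z ∧ W.LMul h (φ t) (φ t'))
    (hR : ∀ t g z, Z.RMul (q t) g z → ∃ t', q t' = z ∧ W.RMul (φ t) g (φ t')) :
    ∃ α : Z ⟶ W, ∀ t, Hom.toFun α (q t) = φ t := by
  let f : Z → W := fun z => φ (hq.surjective z).choose
  have hf : ∀ t, f (q t) = φ t := fun t => (hk _ _).1 (hq.surjective (q t)).choose_spec
  refine ⟨({ toFun := f
             continuous_toFun := hq.continuous_iff.2 ((funext hf : f ∘ q = φ) ▸ hφ)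
             injective := fun z z' h => ?_
             r_map := fun z => ?_
             s_map := fun z => ?_
             map_lact := fun h z e => ?_
             map_ract := fun z g e => ?_ } : Hom Z W), hf⟩
  · obtain ⟨t, rfl⟩ := hq.surjective z
    obtain ⟨t', rfl⟩ := hq.surjective z'
    rw [hf, hf] at h
    exact (hk _ _).2 h
  · obtain ⟨t, rfl⟩ := hq.surjective z
    rw [hf, hr]
  · obtain ⟨t, rfl⟩ := hq.surjective z
    rw [hf, hs]
  · obtain ⟨t, rfl⟩ := hq.surjective z
    obtain ⟨t', h₁, h₂⟩ := hl h t _ ⟨e, rfl⟩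
    rw [← hf, ← hf, h₁] at h₂
    exact h₂.2.symm
  · obtain ⟨t, rfl⟩ := hq.surjective z
    obtain ⟨t', h₁, h₂⟩ := hR t g _ ⟨e, rfl⟩
    rw [← hf, ← hf, h₁] at h₂
    exact h₂.2.symm

theorem hom_ext_of_surjective {Z W : GroupoidCorr H G} {T : Type*} {q : T → Z}
    (hq : Function.Surjective q) {α β : Z ⟶ W}
    (h : ∀ t, Hom.toFun α (q t) = Hom.toFun β (q t)) : α = β := by
  refine Hom.ext (funext fun z => ?_)
  obtain ⟨t, rfl⟩ := hq z
  exact h t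

theorem exists_iso_of_isQuotientMap {Z W : GroupoidCorr H G} {T : Type*} [TopologicalSpace T]
    {q : T → Z} {φ : T → W} (hq : IsQuotientMap q) (hφ : IsQuotientMap φ)
    (hk : ∀ t t', q t = q t' ↔ φ t = φ t') (hr : ∀ t, W.r (φ t) = Z.r (q t))
    (hs : ∀ t, W.s (φ t) = Z.s (q t))
    (hl : ∀ h t z, Z.LMul h (q t) z → ∃ t', q t' = z ∧ W.LMul h (φ t) (φ t'))
    (hR : ∀ t g z, Z.RMul (q t) g z → ∃ t', q t' = z ∧ W.RMul (φ t) g (φ t')) :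
    ∃ α : Z ≅ W, ∀ t, Hom.toFun α.hom (q t) = φ t := by
  obtain ⟨α, hα⟩ := exists_hom_of_isQuotientMap hq hφ.continuous hk hr hs hl hR
  obtain ⟨β, hβ⟩ := exists_hom_of_isQuotientMap hφ hq.continuous (fun t t' => (hk t t').symm)
    (fun t => (hr t).symm) (fun t => (hs t).symm)
    (fun h t w hw => by
      obtain ⟨t', h₁, h₂⟩ := hl h t _ ⟨hw.1.trans (hr t), rfl⟩
      exact ⟨t', h₂.eq hw, h₁ ▸ ⟨hw.1.trans (hr t), rfl⟩⟩)
    (fun t g w hw => by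
      obtain ⟨t', h₁, h₂⟩ := hR t g _ ⟨(hs t).symm.trans hw.1, rfl⟩
      exact ⟨t', h₂.eq hw, h₁ ▸ ⟨(hs t).symm.trans hw.1, rfl⟩⟩)
  refine ⟨⟨α, β, hom_ext_of_surjective hq.surjective fun t => ?_,
    hom_ext_of_surjective hφ.surjective fun t => ?_⟩, hα⟩
  · exact (congrArg (Hom.toFun β) (hα t)).trans (hβ t)
  · exact (congrArg (Hom.toFun α) (hβ t)).trans (hα t)

namespace Composite

variable {X X' : GroupoidCorr H G} {Y Y' : GroupoidCorr G K} {Z Z' W : GroupoidCorr H K}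

theorem hom_ext (c : X.Composite Y Z) {α β : Z ⟶ W}
    (h : ∀ x y e, Hom.toFun α (c.cls x y e) = Hom.toFun β (c.cls x y e)) : α = β :=
  hom_ext_of_surjective c.isQuotientMap_cls.surjective fun p => h p.1.1 p.1.2 p.2

theorem isOpenQuotientMap_cls (c : X.Composite Y Z) :
    IsOpenQuotientMap fun p : {p : X × Y // X.s p.1 = Y.r p.2} => c.cls p.1.1 p.1.2 p.2 :=
  .of_isOpenMap_isQuotientMap c.isLocalHomeomorph_cls.isOpenMap c.isQuotientMap_cls

/-- Composites are unique. -/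
theorem exists_iso (c : X.Composite Y Z) (c' : X.Composite Y Z') :
    ∃ α : Z ≅ Z', ∀ x y e, Hom.toFun α.hom (c.cls x y e) = c'.cls x y e := by
  obtain ⟨α, hα⟩ := exists_iso_of_isQuotientMap c.isQuotientMap_cls c'.isQuotientMap_cls
    (fun p p' => (c.cls_eq_cls_iff _ _ _ _ _ _).trans (c'.cls_eq_cls_iff _ _ _ _ _ _).symm)
    (fun p => (c'.r_cls _ _ _).trans (c.r_cls _ _ _).symm)
    (fun p => (c'.s_cls _ _ _).trans (c.s_cls _ _ _).symm)
    (fun h p z hz => by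
      have e := hz.1.trans (c.r_cls _ _ _)
      exact ⟨⟨(X.lact h p.1.1 e, p.1.2), (X.s_left_act _ _ _).trans p.2⟩,
        (c.lact_cls _ _ _ p.2 e).symm.trans hz.2, _, c'.lact_cls _ _ _ p.2 e⟩)
    (fun p k z hz => by
      have e := (c.s_cls _ _ _).symm.trans hz.1
      exact ⟨⟨(p.1.1, Y.ract p.1.2 k e), p.2.trans (Y.r_right_act _ _ _).symm⟩,
        (c.ract_cls _ _ _ p.2 e).symm.trans hz.2, _, c'.ract_cls _ _ _ p.2 e⟩)
  exact ⟨α, fun x y e => hα ⟨(x, y), e⟩⟩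

/-- The horizontal composite `[x, y] ↦ [α x, β y]`. -/
theorem exists_hcomp (c : X.Composite Y Z) (c' : X'.Composite Y' Z') (α : X ⟶ X') (β : Y ⟶ Y') :
    ∃ γ : Z ⟶ Z', ∀ x y (e : X.s x = Y.r y), Hom.toFun γ (c.cls x y e) =
      c'.cls (Hom.toFun α x) (Hom.toFun β y)
        ((Hom.s_map α x).trans (e.trans (Hom.r_map β y).symm)) := by
  have he : ∀ p : {p : X × Y // X.s p.1 = Y.r p.2},
      X'.s (Hom.toFun α p.1.1) = Y'.r (Hom.toFun β p.1.2) := fun p =>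
    (Hom.s_map α _).trans (p.2.trans (Hom.r_map β _).symm)
  obtain ⟨γ, hγ⟩ := exists_hom_of_isQuotientMap c.isQuotientMap_cls
    (φ := fun p : {p : X × Y // X.s p.1 = Y.r p.2} => c'.cls (Hom.toFun α p.1.1) (Hom.toFun β p.1.2) (he p))
    (c'.isQuotientMap_cls.continuous.comp (Continuous.subtype_mk
      (((Hom.continuous_toFun α).comp (by fun_prop)).prodMk
        ((Hom.continuous_toFun β).comp (by fun_prop))) he))
    (fun p p' => by
      rw [c.cls_eq_cls_iff, c'.cls_eq_cls_iff]
      constructor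
      · rintro ⟨g, eg, h₁, h₂⟩
        refine ⟨g, eg.trans (Hom.r_map β _).symm, ?_, ?_⟩
        · rw [← h₁, Hom.map_ract]
        · rw [← h₂, Hom.map_lact]
      · rintro ⟨g, eg, h₁, h₂⟩
        refine ⟨g, eg.trans (Hom.r_map β _), Hom.injective α ?_, Hom.injective β ?_⟩
        · rw [← h₁, Hom.map_ract]
        · rw [← h₂, Hom.map_lact])
    (fun p => (c'.r_cls _ _ _).trans ((Hom.r_map α _).trans (c.r_cls _ _ _).symm))
    (fun p => (c'.s_cls _ _ _).trans ((Hom.s_map β _).trans (c.s_cls _ _ _).symm))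
    (fun h p z hz => by
      have e := hz.1.trans (c.r_cls _ _ _)
      refine ⟨⟨(X.lact h p.1.1 e, p.1.2), (X.s_left_act _ _ _).trans p.2⟩,
        (c.lact_cls _ _ _ p.2 e).symm.trans hz.2, e.trans ((c'.r_cls _ _ _).trans
          (Hom.r_map α _)).symm, ?_⟩
      refine (c'.lact_cls _ _ _ (he p) (e.trans (Hom.r_map α _).symm)).trans ?_
      simp only [Hom.map_lact])
    (fun p k z hz => by
      have e := (c.s_cls _ _ _).symm.trans hz.1
      refine ⟨⟨(p.1.1, Y.ract p.1.2 k e), p.2.trans (Y.r_right_act _ _ _).symm⟩,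
        (c.ract_cls _ _ _ p.2 e).symm.trans hz.2, ((c'.s_cls _ _ _).trans
          (Hom.s_map β _)).trans e, ?_⟩
      refine (c'.ract_cls _ _ _ (he p) ((Hom.s_map β _).trans e)).trans ?_
      simp only [Hom.map_ract])
  exact ⟨γ, fun x y e => hγ ⟨(x, y), e⟩⟩

theorem cls_eq_iff (c : X.Composite Y Z) {x x' : X} {y y' : Y} {e : X.s x = Y.r y}
    {e' : X.s x' = Y.r y'} :
    c.cls x y e = c.cls x' y' e' ↔ ∃ g, X.RMul x g x' ∧ Y.LMul g y' y := by
  rw [c.rel_rel_iff]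
  exact ⟨fun h => ⟨_, ⟨e', rfl⟩, e, h⟩, fun ⟨_, ⟨_, h₁⟩, _, h₂⟩ => h₂.trans h₁.symm⟩

theorem lmul_cls_iff (c : X.Composite Y Z) {h : H.Arr} {x : X} {y : Y} {e : X.s x = Y.r y}
    {z : Z} : Z.LMul h (c.cls x y e) z ↔ ∃ x', X.LMul h x x' ∧ c.Rel x' y z := by
  rw [c.lmul_iff]
  refine ⟨fun h => ⟨_, ⟨e, rfl⟩, h⟩, ?_⟩
  rintro ⟨_, ⟨_, rfl⟩, h⟩
  exact h

theorem rmul_cls_iff (c : X.Composite Y Z) {k : K.Arr} {x : X} {y : Y} {e : X.s x = Y.r y}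
    {z : Z} : Z.RMul (c.cls x y e) k z ↔ ∃ y', Y.RMul y k y' ∧ c.Rel x y' z := by
  rw [← c.rmul_iff]
  refine ⟨fun h => ⟨_, ⟨e, rfl⟩, h⟩, ?_⟩
  rintro ⟨_, ⟨_, rfl⟩, h⟩
  exact h

/-- Both iterated composites are quotients of the triple fibre product by the same equivalence
relation. Openness matters: quotient maps that are not open need not survive products and
restriction to fibre products. -/
theorem exists_associator {G₁ G₂ G₃ G₄ : EtaleGroupoid.{u}} {X₁ : GroupoidCorr G₁ G₂}
    {X₂ : GroupoidCorr G₂ G₃} {X₃ : GroupoidCorr G₃ G₄} {X₁₂ : GroupoidCorr G₁ G₃}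
    {X₂₃ : GroupoidCorr G₂ G₄} {Z Z' : GroupoidCorr G₁ G₄} (c₁₂ : X₁.Composite X₂ X₁₂)
    (c₂₃ : X₂.Composite X₃ X₂₃) (c : X₁.Composite X₂₃ Z) (c' : X₁₂.Composite X₃ Z') :
    ∃ α : Z ≅ Z', ∀ x₁ x₂ x₃ (e : X₁.s x₁ = X₂.r x₂) (e' : X₂.s x₂ = X₃.r x₃),
      Hom.toFun α.hom (c.cls x₁ (c₂₃.cls x₂ x₃ e') (e.trans (c₂₃.r_cls x₂ x₃ e').symm)) =
        c'.cls (c₁₂.cls x₁ x₂ e) x₃ ((c₁₂.s_cls x₁ x₂ e).trans e') := by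
  let T := {t : X₁ × X₂.FiberProd X₃ // X₁.s t.1 = X₂.r t.2.1.1}
  let q : T → Z := fun t => c.cls t.1.1 (c₂₃.cls t.1.2.1.1 t.1.2.1.2 t.1.2.2)
    (t.2.trans (c₂₃.r_cls _ _ _).symm)
  let φ : T → Z' := fun t => c'.cls (c₁₂.cls t.1.1 t.1.2.1.1 t.2) t.1.2.1.2
    ((c₁₂.s_cls _ _ _).trans t.1.2.2)
  have hq : IsOpenQuotientMap q := c.isOpenQuotientMap_cls.comp
    (((IsOpenQuotientMap.id (X := X₁)).prodMap c₂₃.isOpenQuotientMap_cls).subtypeMap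
      (P' := fun p : X₁ × X₂₃ => X₁.s p.1 = X₂₃.r p.2)
      fun t : X₁ × X₂.FiberProd X₃ => by rw [← c₂₃.r_cls _ _ t.2.2]; rfl)
  have hφc : Continuous φ := by
    refine c'.isQuotientMap_cls.continuous.comp (Continuous.subtype_mk (Continuous.prodMk
      (c₁₂.isQuotientMap_cls.continuous.comp (Continuous.subtype_mk
        ((by fun_prop : Continuous fun t : T => t.1.1).prodMk
          (by fun_prop : Continuous fun t : T => t.1.2.1.1)) fun t => t.2))
      (by fun_prop : Continuous fun t : T => t.1.2.1.2))
        fun t => (c₁₂.s_cls _ _ _).trans t.1.2.2)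
  have hφl : IsLocalHomeomorph φ := by
    refine .of_comp ?_ Z'.isLocalHomeomorph_s hφc
    have h : Z'.s ∘ φ = (X₂₃.s ∘ fun p : X₂.FiberProd X₃ => c₂₃.cls p.1.1 p.1.2 p.2) ∘
        fun t : T => t.1.2 :=
      funext fun t => (c'.s_cls _ _ _).trans (c₂₃.s_cls _ _ _).symm
    rw [h]
    exact (X₂₃.isLocalHomeomorph_s.comp c₂₃.isLocalHomeomorph_cls).comp
      (X₁.isLocalHomeomorph_s.snd_fiberProd (X₂.left.continuous_r.comp
        (continuous_fst.comp continuous_subtype_val)))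
  have hφs : Function.Surjective φ := fun z => by
    obtain ⟨x₁₂, x₃, e', rfl⟩ := c'.exists_rel z
    obtain ⟨x₁, x₂, e, rfl⟩ := c₁₂.exists_rel x₁₂
    exact ⟨⟨(x₁, ⟨(x₂, x₃), (c₁₂.s_cls _ _ _).symm.trans e'⟩), e⟩, rfl⟩
  obtain ⟨α, hα⟩ := exists_iso_of_isQuotientMap hq.isQuotientMap
    (hφl.isOpenMap.isQuotientMap hφc hφs)
    (fun t t' => by
      refine c.cls_eq_iff.trans (Iff.trans ?_ c'.cls_eq_iff.symm)
      constructor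
      · rintro ⟨g, h₁, h₂⟩
        obtain ⟨w, h₃, e, h₄⟩ := c₂₃.lmul_cls_iff.1 h₂
        obtain ⟨k, h₅, h₆⟩ := c₂₃.cls_eq_iff.1 h₄.symm
        exact ⟨k, c₁₂.rmul_cls_iff.2 ⟨w, h₅, h₁.s_eq.trans h₃.r_left.symm,
          c₁₂.cls_eq_iff.2 ⟨g, h₁, h₃⟩⟩, h₆⟩
      · rintro ⟨k, h₁, h₂⟩
        obtain ⟨w, h₃, e, h₄⟩ := c₁₂.rmul_cls_iff.1 h₁
        obtain ⟨g, h₅, h₆⟩ := c₁₂.cls_eq_iff.1 h₄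
        exact ⟨g, h₅, c₂₃.lmul_cls_iff.2 ⟨w, h₆, h₃.s_right.trans h₂.r_eq,
          (c₂₃.cls_eq_iff.2 ⟨k, h₃, h₂⟩).symm⟩⟩)
    (fun t => ((c'.r_cls _ _ _).trans (c₁₂.r_cls _ _ _)).trans (c.r_cls _ _ _).symm)
    (fun t => (c'.s_cls _ _ _).trans ((c.s_cls _ _ _).trans (c₂₃.s_cls _ _ _)).symm)
    (fun h t z hz => by
      obtain ⟨x, hx, e, rfl⟩ := c.lmul_cls_iff.1 hz
      have e' : X₁.s x = X₂.r t.1.2.1.1 := hx.s_eq.trans t.2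
      exact ⟨⟨(x, t.1.2), e'⟩, rfl, c'.lmul_cls_iff.2
        ⟨_, c₁₂.lmul_cls_iff.2 ⟨x, hx, e', rfl⟩, _, rfl⟩⟩)
    (fun t k z hz => by
      obtain ⟨w, hw, e, rfl⟩ := c.rmul_cls_iff.1 hz
      obtain ⟨x, hx, e', rfl⟩ := c₂₃.rmul_cls_iff.1 hw
      exact ⟨⟨(t.1.1, ⟨(t.1.2.1.1, x), e'⟩), t.2⟩, rfl, c'.rmul_cls_iff.2
        ⟨x, hx, _, rfl⟩⟩)
  exact ⟨α, fun x₁ x₂ x₃ e e' => hα ⟨(x₁, ⟨(x₂, x₃), e'⟩), e⟩⟩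

end Composite

@[simp]
theorem id_toFun (X : GroupoidCorr H G) (x : X) : Hom.toFun (𝟙 X) x = x := rfl

@[simp]
theorem comp_toFun {X Y Z : GroupoidCorr H G} (α : X ⟶ Y) (β : Y ⟶ Z) (x : X) :
    Hom.toFun (α ≫ β) x = Hom.toFun β (Hom.toFun α x) := rfl

end GroupoidCorr

/-! ### The bicategory of groupoid correspondences exists -/

/-- The orbit map is surjective, so every 2-arrow out of a composite is determined by its values on
classes, where the axioms are explicit. -/
theorem nonempty_grBicategory : Nonempty GrBicategory.{u} := by
  let T : ∀ {H G K : EtaleGroupoid.{u}} (_ : GroupoidCorr H G) (_ : GroupoidCorr G K),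
    GroupoidCorr H K := fun X Y => X.orbitCorr Y
  let t : ∀ {H G K : EtaleGroupoid.{u}} (X : GroupoidCorr H G) (Y : GroupoidCorr G K),
    X.Composite Y (T X Y) := fun X Y => X.orbitComposite Y
  -- From here on only the `Composite` structure is used, not the orbit-space model.
  clear_value t
  clear_value T
  choose M hM using fun {H G K : EtaleGroupoid.{u}} {X X' : GroupoidCorr H G}
    {Y Y' : GroupoidCorr G K} (α : X ⟶ X') (β : Y ⟶ Y') => (t X Y).exists_hcomp (t X' Y') α β
  choose L hL using fun {H G : EtaleGroupoid.{u}} (X : GroupoidCorr H G) =>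
    (t X (GroupoidCorr.one G)).exists_iso X.rightUnitComposite
  choose R hR using fun {H G : EtaleGroupoid.{u}} (X : GroupoidCorr H G) =>
    (t (GroupoidCorr.one H) X).exists_iso X.leftUnitComposite
  choose P hP using fun {G₁ G₂ G₃ G₄ : EtaleGroupoid.{u}} (X₁ : GroupoidCorr G₁ G₂)
    (X₂ : GroupoidCorr G₂ G₃) (X₃ : GroupoidCorr G₃ G₄) => (t X₁ X₂).exists_associator (t X₂ X₃)
      (t X₁ (T X₂ X₃)) (t (T X₁ X₂) X₃)
  have hP' : ∀ {G₁ G₂ G₃ G₄ : EtaleGroupoid.{u}} (X₁ : GroupoidCorr G₁ G₂)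
      (X₂ : GroupoidCorr G₂ G₃) (X₃ : GroupoidCorr G₃ G₄) x₁ x₂ x₃ (e' : X₂.s x₂ = X₃.r x₃)
      (e : X₁.s x₁ = (T X₂ X₃).r ((t X₂ X₃).cls x₂ x₃ e')),
      GroupoidCorr.Hom.toFun (P X₁ X₂ X₃).hom
          ((t X₁ (T X₂ X₃)).cls x₁ ((t X₂ X₃).cls x₂ x₃ e') e) =
        (t (T X₁ X₂) X₃).cls ((t X₁ X₂).cls x₁ x₂ (e.trans ((t X₂ X₃).r_cls x₂ x₃ e'))) x₃
          (((t X₁ X₂).s_cls _ _ _).trans e') :=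
    fun X₁ X₂ X₃ x₁ x₂ x₃ e' e => hP X₁ X₂ X₃ x₁ x₂ x₃ (e.trans ((t X₂ X₃).r_cls x₂ x₃ e')) e'
  have ext₃ : ∀ {G₁ G₂ G₃ G₄ : EtaleGroupoid.{u}} {X₁ : GroupoidCorr G₁ G₂}
      {X₂ : GroupoidCorr G₂ G₃} {X₃ : GroupoidCorr G₃ G₄} {W : GroupoidCorr G₁ G₄}
      {α β : T X₁ (T X₂ X₃) ⟶ W},
      (∀ x₁ x₂ x₃ (e : X₁.s x₁ = X₂.r x₂) (e' : X₂.s x₂ = X₃.r x₃),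
        GroupoidCorr.Hom.toFun α ((t X₁ (T X₂ X₃)).cls x₁ ((t X₂ X₃).cls x₂ x₃ e')
          (e.trans ((t X₂ X₃).r_cls x₂ x₃ e').symm)) =
        GroupoidCorr.Hom.toFun β ((t X₁ (T X₂ X₃)).cls x₁ ((t X₂ X₃).cls x₂ x₃ e')
          (e.trans ((t X₂ X₃).r_cls x₂ x₃ e').symm))) → α = β := by
    intro G₁ G₂ G₃ G₄ X₁ X₂ X₃ W α β h
    refine (t _ _).hom_ext fun x₁ z e => ?_
    obtain ⟨x₂, x₃, e', rfl⟩ := (t X₂ X₃).exists_rel z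
    exact h x₁ x₂ x₃ (e.trans ((t X₂ X₃).r_cls _ _ _)) e'
  refine ⟨{ comp := fun Y X => T X Y
            whiskerLeft := fun Y _ _ α => M α (𝟙 Y)
            whiskerRight := fun β X => M (𝟙 X) β
            associator := fun X₃ X₂ X₁ => P X₁ X₂ X₃
            leftUnitor := fun X => L X
            rightUnitor := fun X => R X
            whiskerLeft_id := ?_
            whiskerLeft_comp := ?_
            id_whiskerLeft := ?_
            comp_whiskerLeft := ?_
            id_whiskerRight := ?_
            comp_whiskerRight := ?_
            whiskerRight_id := ?_
            whiskerRight_comp := ?_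
            whisker_assoc := ?_
            whisker_exchange := ?_
            pentagon := ?_
            triangle := ?_
            composite := fun X Y => t X Y
            whiskerLeft_cls := fun Y _ _ α => hM α (𝟙 Y)
            whiskerRight_cls := fun β X => hM (𝟙 X) β
            associator_cls := fun X₁ X₂ X₃ => hP X₁ X₂ X₃
            leftUnitor_cls := fun X => hL X
            rightUnitor_cls := fun X => hR X }⟩
  · intro A B C f g
    exact (t _ _).hom_ext fun x y e => by simp [hM]
  · intro A B C f g h i η θ
    exact (t _ _).hom_ext fun x y e => by simp [hM]
  · intro A B f g η
    rw [← Category.assoc, Iso.eq_comp_inv]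
    exact (t _ _).hom_ext fun x y e => by
      simp only [GroupoidCorr.comp_toFun, hM, hL]
      exact (GroupoidCorr.Hom.map_ract _ _ _ _).symm
  · intro A B C D f g h h' η
    rw [← Category.assoc, Iso.eq_comp_inv]
    exact ext₃ fun x y z e e' => by simp [hM, hP']
  · intro A B C f g
    exact (t _ _).hom_ext fun x y e => by simp [hM]
  · intro A B C f g h η θ i
    exact (t _ _).hom_ext fun x y e => by simp [hM]
  · intro A B f g η
    rw [← Category.assoc, Iso.eq_comp_inv]
    exact (t _ _).hom_ext fun x y e => by
      simp only [GroupoidCorr.comp_toFun, hM, hR]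
      exact (GroupoidCorr.Hom.map_lact _ _ _ _).symm
  · intro A B C D f f' η g h
    rw [Iso.eq_inv_comp]
    exact ext₃ fun x y z e e' => by simp [hM, hP']
  · intro A B C D f g g' η h
    rw [← Category.assoc, Iso.eq_comp_inv]
    exact ext₃ fun x y z e e' => by simp [hM, hP']
  · intro A B C f g h i η θ
    exact (t _ _).hom_ext fun x y e => by simp [hM]
  · intro A B C D E f g h i
    refine ext₃ fun x₁ x₂ z e e' => ?_
    obtain ⟨x₃, x₄, e'', rfl⟩ := (t g f).exists_rel z
    simp [hM, hP']
  · intro A B C f g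
    exact ext₃ fun x y z e e' => by
      simp only [GroupoidCorr.comp_toFun, hM, hP', hL, hR]
      -- The triangle axiom is the orbit relation `[x g, y] = [x, g y]`.
      exact ((t g f).cls_eq_iff.2 ⟨y, ⟨e, rfl⟩, e', rfl⟩).symm

/-! ### The homomorphism of bicategories -/

/-- The bicategories of groupoid correspondences and of C*-correspondences exist, and between any
(equivalently, some) models `𝔊` and `ℭ` of them there is a strictly unital homomorphism `F` with
`F.obj G = C*(G)`, `F.map X = C*(X)`, with `F.map₂ α = C*(α)` extending functions by zero along
`α`, with the identity of `𝔖(G)` as unit constraint, and with the unitaries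
`μ_{X,Y} : C*(X) ⊗ C*(Y) ≅ C*(X ∘ Y)` as composition constraints. -/
theorem mainTheorem1 :
    Nonempty GrBicategory.{u} ∧ Nonempty CorrBicategory.{u} ∧
      ∀ (𝔊 : GrBicategory.{u}) (ℭ : CorrBicategory.{u}),
        ∃ (F : StrictlyUnitaryPseudofunctor 𝔊.Ob ℭ.Ob)
          (cstar : ∀ G : 𝔊.Ob,
            GroupoidCStarAlgebra (GrBicategory.gpd G) (CorrBicategory.alg (F.obj G)))
          (cstarCorr : ∀ {G H : 𝔊.Ob} (X : G ⟶ H),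
            GroupoidCStarCorr (GrBicategory.corr X) (cstar H) (cstar G)
              (CorrBicategory.corr (F.map X))),
          (∀ {G H : 𝔊.Ob} {X Y : G ⟶ H} (α : X ⟶ Y) (ξ : SFun (GrBicategory.corr X)),
            ∃ φ : SFun (GrBicategory.corr Y),
              (φ : GrBicategory.corr Y → ℂ) =
                  Function.extend (GrBicategory.fn α) (ξ : GrBicategory.corr X → ℂ) 0 ∧
                CorrBicategory.fn (F.map₂ α) ((cstarCorr X).ι ξ) = (cstarCorr Y).ι φ) ∧
          (∀ (G : 𝔊.Ob) (ξ : SFun (GrBicategory.gpd G).Arr),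
            CorrBicategory.fn (F.mapId G).hom ((cstarCorr (𝟙 G)).ι ξ) = (cstar G).ι ξ) ∧
          (∀ {K G H : 𝔊.Ob} (Y : K ⟶ G) (X : G ⟶ H) (f₁ : SFun (GrBicategory.corr X))
            (f₂ : SFun (GrBicategory.corr Y)),
            ∃ φ : SFun (GrBicategory.corr (Y ≫ X)),
              (∀ x y e, (φ : GrBicategory.corr (Y ≫ X) → ℂ)
                  ((𝔊.composite (GrBicategory.corr X) (GrBicategory.corr Y)).cls x y e) =
                (GrBicategory.corr X).pairing (GrBicategory.corr Y) f₁ f₂ x y e) ∧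
              CorrBicategory.fn (F.mapComp Y X).inv
                  ((ℭ.tensor (CorrBicategory.corr (F.map X)) (CorrBicategory.corr (F.map Y))).tmul
                    ((cstarCorr X).ι f₁) ((cstarCorr Y).ι f₂)) =
                (cstarCorr (Y ≫ X)).ι φ) :=
  ⟨nonempty_grBicategory, nonempty_corrBicategory, exists_homomorphism⟩
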